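/- \textbf{Braids.} Let $B_n$ be the Artin braid group with generators $\sigma_1,\dots,\sigma_{n-1}$ and relations $\sigma_i\sigma_{i+1}\sigma_i=\sigma_{i+1}\sigma_i\sigma_{i+1}$, $\sigma_i\sigma_j=\sigma_j\sigma_i$ ($|i-j|\ge 2$), where in a product $gh$ one runs first through $h$; let $\rho:B_n\to S_n$, $\sigma_i\mapsto(i,i+1)$, and $PB_n=\ker\rho$. Put $x_{i,i+1}=\sigma_i^2$, $x_{13}=\sigma_2\sigma_1^2\sigma_2^{-1}$, and let $F_2=\langle x_{12},x_{23}\rangle\le PB_3$. Let $\varphi_{123},\varphi_{234},\varphi_{12,3,4},\varphi_{1,23,4},\varphi_{1,2,34}:PB_3\to PB_4$ be the homomorphisms that add a strand on the right, add a strand on the left, and double the first, second, third strand, respectively, and let $\varphi_{12},\varphi_{23},\varphi_{12,3},\varphi_{1,23}:PB_2\to PB_3$ be the analogous homomorphisms. \textbf{The poset.} Let $\mathrm{NFI}_{PB_4}(B_4)$ be the set of normal subgroups $N$ of finite index of $B_4$ with $N\le PB_4$, ordered by inclusion. For such $N$ let $N_{PB_3}\le PB_3$ be the intersection of the preimages of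 $N$ under the five maps $PB_3\to PB_4$, let $N_{PB_2}\le PB_2$ be the intersection of the preimages of $N_{PB_3}$ under the four maps $PB_2\to PB_3$, and let $N_{\mathrm{ord}}=[PB_2:N_{PB_2}]$. (These are normal subgroups of finite index in $B_3$ and $B_2$.) Put $N_{PB_4}=N$. \textbf{GT-shadows.} Consider pairs $(m,f)\in\mathbb Z\times PB_3$ satisfying, modulo $N_{PB_3}$, $$\sigma_1x_{12}^m\,f^{-1}\sigma_2x_{23}^m f=f^{-1}\sigma_1\sigma_2(x_{13}x_{23})^m,\qquad f^{-1}\sigma_2x_{23}^mf\,\sigma_1x_{12}^m=\sigma_2\sigma_1(x_{12}x_{13})^mf$$ and, modulo $N$, $$\varphi_{234}(f)\,\varphi_{1,23,4}(f)\,\varphi_{123}(f)=\varphi_{1,2,34}(f)\,\varphi_{12,3,4}(f).$$ Such a pair defines homomorphisms $T^{B_n}_{m,f}:B_n\to B_n/N_{PB_n}$ ($n=2,3,4$): $\sigma_1\mapsto\sigma_1x_{12}^m$; for $n=3$, $\sigma_2\mapsto f^{-1}\sigma_2x_{23}^mf$; for $n=4$, $\sigma_2\mapsto\varphi_{123}(f)^{-1}\sigma_2x_{23}^m\varphi_{123}(f)$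 and $\sigma_3\mapsto\varphi_{12,3,4}(f)^{-1}\sigma_3x_{34}^m\varphi_{12,3,4}(f)$. The class $[(m,f)]\in\mathbb Z/N_{\mathrm{ord}}\times PB_3/N_{PB_3}$ is a \emph{GT-shadow} if in addition the restrictions $PB_n\to PB_n/N_{PB_n}$ of $T^{B_n}_{m,f}$ are onto for $n=2,3,4$. It is \emph{charming} if moreover $fN_{PB_3}$ contains an element of $[F_2,F_2]$ and the restriction $F_2\to F_2/(N_{PB_3}\cap F_2)$ of $T^{B_3}_{m,f}$ is onto. Let $\mathrm{GT}^{\heartsuit}(N)$ be the set of charming GT-shadows. For $K\le N$ in $\mathrm{NFI}_{PB_4}(B_4)$ there is a natural map $\mathrm{GT}^{\heartsuit}(K)\to\mathrm{GT}^{\heartsuit}(N)$, $[(m,f)]\mapsto[(m,f)]$. \textbf{Genuine GT-shadows.} Let $\mathsf{PaB}$ be the operad of parenthesized braids: the objects of the groupoid $\mathsf{PaB}(n)$, $n\ge1$, are the complete parenthesizations of the permutations of $1,\dots,n$, and the morphisms between two objects are the braids in $B_n$ that connect equal labels; $S_n$ acts by relabelling, and $\gamma\circ_i\eta$ replaces the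 strand of $\gamma$ that originates at the label $i$ by a thin copy of $\eta$. The profinite completion $\widehat{\mathsf{PaB}}$ (arity by arity, the limit of the finite quotients of $\mathsf{PaB}(n)$ by equivalence relations that relate only parallel morphisms and are compatible with composition) is an operad in topological groupoids; let $\widehat{\mathrm{GT}}$ be the group of its continuous automorphisms which are the identity on objects. Let $\beta:12\to21$ and $\alpha:(12)3\to1(23)$ be the morphisms of $\mathsf{PaB}$ with the braids $\sigma_1$ and $1$. A GT-shadow $[(m,f)]$ with target $N$ is \emph{genuine} if there is $\hat T\in\widehat{\mathrm{GT}}$ such that the image of $\hat T(\beta)$ in $\mathsf{PaB}(2)/{\sim_N}$ is the class of $\beta\cdot x_{12}^m$ and the image of $\hat T(\alpha)$ in $\mathsf{PaB}(3)/{\sim_N}$ is the class of $\alpha\cdot f$; here $\gamma\sim_N\gamma'$ for parallel morphisms $\gamma,\gamma'$ of $\mathsf{PaB}(n)$ if the braid of $\gamma^{-1}\gamma'$ lies in $N_{PB_n}$. \textbf{Corollary.} Let $N\in\mathrm{NFI}_{PB_4}(B_4)$ and $[(m,f)]\in\mathrm{GT}^{\heartsuit}(N)$. Then $[(m,f)]$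 is genuine if and only if, for every $K\in\mathrm{NFI}_{PB_4}(B_4)$ with $K\le N$, $[(m,f)]$ lies in the image of the natural map $\mathrm{GT}^{\heartsuit}(K)\to\mathrm{GT}^{\heartsuit}(N)$. -/

import Mathlib

namespace GTSh

/-- `s 0, s 1, …, s (N-2)` satisfy the braid relations of the braid group on `N` strands. -/
structure IsBraid {G : Type*} [Group G] (N : ℕ) (s : ℕ → G) : Prop where
  comm : ∀ i j, i + 2 ≤ j → j + 1 < N → s i * s j = s j * s i
  braid : ∀ i, i + 2 < N → s i * s (i + 1) * s i = s (i + 1) * s i * s (i + 1)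

/-- `up s j m = s j * s (j+1) * ⋯ * s (j+m-1)`. -/
def up {G : Type*} [Group G] (s : ℕ → G) (j : ℕ) : ℕ → G
  | 0 => 1
  | m + 1 => up s j m * s (j + m)

/-- `dn s j m = s (j+m-1) * ⋯ * s (j+1) * s j`. -/
def dn {G : Type*} [Group G] (s : ℕ → G) (j : ℕ) : ℕ → G
  | 0 => 1
  | m + 1 => s (j + m) * dn s j m

namespace IsBraid

variable {G : Type*} [Group G] {N : ℕ} {s : ℕ → G}

theorem up_comm (h : IsBraid N s) {j i : ℕ} : ∀ {m : ℕ},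
    (i + 2 ≤ j ∧ j + m < N ∨ j + m < i ∧ i + 1 < N) → up s j m * s i = s i * up s j m
  | 0, _ => by simp [up]
  | m + 1, hi => by
    have ih := h.up_comm (j := j) (i := i) (m := m) (by omega)
    have hc : s (j + m) * s i = s i * s (j + m) := by
      rcases hi with hi | hi
      · exact (h.comm i (j + m) (by omega) (by omega)).symm
      · exact h.comm (j + m) i (by omega) (by omega)
    rw [up, mul_assoc, hc, ← mul_assoc, ih, mul_assoc]

theorem dn_comm (h : IsBraid N s) {j i : ℕ} : ∀ {m : ℕ},
    (i + 2 ≤ j ∧ j + m < N ∨ j + m < i ∧ i + 1 < N) → dn s j m * s i = s i * dn s j m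
  | 0, _ => by simp [dn]
  | m + 1, hi => by
    have ih := h.dn_comm (j := j) (i := i) (m := m) (by omega)
    have hc : s (j + m) * s i = s i * s (j + m) := by
      rcases hi with hi | hi
      · exact (h.comm i (j + m) (by omega) (by omega)).symm
      · exact h.comm (j + m) i (by omega) (by omega)
    rw [dn, mul_assoc, ih, ← mul_assoc, hc, mul_assoc]

theorem up_shift (h : IsBraid N s) {j i : ℕ} : ∀ {m : ℕ}, j ≤ i → i + 1 < j + m → j + m < N →
    up s j m * s i = s (i + 1) * up s j m
  | 0, _, h2, _ => by omega
  | m + 1, h1, h2, h3 => by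
    by_cases hi : i + 1 < j + m
    · have ih := h.up_shift (j := j) (i := i) (m := m) h1 hi (by omega)
      rw [up, mul_assoc, ← h.comm i (j + m) (by omega) (by omega), ← mul_assoc, ih, mul_assoc]
    · obtain ⟨m, rfl⟩ : ∃ m', m = m' + 1 := ⟨m - 1, by omega⟩
      obtain rfl : i = j + m := by omega
      have hc := h.up_comm (j := j) (i := j + m + 1) (m := m) (by omega)
      have hb := h.braid (j + m) (by omega)
      rw [up, up, show j + (m + 1) = j + m + 1 by omega]
      calc up s j m * s (j + m) * s (j + m + 1) * s (j + m)
          = up s j m * (s (j + m) * s (j + m + 1) * s (j + m)) := by group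
        _ = up s j m * s (j + m + 1) * (s (j + m) * s (j + m + 1)) := by rw [hb]; group
        _ = _ := by rw [hc]; group

theorem dn_shift (h : IsBraid N s) {j i : ℕ} : ∀ {m : ℕ}, j ≤ i → i + 1 < j + m → j + m < N →
    dn s j m * s (i + 1) = s i * dn s j m
  | 0, _, h2, _ => by omega
  | m + 1, h1, h2, h3 => by
    by_cases hi : i + 1 < j + m
    · have ih := h.dn_shift (j := j) (i := i) (m := m) h1 hi (by omega)
      rw [dn, mul_assoc, ih, ← mul_assoc, ← h.comm i (j + m) (by omega) (by omega), mul_assoc]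
    · obtain ⟨m, rfl⟩ : ∃ m', m = m' + 1 := ⟨m - 1, by omega⟩
      obtain rfl : i = j + m := by omega
      have hc := h.dn_comm (j := j) (i := j + m + 1) (m := m) (by omega)
      have hb := h.braid (j + m) (by omega)
      rw [dn, dn, show j + (m + 1) = j + m + 1 by omega]
      calc s (j + m + 1) * (s (j + m) * dn s j m) * s (j + m + 1)
          = s (j + m + 1) * s (j + m) * (dn s j m * s (j + m + 1)) := by group
        _ = (s (j + m + 1) * s (j + m) * s (j + m + 1)) * dn s j m := by rw [hc]; group
        _ = _ := by rw [← hb]; group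

theorem up_succ' (s : ℕ → G) (j : ℕ) : ∀ m, up s j (m + 1) = s j * up s (j + 1) m
  | 0 => by simp [up]
  | m + 1 => by rw [up, up_succ' s j m, up, mul_assoc, show j + 1 + m = j + (m + 1) by omega]

theorem dn_succ' (s : ℕ → G) (j : ℕ) : ∀ m, dn s j (m + 1) = dn s (j + 1) m * s j
  | 0 => by simp [dn]
  | m + 1 => by rw [dn, dn_succ' s j m, dn, mul_assoc, show j + 1 + m = j + (m + 1) by omega]

theorem up_up (h : IsBraid N s) {j l m : ℕ} : ∀ {r : ℕ}, j ≤ l → l + r < j + m → j + m < N →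
    up s j m * up s l r = up s (l + 1) r * up s j m
  | 0, _, _, _ => by simp [up]
  | r + 1, h1, h2, h3 => by
    rw [up, ← mul_assoc, h.up_up h1 (by omega) h3, mul_assoc,
      h.up_shift (by omega) (by omega) h3, ← mul_assoc, up, show l + 1 + r = l + r + 1 by omega]

theorem up_dn (h : IsBraid N s) {j l m : ℕ} : ∀ {r : ℕ}, j ≤ l → l + r < j + m → j + m < N →
    up s j m * dn s l r = dn s (l + 1) r * up s j m
  | 0, _, _, _ => by simp [dn]
  | r + 1, h1, h2, h3 => by
    rw [dn, ← mul_assoc, h.up_shift (by omega) (by omega) h3, mul_assoc,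
      h.up_dn h1 (by omega) h3, ← mul_assoc, dn, show l + 1 + r = l + r + 1 by omega]

theorem dn_dn (h : IsBraid N s) {j l m : ℕ} : ∀ {r : ℕ}, j ≤ l → l + r < j + m → j + m < N →
    dn s j m * dn s (l + 1) r = dn s l r * dn s j m
  | 0, _, _, _ => by simp [dn]
  | r + 1, h1, h2, h3 => by
    rw [dn, show l + 1 + r = l + r + 1 by omega, ← mul_assoc,
      h.dn_shift (by omega) (by omega) h3, mul_assoc,
      h.dn_dn h1 (by omega) h3, ← mul_assoc, dn]

end IsBraid

/-! ### Braid groups -/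

/-- The relations of the Artin presentation of the braid group on `n` strands; the generators
`σ_1, …, σ_{n-1}` are numbered from `0` here. -/
def braidRels (n : ℕ) : Set (FreeGroup {i : ℕ // i + 1 < n}) :=
  {w | ∃ i j : {i : ℕ // i + 1 < n}, i.1 + 2 ≤ j.1 ∧
      w = .of i * .of j * (.of i)⁻¹ * (.of j)⁻¹} ∪
  {w | ∃ i j : {i : ℕ // i + 1 < n}, i.1 + 1 = j.1 ∧
      w = .of i * .of j * .of i * (.of j)⁻¹ * (.of i)⁻¹ * (.of j)⁻¹}

/-- The Artin braid group `B_n`. -/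
abbrev Braid (n : ℕ) : Type := PresentedGroup (braidRels n)

namespace Braid

/-- The standard generator `σ_{i+1}` of `B_n` for `i + 1 < n` (and `1` otherwise). -/
def sg (n i : ℕ) : Braid n := if h : i + 1 < n then PresentedGroup.of ⟨i, h⟩ else 1

theorem sg_of {n i : ℕ} (h : i + 1 < n) : sg n i = PresentedGroup.of ⟨i, h⟩ := dif_pos h

theorem isBraid_sg (n : ℕ) : IsBraid n (sg n) where
  comm i j h1 h2 := by
    rw [sg_of h2, sg_of (show i + 1 < n by omega)]
    have := PresentedGroup.one_of_mem (rels := braidRels n)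
      (Or.inl ⟨⟨i, by omega⟩, ⟨j, h2⟩, h1, rfl⟩)
    simp only [map_mul, map_inv] at this
    exact (mul_inv_eq_iff_eq_mul.mp (mul_inv_eq_one.mp this))
  braid i h := by
    rw [sg_of (show i + 1 < n by omega), sg_of (show i + 1 + 1 < n by omega)]
    have := PresentedGroup.one_of_mem (rels := braidRels n)
      (Or.inr ⟨⟨i, by omega⟩, ⟨i + 1, h⟩, rfl, rfl⟩)
    simp only [map_mul, map_inv] at this
    have := mul_inv_eq_iff_eq_mul.mp (mul_inv_eq_iff_eq_mul.mp (mul_inv_eq_one.mp this))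
    exact this

/-- The homomorphism out of `B_n` with prescribed values on the generators. -/
def lift {G : Type*} [Group G] {n : ℕ} (s : ℕ → G) (hs : IsBraid n s) : Braid n →* G :=
  PresentedGroup.toGroup (f := fun i => s i.1) (by
    rintro w (⟨i, j, h, rfl⟩ | ⟨i, j, h, rfl⟩)
    · simp [hs.comm i.1 j.1 h j.2]
    · have := hs.braid i.1 (by have := j.2; omega)
      rw [h] at this
      simp [this])

theorem lift_sg {G : Type*} [Group G] {n : ℕ} {s : ℕ → G} (hs : IsBraid n s) {i : ℕ}
    (h : i + 1 < n) : lift s hs (sg n i) = s i := by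
  rw [sg_of h]
  exact PresentedGroup.toGroup.of _

theorem induction {n : ℕ} {P : Braid n → Prop} (one : P 1) (gen : ∀ i, i + 1 < n → P (sg n i))
    (mul : ∀ x y, P x → P y → P (x * y)) (inv : ∀ x, P x → P x⁻¹) (x : Braid n) : P x := by
  have hx : x ∈ Subgroup.closure (Set.range (PresentedGroup.of (rels := braidRels n))) := by
    rw [PresentedGroup.closure_range_of]; trivial
  induction hx using Subgroup.closure_induction with
  | mem x hx => obtain ⟨i, rfl⟩ := hx; rw [← sg_of i.2]; exact gen _ i.2
  | one => exact one
  | mul x y _ _ hx hy => exact mul x y hx hy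
  | inv x _ hx => exact inv x hx

theorem hom_ext {G : Type*} [Group G] {n : ℕ} {φ ψ : Braid n →* G}
    (h : ∀ i, i + 1 < n → φ (sg n i) = ψ (sg n i)) : φ = ψ :=
  MonoidHom.ext (induction (by simp) h (by simp +contextual) (by simp +contextual))

/-- The transposition `(i+1, i+2)` of the `n` strands, i.e. `(i, i+1)` when numbered from `0`. -/
def adjSwap (n i : ℕ) : Equiv.Perm (Fin n) :=
  if h : i + 1 < n then Equiv.swap ⟨i, by omega⟩ ⟨i + 1, h⟩ else 1

theorem adjSwap_val {n i : ℕ} (h : i + 1 < n) (x : Fin n) :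
    (adjSwap n i x).1 = if x.1 = i then i + 1 else if x.1 = i + 1 then i else x.1 := by
  rw [adjSwap, dif_pos h, Equiv.swap_apply_def]
  simp only [Fin.ext_iff]
  split_ifs <;> simp

/-- `q` is the image of `p` under the transposition of `j` and `j + 1`. -/
def IsSwap (j p q : ℕ) : Prop :=
  (p = j ∧ q = j + 1) ∨ (p = j + 1 ∧ q = j) ∨ (p ≠ j ∧ p ≠ j + 1 ∧ q = p)

theorem isSwap_adjSwap {n i : ℕ} (h : i + 1 < n) (x : Fin n) : IsSwap i x (adjSwap n i x) := by
  have := adjSwap_val h x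
  unfold IsSwap
  split_ifs at this <;> omega

theorem isBraid_adjSwap (n : ℕ) : IsBraid n (adjSwap n) where
  comm i j h1 h2 := by
    have h1' : i + 1 < n := by omega
    ext x
    have e1 := isSwap_adjSwap h2 x
    have e2 := isSwap_adjSwap h1' x
    have e3 := isSwap_adjSwap h1' (adjSwap n j x)
    have e4 := isSwap_adjSwap h2 (adjSwap n i x)
    unfold IsSwap at e1 e2 e3 e4
    rw [Equiv.Perm.mul_apply, Equiv.Perm.mul_apply]
    omega
  braid i h := by
    have h' : i + 1 < n := by omega
    ext x
    have e1 := isSwap_adjSwap h' x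
    have e2 := isSwap_adjSwap h (adjSwap n i x)
    have e3 := isSwap_adjSwap h' (adjSwap n (i + 1) (adjSwap n i x))
    have e4 := isSwap_adjSwap h x
    have e5 := isSwap_adjSwap h' (adjSwap n (i + 1) x)
    have e6 := isSwap_adjSwap h (adjSwap n i (adjSwap n (i + 1) x))
    unfold IsSwap at e1 e2 e3 e4 e5 e6
    simp only [Equiv.Perm.mul_apply]
    omega

/-- The standard homomorphism `ρ : B_n → S_n`: `ρ g p` is the position at which the strand of `g`
that originates at the position `p` ends (in `g * h` one runs first through `h`, then through
`g`). -/
def rho (n : ℕ) : Braid n →* Equiv.Perm (Fin n) := lift (adjSwap n) (isBraid_adjSwap n)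

theorem rho_sg {n i : ℕ} (h : i + 1 < n) : rho n (sg n i) = adjSwap n i := lift_sg _ h

/-- The pure braid group `PB_n`. -/
def PB (n : ℕ) : Subgroup (Braid n) := (rho n).ker

/-- The homomorphism `B_m → B_N` that puts a braid on the `m` consecutive strands
`p, …, p + m - 1` (numbered from `0`). -/
def shift {m N : ℕ} (p : ℕ) (h : p + m ≤ N) : Braid m →* Braid N :=
  lift (fun i => sg N (p + i))
    { comm := fun i j h1 h2 => (isBraid_sg N).comm _ _ (by omega) (by omega)
      braid := fun i h1 => (isBraid_sg N).braid (p + i) (by omega) }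

theorem shift_sg {m N p i : ℕ} (h : p + m ≤ N) (hi : i + 1 < m) :
    shift p h (sg m i) = sg N (p + i) := lift_sg _ hi

/-! ### Cabling -/

/-- The braid obtained from the generator `σ_{j+1}` of `B_n` by replacing the strand originating
at the position `p` (from `0`) by `k + 1` parallel strands. -/
def cableGen (n k j p : ℕ) : Braid (n + k) :=
  if p < j then sg (n + k) (j + k)
  else if p = j then up (sg (n + k)) j (k + 1)
  else if p = j + 1 then dn (sg (n + k)) j (k + 1)
  else sg (n + k) j

theorem cableGen_lt {n k j p : ℕ} (h : p < j) : cableGen n k j p = sg (n + k) (j + k) := if_pos h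

theorem cableGen_eq {n k j p : ℕ} (h : p = j) :
    cableGen n k j p = up (sg (n + k)) j (k + 1) := by
  rw [cableGen, if_neg (by omega), if_pos h]

theorem cableGen_eq' {n k j p : ℕ} (h : p = j + 1) :
    cableGen n k j p = dn (sg (n + k)) j (k + 1) := by
  rw [cableGen, if_neg (by omega), if_neg (by omega), if_pos h]

theorem cableGen_gt {n k j p : ℕ} (h : j + 1 < p) : cableGen n k j p = sg (n + k) j := by
  rw [cableGen, if_neg (by omega), if_neg (by omega), if_neg (by omega)]

/-- The action of `σ_{j+1}` on pairs (position of the cabled strand, braid composed so far). -/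
def cablePerm (n k j : ℕ) : Equiv.Perm (Fin n × Braid (n + k)) :=
  (Equiv.prodShear (adjSwap n j) fun p => Equiv.mulLeft (cableGen n k j p))

theorem cablePerm_apply (n k j : ℕ) (x : Fin n × Braid (n + k)) :
    cablePerm n k j x = (adjSwap n j x.1, cableGen n k j x.1 * x.2) := rfl

theorem cableGen_comm {n k i j p q r : ℕ} (h1 : i + 2 ≤ j) (h2 : j + 1 < n) (hp : p < n)
    (hq : IsSwap j p q)
    (hr : IsSwap i p r) :
    cableGen n k i q * cableGen n k j p = cableGen n k j r * cableGen n k i p := by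
  have hs := isBraid_sg (n + k)
  unfold IsSwap at hq hr
  rcases (by omega : p < i ∨ p = i ∨ p = i + 1 ∨ (i + 1 < p ∧ p < j) ∨ p = j ∨ p = j + 1 ∨
    j + 1 < p) with c | c | c | c | c | c | c
  · rw [cableGen_lt (show q < i by omega), cableGen_lt (show p < j by omega),
      cableGen_lt (show r < j by omega), cableGen_lt c]
    exact hs.comm _ _ (by omega) (by omega)
  · rw [cableGen_eq (show q = i by omega), cableGen_lt (show p < j by omega),
      cableGen_lt (show r < j by omega), cableGen_eq c]
    exact hs.up_comm (by omega)
  · rw [cableGen_eq' (show q = i + 1 by omega), cableGen_lt (show p < j by omega),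
      cableGen_lt (show r < j by omega), cableGen_eq' c]
    exact hs.dn_comm (by omega)
  · rw [cableGen_gt (show i + 1 < q by omega), cableGen_lt (show p < j by omega),
      cableGen_lt (show r < j by omega), cableGen_gt c.1]
    exact hs.comm _ _ (by omega) (by omega)
  · rw [cableGen_gt (show i + 1 < q by omega), cableGen_eq c,
      cableGen_eq (show r = j by omega), cableGen_gt (show i + 1 < p by omega)]
    exact (hs.up_comm (by omega)).symm
  · rw [cableGen_gt (show i + 1 < q by omega), cableGen_eq' c,
      cableGen_eq' (show r = j + 1 by omega), cableGen_gt (show i + 1 < p by omega)]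
    exact (hs.dn_comm (by omega)).symm
  · rw [cableGen_gt (show i + 1 < q by omega), cableGen_gt c,
      cableGen_gt (show j + 1 < r by omega), cableGen_gt (show i + 1 < p by omega)]
    exact hs.comm _ _ (by omega) (by omega)

theorem cableGen_braid {n k j p q q' r r' : ℕ} (h : j + 2 < n)
    (hq : IsSwap j p q)
    (hq' : IsSwap (j + 1) q q')
    (hr : IsSwap (j + 1) p r)
    (hr' : IsSwap j r r') :
    cableGen n k j q' * cableGen n k (j + 1) q * cableGen n k j p =
      cableGen n k (j + 1) r' * cableGen n k j r * cableGen n k (j + 1) p := by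
  have hs := isBraid_sg (n + k)
  unfold IsSwap at hq hq' hr hr'
  have eu : up (sg (n + k)) j (k + 1) * sg (n + k) (j + 1 + k) = up (sg (n + k)) j (k + 2) := by
    rw [show j + 1 + k = j + (k + 1) by omega]; rfl
  have ed : sg (n + k) (j + 1 + k) * dn (sg (n + k)) j (k + 1) = dn (sg (n + k)) j (k + 2) := by
    rw [show j + 1 + k = j + (k + 1) by omega]; rfl
  have eu' := IsBraid.up_succ' (sg (n + k)) j (k + 1)
  have ed' := IsBraid.dn_succ' (sg (n + k)) j (k + 1)
  rcases (by omega : p < j ∨ p = j ∨ p = j + 1 ∨ p = j + 2 ∨ j + 2 < p) with c | c | c | c | c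
  · obtain ⟨rfl, rfl, rfl, rfl⟩ : q = p ∧ q' = p ∧ r = p ∧ r' = p := by omega
    rw [cableGen_lt c, cableGen_lt (show r' < j + 1 by omega), show j + 1 + k = j + k + 1 by omega]
    exact hs.braid _ (by omega)
  · obtain ⟨rfl, rfl, rfl, rfl⟩ : q = j + 1 ∧ q' = j + 2 ∧ r = j ∧ r' = j + 1 := by omega
    rw [c, cableGen_gt (show r + 1 < r + 2 by omega), cableGen_eq (show r + 1 = r + 1 from rfl),
      cableGen_eq (show r = r from rfl), cableGen_lt (show r < r + 1 by omega),
      mul_assoc (up _ (r + 1) _), eu, ← eu']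
    exact hs.up_up le_rfl (by omega) (by omega)
  · obtain ⟨rfl, rfl, rfl, rfl⟩ : q = j ∧ q' = j ∧ r = j + 2 ∧ r' = j + 2 := by omega
    rw [c, cableGen_eq (show q' = q' from rfl), cableGen_lt (show q' < q' + 1 by omega),
      cableGen_eq' (show q' + 1 = q' + 1 from rfl), cableGen_eq' (show q' + 2 = q' + 1 + 1 from rfl),
      cableGen_gt (show q' + 1 < q' + 2 by omega), cableGen_eq (show q' + 1 = q' + 1 from rfl),
      mul_assoc (dn _ _ _), eu, ← eu']
    exact hs.up_dn le_rfl (by omega) (by omega)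
  · obtain ⟨rfl, rfl, rfl, rfl⟩ : q = j + 2 ∧ q' = j + 1 ∧ r = j + 1 ∧ r' = j := by omega
    rw [c, cableGen_eq' (show r' + 1 = r' + 1 from rfl),
      cableGen_eq' (show r' + 2 = r' + 1 + 1 from rfl),
      cableGen_gt (show r' + 1 < r' + 2 by omega), cableGen_lt (show r' < r' + 1 by omega),
      mul_assoc, ← ed', ed]
    exact (hs.dn_dn le_rfl (by omega) (by omega)).symm
  · obtain ⟨rfl, rfl, rfl, rfl⟩ : q = p ∧ q' = p ∧ r = p ∧ r' = p := by omega
    rw [cableGen_gt (show j + 1 < r' by omega), cableGen_gt (show j + 1 + 1 < r' by omega)]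
    exact hs.braid _ (by omega)

theorem isBraid_cablePerm (n k : ℕ) : IsBraid n (cablePerm n k) where
  comm i j h1 h2 := by
    have hs := isBraid_sg (n + k)
    refine Equiv.ext fun ⟨p, b⟩ => Prod.ext ?_ ?_
    · exact congrArg (· p) ((isBraid_adjSwap n).comm i j h1 h2)
    · have hp := p.2
      have e1 := isSwap_adjSwap h2 p
      have e2 := isSwap_adjSwap (show i + 1 < n by omega) p
      have H := cableGen_comm (k := k) h1 h2 hp e1 e2
      simp only [Equiv.Perm.mul_apply, cablePerm_apply, ← mul_assoc, H]
  braid j h := by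
    have hs := isBraid_sg (n + k)
    refine Equiv.ext fun ⟨p, b⟩ => Prod.ext ?_ ?_
    · exact congrArg (· p) ((isBraid_adjSwap n).braid j h)
    · have hp := p.2
      have h' : j + 1 < n := by omega
      have e1 := isSwap_adjSwap h' p
      have e2 := isSwap_adjSwap h p
      have e3 := isSwap_adjSwap h (adjSwap n j p)
      have e4 := isSwap_adjSwap h' (adjSwap n (j + 1) p)
      have H := cableGen_braid (n := n) (k := k) (j := j) (p := p) h e1 e3 e2 e4
      simp only [Equiv.Perm.mul_apply, cablePerm_apply, ← mul_assoc, H]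

/-- `B_n` acting on pairs (position of the cabled strand, braid composed so far). -/
def cableHom (n k : ℕ) : Braid n →* Equiv.Perm (Fin n × Braid (n + k)) :=
  lift (cablePerm n k) (isBraid_cablePerm n k)

/-- The braid in `B_{n+k}` obtained from `g ∈ B_n` by replacing the strand that originates at the
position `p` by `k + 1` parallel strands. -/
def cable {n : ℕ} (k : ℕ) (p : Fin n) (g : Braid n) : Braid (n + k) := (cableHom n k g (p, 1)).2

theorem cableHom_apply {n k : ℕ} (g : Braid n) :
    ∀ (p : Fin n) (b : Braid (n + k)), cableHom n k g (p, b) = (rho n g p, cable k p g * b) := by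
  induction g using induction with
  | one => intro p b; simp [cable]
  | gen i hi =>
    intro p b
    simp [cable, cableHom, lift_sg _ hi, rho_sg hi, cablePerm_apply]
  | mul x y hx hy =>
    intro p b
    rw [cable, map_mul, Equiv.Perm.mul_apply, Equiv.Perm.mul_apply, hy p b, hy p 1, hx, hx]
    simp [mul_assoc]
  | inv x hx =>
    have key : ∀ p (b : Braid (n + k)), cableHom n k x⁻¹ (p, b) =
        ((rho n x)⁻¹ p, (cable k ((rho n x)⁻¹ p) x)⁻¹ * b) := by
      intro p b
      rw [map_inv, Equiv.Perm.inv_eq_iff_eq, hx]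
      simp
    intro p b
    rw [cable, key p b, key p 1]
    simp

theorem cable_one {n k : ℕ} (p : Fin n) : cable k p (1 : Braid n) = 1 := by simp [cable]

theorem cable_sg {n k i : ℕ} (hi : i + 1 < n) (p : Fin n) :
    cable k p (sg n i) = cableGen n k i p := by
  simp [cable, cableHom, lift_sg _ hi, cablePerm_apply]

theorem cable_mul {n k : ℕ} (p : Fin n) (g h : Braid n) :
    cable k p (g * h) = cable k (rho n h p) g * cable k p h := by
  rw [cable, map_mul, Equiv.Perm.mul_apply, cableHom_apply h, cableHom_apply g]
  simp

theorem cable_inv {n k : ℕ} (p : Fin n) (g : Braid n) :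
    cable k p g⁻¹ = (cable k ((rho n g)⁻¹ p) g)⁻¹ := by
  rw [eq_inv_iff_mul_eq_one]
  have := cable_mul (k := k) ((rho n g)⁻¹ p) g⁻¹ g
  rw [inv_mul_cancel, cable_one, ← Equiv.Perm.mul_apply, mul_inv_cancel,
    Equiv.Perm.one_apply] at this
  exact this.symm

/-- The homomorphism `B_{k+1} → B_{n+k}` that puts a braid on the `k + 1` strands which replace the
strand at the position `p`. -/
def blockShift {n : ℕ} (k : ℕ) (p : Fin n) : Braid (k + 1) →* Braid (n + k) :=
  shift p.1 (by omega)

theorem blockShift_sg {n k i : ℕ} (p : Fin n) (hi : i + 1 < k + 1) :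
    blockShift k p (sg (k + 1) i) = sg (n + k) (p + i) := shift_sg _ hi

/-- A cabled strand may be braided internally before or after. -/
theorem cable_mul_shift {n k : ℕ} (g : Braid n) : ∀ (p : Fin n) (h : Braid (k + 1)),
    cable k p g * blockShift k p h = blockShift k (rho n g p) h * cable k p g := by
  have hs := isBraid_sg (n + k)
  induction g using induction with
  | one => simp [cable_one]
  | gen j hj =>
    intro p h
    induction h using induction with
    | one => simp
    | gen t ht =>
      have e := isSwap_adjSwap hj p
      have hp := p.2
      rw [blockShift_sg _ ht, blockShift_sg _ ht, cable_sg hj, rho_sg hj]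
      unfold IsSwap at e
      rcases (by omega : p.1 < j ∨ p.1 = j ∨ p.1 = j + 1 ∨ j + 1 < p.1) with c | c | c | c
      · rw [show (adjSwap n j p).1 = p by omega, cableGen_lt c]
        exact (hs.comm _ _ (by omega) (by omega)).symm
      · rw [show (adjSwap n j p).1 = j + 1 by omega, cableGen_eq c, c, Nat.add_right_comm]
        exact hs.up_shift (by omega) (by omega) (by omega)
      · rw [show (adjSwap n j p).1 = j by omega, cableGen_eq' c, c, Nat.add_right_comm]
        exact hs.dn_shift (by omega) (by omega) (by omega)
      · rw [show (adjSwap n j p).1 = p by omega, cableGen_gt c]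
        exact hs.comm _ _ (by omega) (by omega)
    | mul x y hx hy => rw [map_mul, map_mul, ← mul_assoc, hx, mul_assoc, hy, mul_assoc]
    | inv x hx => rw [map_inv, map_inv, mul_inv_eq_iff_eq_mul, mul_assoc, hx, inv_mul_cancel_left]
  | mul x y hx hy =>
    intro p h
    rw [cable_mul, mul_assoc, hy, ← mul_assoc, hx, map_mul, Equiv.Perm.mul_apply, mul_assoc]
  | inv x hx =>
    intro p h
    have := hx ((rho n x)⁻¹ p) h
    rw [← Equiv.Perm.mul_apply, mul_inv_cancel, Equiv.Perm.one_apply] at this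
    rw [cable_inv, map_inv, inv_mul_eq_iff_eq_mul, ← mul_assoc, this, mul_inv_cancel_right]

/-! ### Permutations of blocks -/

/-- Substituting a block of `k + 1` positions for the position `p` of `n` positions. -/
def blockEquiv {n : ℕ} (k : ℕ) (p : Fin n) : {x : Fin n // x ≠ p} ⊕ Fin (k + 1) ≃ Fin (n + k) where
  toFun
    | .inl x => ⟨if x.1.1 < p.1 then x.1.1 else x.1.1 + k, by split_ifs <;> omega⟩
    | .inr y => ⟨p.1 + y.1, by omega⟩
  invFun z :=
    if h1 : z.1 < p.1 then .inl ⟨⟨z.1, by omega⟩, by simp [Fin.ext_iff]; omega⟩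
    else if h2 : z.1 ≤ p.1 + k then .inr ⟨z.1 - p.1, by omega⟩
    else .inl ⟨⟨z.1 - k, by omega⟩, by simp [Fin.ext_iff]; omega⟩
  left_inv := by
    rintro (⟨x, hx⟩ | y)
    · have hx' : x.1 ≠ p.1 := fun h => hx (Fin.ext h)
      by_cases h : x.1 < p.1
      · simp [h]
      · have h3 : ¬ x.1 + k < p.1 := by omega
        have h4 : ¬ x.1 ≤ p.1 := by omega
        simp [h, h3, h4]
    · have : y.1 ≤ k := by omega
      simp [this]
  right_inv z := by
    by_cases h1 : z.1 < p.1
    · simp [h1]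
    · by_cases h2 : z.1 ≤ p.1 + k
      · simp only [h1, h2, dite_true, dite_false, Fin.ext_iff]; omega
      · have h3 : ¬ z.1 - k < p.1 := by omega
        simp only [h1, h2, h3, dite_false, if_false, Fin.ext_iff]; omega

/-- The permutation of `n + k` positions that permutes by `σ` the `n` positions of which the
`p`-th is replaced by a block of `k + 1` positions, and permutes this block internally by `τ`. -/
def blockPerm {n k : ℕ} (σ : Equiv.Perm (Fin n)) (p : Fin n) (τ : Equiv.Perm (Fin (k + 1))) :
    Equiv.Perm (Fin (n + k)) :=
  (blockEquiv k p).symm.trans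
    ((Equiv.sumCongr (σ.subtypeEquiv (p := (· ≠ p)) (q := (· ≠ σ p)) (by simp)) τ).trans
      (blockEquiv k (σ p)))

theorem blockPerm_inl {n k : ℕ} (σ : Equiv.Perm (Fin n)) (p : Fin n)
    (τ : Equiv.Perm (Fin (k + 1))) (x : {x : Fin n // x ≠ p}) :
    blockPerm σ p τ (blockEquiv k p (.inl x)) =
      blockEquiv k (σ p) (.inl ⟨σ x, fun h => x.2 (σ.injective h)⟩) := by
  simp only [blockPerm, Equiv.trans_apply, Equiv.symm_apply_apply, Equiv.sumCongr_apply,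
    Sum.map_inl, Equiv.subtypeEquiv_apply]

theorem blockPerm_inr {n k : ℕ} (σ : Equiv.Perm (Fin n)) (p : Fin n)
    (τ : Equiv.Perm (Fin (k + 1))) (y : Fin (k + 1)) :
    blockPerm σ p τ (blockEquiv k p (.inr y)) = blockEquiv k (σ p) (.inr (τ y)) := by
  simp only [blockPerm, Equiv.trans_apply, Equiv.symm_apply_apply, Equiv.sumCongr_apply,
    Sum.map_inr]

theorem blockPerm_one {n k : ℕ} (p : Fin n) :
    blockPerm (1 : Equiv.Perm (Fin n)) p (1 : Equiv.Perm (Fin (k + 1))) = 1 := by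
  refine Equiv.ext fun z => ?_
  obtain ⟨w, rfl⟩ := (blockEquiv k p).surjective z
  rcases w with x | y
  · rw [blockPerm_inl]; rfl
  · rw [blockPerm_inr]; rfl

theorem blockPerm_mul {n k : ℕ} (σ σ' : Equiv.Perm (Fin n)) (p : Fin n)
    (τ τ' : Equiv.Perm (Fin (k + 1))) :
    blockPerm (σ' * σ) p (τ' * τ) = blockPerm σ' (σ p) τ' * blockPerm σ p τ := by
  refine Equiv.ext fun z => ?_
  obtain ⟨w, rfl⟩ := (blockEquiv k p).surjective z
  rw [Equiv.Perm.mul_apply]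
  rcases w with x | y
  · rw [blockPerm_inl, blockPerm_inl, blockPerm_inl]; rfl
  · rw [blockPerm_inr, blockPerm_inr, blockPerm_inr]; rfl

theorem blockPerm_inv_mul {n k : ℕ} {σ σ' : Equiv.Perm (Fin n)} {p p' : Fin n}
    (τ τ' : Equiv.Perm (Fin (k + 1))) (h : σ p = σ' p') :
    (blockPerm σ' p' τ')⁻¹ * blockPerm σ p τ = blockPerm (σ'⁻¹ * σ) p (τ'⁻¹ * τ) := by
  have hp : (σ'⁻¹ * σ) p = p' := by
    rw [Equiv.Perm.mul_apply, h, ← Equiv.Perm.mul_apply, inv_mul_cancel, Equiv.Perm.one_apply]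
  rw [inv_mul_eq_iff_eq_mul, ← hp, ← blockPerm_mul, mul_inv_cancel_left, mul_inv_cancel_left]

theorem rho_up {N j : ℕ} : ∀ {m : ℕ}, j + m < N → ∀ x : Fin N,
    (x.1 = j + m ∧ (rho N (up (sg N) j m) x).1 = j) ∨
    (j ≤ x.1 ∧ x.1 < j + m ∧ (rho N (up (sg N) j m) x).1 = x + 1) ∨
    ((x.1 < j ∨ j + m < x.1) ∧ (rho N (up (sg N) j m) x).1 = x)
  | 0, _, x => by simp [up]; omega
  | m + 1, h, x => by
    have e := isSwap_adjSwap (n := N) (i := j + m) (by omega) x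
    have ih := rho_up (j := j) (m := m) (by omega) (adjSwap N (j + m) x)
    unfold IsSwap at e
    rw [up, map_mul, Equiv.Perm.mul_apply, rho_sg (by omega)]
    omega

theorem rho_dn {N j : ℕ} : ∀ {m : ℕ}, j + m < N → ∀ x : Fin N,
    (x.1 = j ∧ (rho N (dn (sg N) j m) x).1 = j + m) ∨
    (j < x.1 ∧ x.1 ≤ j + m ∧ (rho N (dn (sg N) j m) x).1 + 1 = x) ∨
    ((x.1 < j ∨ j + m < x.1) ∧ (rho N (dn (sg N) j m) x).1 = x)
  | 0, _, x => by simp [dn]; omega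
  | m + 1, h, x => by
    have e := isSwap_adjSwap (n := N) (i := j + m) (by omega) (rho N (dn (sg N) j m) x)
    have ih := rho_dn (j := j) (m := m) (by omega) x
    unfold IsSwap at e
    rw [dn, map_mul, Equiv.Perm.mul_apply, rho_sg (by omega)]
    omega

theorem blockEquiv_inl_val {n k : ℕ} (p : Fin n) (x : {x : Fin n // x ≠ p}) :
    (x.1.1 < p.1 ∧ (blockEquiv k p (.inl x)).1 = x.1.1) ∨
    (p.1 < x.1.1 ∧ (blockEquiv k p (.inl x)).1 = x.1.1 + k) := by
  have hx : x.1.1 ≠ p.1 := fun h => x.2 (Fin.ext h)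
  have : (blockEquiv k p (.inl x)).1 = if x.1.1 < p.1 then x.1.1 else x.1.1 + k := rfl
  split_ifs at this <;> omega

theorem rho_cable {n k : ℕ} (g : Braid n) : ∀ p : Fin n,
    rho (n + k) (cable k p g) = blockPerm (rho n g) p 1 := by
  induction g using induction with
  | one => intro p; rw [cable_one, map_one, map_one, blockPerm_one]
  | gen j hj =>
    intro p
    rw [cable_sg hj, rho_sg hj]
    refine Equiv.ext fun z => Fin.ext ?_
    have hz := z.2
    have hp := p.2
    have ep := isSwap_adjSwap hj p
    unfold IsSwap at ep
    obtain ⟨w, rfl⟩ := (blockEquiv k p).surjective z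
    rcases w with x | y
    · rw [blockPerm_inl]
      have hx := x.1.2
      have ex := isSwap_adjSwap hj x.1
      have e1 := blockEquiv_inl_val (k := k) p x
      have e2 := blockEquiv_inl_val (k := k) (adjSwap n j p)
        ⟨adjSwap n j x, fun h => x.2 ((adjSwap n j).injective h)⟩
      dsimp only at e2
      unfold IsSwap at ex
      rcases (by omega : p.1 < j ∨ p.1 = j ∨ p.1 = j + 1 ∨ j + 1 < p.1) with c | c | c | c
      · rw [cableGen_lt c, rho_sg (by omega)]
        have e := isSwap_adjSwap (n := n + k) (i := j + k) (by omega) (blockEquiv k p (.inl x))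
        unfold IsSwap at e
        omega
      · rw [cableGen_eq c]
        have e := rho_up (N := n + k) (j := j) (m := k + 1) (by omega) (blockEquiv k p (.inl x))
        omega
      · rw [cableGen_eq' c]
        have e := rho_dn (N := n + k) (j := j) (m := k + 1) (by omega) (blockEquiv k p (.inl x))
        omega
      · rw [cableGen_gt c, rho_sg (by omega)]
        have e := isSwap_adjSwap (n := n + k) (i := j) (by omega) (blockEquiv k p (.inl x))
        unfold IsSwap at e
        omega
    · rw [blockPerm_inr]
      have hy := y.2
      have e1 : (blockEquiv k p (.inr y)).1 = p.1 + y.1 := rfl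
      have e2 : (blockEquiv k (adjSwap n j p) (.inr y)).1 = (adjSwap n j p).1 + y.1 := rfl
      rw [Equiv.Perm.one_apply]
      rcases (by omega : p.1 < j ∨ p.1 = j ∨ p.1 = j + 1 ∨ j + 1 < p.1) with c | c | c | c
      · rw [cableGen_lt c, rho_sg (by omega)]
        have e := isSwap_adjSwap (n := n + k) (i := j + k) (by omega) (blockEquiv k p (.inr y))
        unfold IsSwap at e
        omega
      · rw [cableGen_eq c]
        have e := rho_up (N := n + k) (j := j) (m := k + 1) (by omega) (blockEquiv k p (.inr y))
        omega
      · rw [cableGen_eq' c]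
        have e := rho_dn (N := n + k) (j := j) (m := k + 1) (by omega) (blockEquiv k p (.inr y))
        omega
      · rw [cableGen_gt c, rho_sg (by omega)]
        have e := isSwap_adjSwap (n := n + k) (i := j) (by omega) (blockEquiv k p (.inr y))
        unfold IsSwap at e
        omega
  | mul x y hx hy =>
    intro p
    rw [cable_mul, map_mul, hx, hy, ← blockPerm_mul, map_mul, one_mul]
  | inv x hx =>
    intro p
    have h1 : rho n x ((rho n x)⁻¹ p) = p := by
      rw [← Equiv.Perm.mul_apply, mul_inv_cancel, Equiv.Perm.one_apply]
    have h2 := blockPerm_inv_mul (k := k) (σ := 1) (σ' := rho n x) (p := p)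
      (p' := (rho n x)⁻¹ p) 1 1 h1.symm
    rw [cable_inv, map_inv, hx, map_inv]
    simpa [blockPerm_one] using h2

theorem rho_blockShift {n k : ℕ} (p : Fin n) (h : Braid (k + 1)) :
    rho (n + k) (blockShift k p h) = blockPerm 1 p (rho (k + 1) h) := by
  induction h using induction with
  | one => rw [map_one, map_one, map_one, blockPerm_one]
  | gen i hi =>
    rw [blockShift_sg p hi, rho_sg hi, rho_sg (by omega)]
    refine Equiv.ext fun z => Fin.ext ?_
    have e := isSwap_adjSwap (n := n + k) (i := p + i) (by omega) z
    unfold IsSwap at e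
    obtain ⟨w, rfl⟩ := (blockEquiv k p).surjective z
    rcases w with x | y
    · rw [blockPerm_inl]
      have e1 := blockEquiv_inl_val (k := k) p x
      change _ = (blockEquiv k p (.inl x)).1
      omega
    · rw [blockPerm_inr]
      have hy := isSwap_adjSwap hi y
      unfold IsSwap at hy
      have e1 : (blockEquiv k p (.inr y)).1 = p.1 + y.1 := rfl
      change _ = p.1 + (adjSwap (k + 1) i y).1
      omega
  | mul x y hx hy => rw [map_mul, map_mul, hx, hy, map_mul, ← mul_one (1 : Equiv.Perm (Fin n)),
      blockPerm_mul, mul_one]; rfl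
  | inv x hx =>
    have h2 := blockPerm_inv_mul (k := k) (σ := (1 : Equiv.Perm (Fin n))) (σ' := 1) (p := p)
      (p' := p) 1 (rho (k + 1) x) rfl
    rw [map_inv, map_inv, hx, map_inv]
    simpa [blockPerm_one] using h2

end Braid

/-! ### Parenthesized braids -/

/-- Parenthesizations of a sequence, as binary trees; the leaves are the entries of the
sequence. -/
inductive Paren : Type
  | leaf : Paren
  | node : Paren → Paren → Paren

namespace Paren

/-- The number of entries. -/
def size : Paren → ℕ
  | leaf => 1
  | node l r => l.size + r.size

/-- Substitution of `t` for the `p`-th entry (from `0`). -/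
def graft (t : Paren) : Paren → ℕ → Paren
  | leaf, _ => t
  | node l r, p => if p < l.size then node (graft t l p) r else node l (graft t r (p - l.size))

theorem size_graft (t : Paren) : ∀ (s : Paren) (p : ℕ), p < s.size →
    (graft t s p).size + 1 = s.size + t.size
  | leaf, _, _ => by simp [graft, size]; omega
  | node l r, p, hp => by
    rw [graft]
    simp only [size] at hp
    split_ifs with h
    · have := size_graft t l p h
      simp only [size]; omega
    · have := size_graft t r (p - l.size) (by omega)
      simp only [size]; omega

end Paren

/-- The objects of the groupoid `PaB(n)`: parenthesizations of the sequences
`(τ(1), …, τ(n))`, where `τ = perm ∈ S_n` (so `perm` sends a position to its label). -/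
structure PaB (n : ℕ) where
  shape : Paren
  size_eq : shape.size = n
  perm : Equiv.Perm (Fin n)

open CategoryTheory Braid

/-- The morphisms `a ⟶ b` of `PaB(n)` are the braids `g` with `ρ(g) = 𝔭(b)⁻¹ ∘ 𝔭(a)`; their
composition is the multiplication of braids. -/
instance (n : ℕ) : Groupoid (PaB n) where
  Hom a b := {g : Braid n // rho n g = b.perm⁻¹ * a.perm}
  id a := ⟨1, by simp⟩
  comp f g := ⟨g.1 * f.1, by rw [map_mul, f.2, g.2]; group⟩
  id_comp f := Subtype.ext (mul_one f.1)
  comp_id f := Subtype.ext (one_mul f.1)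
  assoc f g h := Subtype.ext (mul_assoc h.1 g.1 f.1).symm
  inv f := ⟨f.1⁻¹, by rw [map_inv, f.2]; group⟩
  inv_comp f := Subtype.ext (mul_inv_cancel f.1)
  comp_inv f := Subtype.ext (inv_mul_cancel f.1)

namespace PaB

/-- The braid of a morphism (the map `𝔬𝔲`). -/
def braid {n : ℕ} {a b : PaB n} (f : a ⟶ b) : Braid n := f.1

/-- The morphism given by a braid. -/
def ofBraid {n : ℕ} {a b : PaB n} (g : Braid n) (hg : rho n g = b.perm⁻¹ * a.perm) : a ⟶ b :=
  ⟨g, hg⟩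

/-- The action of `θ ∈ S_n` on `PaB(n)`: it relabels the objects and keeps the braids. -/
def act {n : ℕ} (θ : Equiv.Perm (Fin n)) : PaB n ⥤ PaB n where
  obj a := ⟨a.shape, a.size_eq, θ * a.perm⟩
  map {a b} f := ofBraid (a := ⟨a.shape, a.size_eq, θ * a.perm⟩)
    (b := ⟨b.shape, b.size_eq, θ * b.perm⟩) f.1 (by rw [f.2]; simp [mul_assoc])
  map_id _ := rfl
  map_comp _ _ := rfl

/-- The position of the label `i`. -/
def pos {n : ℕ} (a : PaB n) (i : Fin n) : Fin n := a.perm⁻¹ i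

theorem perm_pos {n : ℕ} (a : PaB n) (i : Fin n) : a.perm (a.pos i) = i :=
  Equiv.apply_symm_apply _ _

theorem rho_pos {n : ℕ} {a b : PaB n} (f : a ⟶ b) (i : Fin n) : rho n f.1 (a.pos i) = b.pos i := by
  rw [f.2, Equiv.Perm.mul_apply, perm_pos]; rfl

/-- The elementary insertion `a ∘_i b` of objects, for `a` of arity `n` and `b` of arity
`m = k + 1`; its arity is `n + m - 1 = n + k`. (There are no objects of arity `0`.) -/
def ins {n k : ℕ} (i : Fin n) (a : PaB n) (b : PaB (k + 1)) : PaB (n + k) where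
  shape := b.shape.graft a.shape (a.pos i)
  size_eq := by
    have := b.shape.size_graft a.shape (a.pos i) (by rw [a.size_eq]; exact (a.pos i).2)
    rw [a.size_eq, b.size_eq] at this
    omega
  perm := blockPerm a.perm (a.pos i) b.perm

/-- The functor `? ∘_i id_b`: it cables the strand that originates at the label `i`. -/
def insLeft {n k : ℕ} (i : Fin n) (b : PaB (k + 1)) : PaB n ⥤ PaB (n + k) where
  obj a := a.ins i b
  map {a a'} f := ofBraid (cable k (a.pos i) f.1) (by
    rw [rho_cable, ins, ins, blockPerm_inv_mul _ _ (by rw [perm_pos, perm_pos]), f.2,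
      inv_mul_cancel])
  map_id a := Subtype.ext (cable_one (a.pos i))
  map_comp {a a' a''} f g := Subtype.ext (by
    change cable k (a.pos i) (g.1 * f.1) = cable k (a'.pos i) g.1 * cable k (a.pos i) f.1
    rw [cable_mul, rho_pos])

/-- The functor `id_a ∘_i ?`: it puts a braid on the block at the label `i`. -/
def insRight {n k : ℕ} (i : Fin n) (a : PaB n) : PaB (k + 1) ⥤ PaB (n + k) where
  obj b := a.ins i b
  map {b b'} g := ofBraid (blockShift k (a.pos i) g.1) (by
    rw [rho_blockShift, ins, ins, blockPerm_inv_mul _ _ rfl, g.2, inv_mul_cancel])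
  map_id b := Subtype.ext (map_one (blockShift k (a.pos i)))
  map_comp f g := Subtype.ext (map_mul (blockShift k (a.pos i)) g.1 f.1)

end PaB

/-! ### Profinite completion of groupoids -/

/-- Compatible equivalence relations on a groupoid: they relate parallel morphisms only, are
compatible with composition and have finitely many classes (of morphisms `a ⟶ b`, for any
`a` and `b`). -/
structure CompatRel (C : Type) [Groupoid.{0} C] where
  rel : ∀ a b : C, Setoid (a ⟶ b)
  comp : ∀ {a b c : C} {f f' : a ⟶ b} {g g' : b ⟶ c},
    (rel a b) f f' → (rel b c) g g' → (rel a c) (f ≫ g) (f' ≫ g')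
  finite : ∀ a b : C, Finite (Quotient (rel a b))

/-- The pullback of a compatible equivalence relation along a functor. -/
def CompatRel.pullback {C D : Type} [Groupoid.{0} C] [Groupoid.{0} D] (F : C ⥤ D)
    (R : CompatRel D) : CompatRel C where
  rel a b := (R.rel (F.obj a) (F.obj b)).comap F.map
  comp h h' := by
    simp only [Setoid.comap_rel, F.map_comp] at *
    exact R.comp h h'
  finite a b := by
    have := R.finite (F.obj a) (F.obj b)
    refine Finite.of_injective (β := Quotient (R.rel (F.obj a) (F.obj b)))
      (Quotient.map F.map fun _ _ h => h) ?_
    rintro ⟨f⟩ ⟨g⟩ h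
    exact Quotient.sound (Quotient.exact h : R.rel _ _ (F.map f) (F.map g))

/-- The morphisms `a ⟶ b` of the profinite completion of a groupoid: the limit of the sets of
classes of morphisms `a ⟶ b` over all compatible equivalence relations. The objects of the
completion are those of the groupoid. -/
structure ProHom {C : Type} [Groupoid.{0} C] (a b : C) where
  val : ∀ R : CompatRel C, Quotient (R.rel a b)
  compat : ∀ (R S : CompatRel C)
    (h : ∀ (x y : C) (f g : x ⟶ y), R.rel x y f g → S.rel x y f g),
    Quotient.map id (h a b) (val R) = val S

namespace ProHom

variable {C D : Type} [Groupoid.{0} C] [Groupoid.{0} D]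

/-- The topology of the limit of finite discrete sets. -/
instance (a b : C) : TopologicalSpace (ProHom a b) :=
  ⨅ R : CompatRel C, TopologicalSpace.induced (fun γ => γ.val R) ⊥

/-- The canonical functor to the completion, on morphisms. -/
def of {a b : C} (f : a ⟶ b) : ProHom a b := ⟨fun _ => ⟦f⟧, fun _ _ _ => rfl⟩

/-- Composition in the completion (`γ` first). -/
def comp {a b c : C} (γ : ProHom a b) (η : ProHom b c) : ProHom a c where
  val R := Quotient.map₂ (fun f g => f ≫ g) (fun _ _ h _ _ h' => R.comp h h') (γ.val R) (η.val R)
  compat R S h := by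
    rw [← γ.compat R S h, ← η.compat R S h]
    induction γ.val R using Quotient.inductionOn
    induction η.val R using Quotient.inductionOn
    rfl

/-- The completion of a functor, on morphisms. -/
def map (F : C ⥤ D) {a b : C} (γ : ProHom a b) : ProHom (F.obj a) (F.obj b) where
  val R := Quotient.map F.map (fun _ _ h => h) (γ.val (R.pullback F))
  compat R S h := by
    rw [← γ.compat (R.pullback F) (S.pullback F) (fun x y f g => h _ _ _ _)]
    induction γ.val (R.pullback F) using Quotient.inductionOn
    rfl

end ProHom

/-- The elementary insertion `γ ∘_i η` in the completion of the operad `PaB`; it is the continuous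
extension of `γ ∘_i η = (γ ∘_i id_{b'}) · (id_a ∘_i η)` for `γ : a → a'`, `η : b → b'`. -/
def ProHom.ins {n k : ℕ} (i : Fin n) {a a' : PaB n} {b b' : PaB (k + 1)} (γ : ProHom a a')
    (η : ProHom b b') : ProHom (a.ins i b) (a'.ins i b') :=
  (η.map (PaB.insRight i a)).comp (γ.map (PaB.insLeft i b'))

/-- The elements of the Grothendieck-Teichmüller group `GT^`: the continuous automorphisms of the
operad in topological groupoids given by the profinite completion of `PaB`, which are the identity
on objects. -/
structure GTHat where
  toHomeo : ∀ {n : ℕ} (a b : PaB n), ProHom a b ≃ₜ ProHom a b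
  map_comp : ∀ {n : ℕ} {a b c : PaB n} (γ : ProHom a b) (η : ProHom b c),
    toHomeo a c (γ.comp η) = (toHomeo a b γ).comp (toHomeo b c η)
  map_act : ∀ {n : ℕ} {a b : PaB n} (θ : Equiv.Perm (Fin n)) (γ : ProHom a b),
    toHomeo _ _ (γ.map (PaB.act θ)) = (toHomeo a b γ).map (PaB.act θ)
  map_ins : ∀ {n k : ℕ} (i : Fin n) {a a' : PaB n} {b b' : PaB (k + 1)}
    (γ : ProHom a a') (η : ProHom b b'),
    toHomeo _ _ (γ.ins i η) = (toHomeo a a' γ).ins i (toHomeo b b' η)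

/-! ### The poset `NFI_{PB_4}(B_4)` -/

/-- For `M ≤ B_{n+1}`, the subgroup of those `h ∈ PB_n` for which all the braids obtained from `h`
by adding a strand on the right or on the left, or by doubling one of the strands, lie in `M`. -/
def down {n : ℕ} (M : Subgroup (Braid (n + 1))) : Subgroup (Braid n) where
  carrier := {h | h ∈ PB n ∧ shift (N := n + 1) 0 (by omega) h ∈ M ∧
    shift (N := n + 1) 1 (by omega) h ∈ M ∧ ∀ p : Fin n, cable 1 p h ∈ M}
  mul_mem' {g h} hg hh := by
    refine ⟨mul_mem hg.1 hh.1, ?_, ?_, fun p => ?_⟩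
    · rw [map_mul]; exact mul_mem hg.2.1 hh.2.1
    · rw [map_mul]; exact mul_mem hg.2.2.1 hh.2.2.1
    · rw [cable_mul, show rho n h = 1 from hh.1]; exact mul_mem (hg.2.2.2 p) (hh.2.2.2 p)
  one_mem' := ⟨one_mem _, by rw [map_one]; exact one_mem _, by rw [map_one]; exact one_mem _,
    fun p => by rw [cable_one]; exact one_mem _⟩
  inv_mem' {g} hg := by
    refine ⟨inv_mem hg.1, ?_, ?_, fun p => ?_⟩
    · rw [map_inv]; exact inv_mem hg.2.1
    · rw [map_inv]; exact inv_mem hg.2.2.1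
    · rw [cable_inv]; exact inv_mem (hg.2.2.2 _)

theorem down_mono {n : ℕ} {M M' : Subgroup (Braid (n + 1))} (h : M ≤ M') : down M ≤ down M' :=
  fun _ hx => ⟨hx.1, h hx.2.1, h hx.2.2.1, fun p => h (hx.2.2.2 p)⟩

instance down_normal {n : ℕ} (M : Subgroup (Braid (n + 1))) [hM : M.Normal] :
    (down M).Normal where
  conj_mem h hh g := by
    refine ⟨(MonoidHom.normal_ker (rho n)).conj_mem h hh.1 g, ?_, ?_, fun p => ?_⟩
    · rw [map_mul, map_mul, map_inv]; exact hM.conj_mem _ hh.2.1 _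
    · rw [map_mul, map_mul, map_inv]; exact hM.conj_mem _ hh.2.2.1 _
    · rw [cable_mul, cable_mul, cable_inv, map_inv, show rho n h = 1 from hh.1]
      exact hM.conj_mem _ (hh.2.2.2 _) _

instance PB_finiteIndex (n : ℕ) : (PB n).FiniteIndex := by
  unfold PB; infer_instance

theorem finiteIndex_comap {G H : Type*} [Group G] [Group H] (f : G →* H) (M : Subgroup H)
    [M.FiniteIndex] : (M.comap f).FiniteIndex := by
  have : M.IsFiniteRelIndex f.range := Subgroup.isFiniteRelIndex_of_finiteIndex
  exact ⟨by rw [Subgroup.index_comap]; exact Subgroup.relIndex_ne_zero⟩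

/-- Doubling of a strand, as a homomorphism on pure braids. -/
def cablePB {n : ℕ} (p : Fin n) : PB n →* Braid (n + 1) where
  toFun h := cable 1 p h.1
  map_one' := cable_one p
  map_mul' g h := by
    change cable 1 p (g.1 * h.1) = _
    rw [cable_mul, show rho n h.1 = 1 from h.2]; rfl

instance down_finiteIndex {n : ℕ} (M : Subgroup (Braid (n + 1))) [M.FiniteIndex] :
    (down M).FiniteIndex := by
  have h1 := finiteIndex_comap (shift (N := n + 1) 0 (by omega) : Braid n →* _) M
  have h2 := finiteIndex_comap (shift (N := n + 1) 1 (by omega) : Braid n →* _) M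
  have h3 : ((⨅ p : Fin n, M.comap (cablePB p))).FiniteIndex :=
    Subgroup.finiteIndex_iInf fun p => finiteIndex_comap _ _
  have h4 : ((⨅ p : Fin n, M.comap (cablePB p)).map (PB n).subtype).FiniteIndex := by
    refine ⟨?_⟩
    rw [Subgroup.index_map_subtype]
    exact mul_ne_zero h3.index_ne_zero (PB_finiteIndex n).index_ne_zero
  refine Subgroup.finiteIndex_of_le (H := (M.comap (shift (N := n + 1) 0 (by omega)) ⊓
    M.comap (shift (N := n + 1) 1 (by omega))) ⊓
    (⨅ p : Fin n, M.comap (cablePB p)).map (PB n).subtype) ?_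
  rintro x ⟨⟨hx1, hx2⟩, y, hy, rfl⟩
  exact ⟨y.2, hx1, hx2, fun p => (Subgroup.mem_iInf.mp hy p)⟩

/-- The poset `NFI_{PB_4}(B_4)` of finite index normal subgroups `N` of `B_4` with `N ≤ PB_4`. -/
structure NFI where
  sub4 : Subgroup (Braid 4)
  normal : sub4.Normal
  finiteIndex : sub4.FiniteIndex
  le_PB : sub4 ≤ PB 4

namespace NFI

instance : LE NFI := ⟨fun K N => K.sub4 ≤ N.sub4⟩

variable (N : NFI)

instance : N.sub4.Normal := N.normal
instance : N.sub4.FiniteIndex := N.finiteIndex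

/-- `N_{PB_3}`. -/
def sub3 : Subgroup (Braid 3) := down (n := 3) N.sub4

/-- `N_{PB_2}`. -/
def sub2 : Subgroup (Braid 2) := down (n := 2) N.sub3

instance sub3_normal : N.sub3.Normal := @down_normal 3 N.sub4 N.normal
instance sub3_finiteIndex : N.sub3.FiniteIndex := @down_finiteIndex 3 N.sub4 N.finiteIndex
instance sub2_normal : N.sub2.Normal := @down_normal 2 N.sub3 N.sub3_normal
instance sub2_finiteIndex : N.sub2.FiniteIndex :=
  @down_finiteIndex 2 N.sub3 N.sub3_finiteIndex

/-- `N_ord`, the index of `N_{PB_2}` in `PB_2`. -/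
noncomputable def ord : ℕ := N.sub2.relIndex (PB 2)

theorem sub3_mono {K N : NFI} (h : K ≤ N) : K.sub3 ≤ N.sub3 := down_mono (n := 3) h

theorem sub2_mono {K N : NFI} (h : K ≤ N) : K.sub2 ≤ N.sub2 := down_mono (n := 2) (sub3_mono h)

theorem ord_dvd {K N : NFI} (h : K ≤ N) : N.ord ∣ K.ord :=
  Subgroup.relIndex_dvd_of_le_left _ (sub2_mono h)

end NFI

/-- The equivalence relation on `PaB(n)` given by a normal subgroup `M` of finite index of `B_n`:
`γ ∼ γ'` iff the braid of `γ⁻¹ · γ'` lies in `M`. -/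
def relOf {n : ℕ} (M : Subgroup (Braid n)) [hM : M.Normal] [M.FiniteIndex] : CompatRel (PaB n) where
  rel a b := (QuotientGroup.leftRel M).comap fun f : a ⟶ b => f.1
  comp {a b c f f' g g'} h h' := by
    simp only [Setoid.comap_rel, QuotientGroup.leftRel_apply] at *
    change (g.1 * f.1)⁻¹ * (g'.1 * f'.1) ∈ M
    have := mul_mem (hM.conj_mem _ h' f.1⁻¹) h
    convert this using 1
    group
  finite a b := by
    refine Finite.of_injective (β := Braid n ⧸ M) (Quotient.map (fun f => f.1) fun _ _ h => h) ?_
    rintro ⟨f⟩ ⟨g⟩ h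
    exact Quotient.sound (Quotient.exact h : QuotientGroup.leftRel M f.1 g.1)

/-! ### GT-shadows -/

section words

/-- `φ_{123} : PB_3 → PB_4` -/
def phi123 (h : Braid 3) : Braid 4 := shift 0 (by omega) h
/-- `φ_{234}` -/
def phi234 (h : Braid 3) : Braid 4 := shift 1 (by omega) h
/-- `φ_{12,3,4}` -/
def phi12_3_4 (h : Braid 3) : Braid 4 := cable 1 (0 : Fin 3) h
/-- `φ_{1,23,4}` -/
def phi1_23_4 (h : Braid 3) : Braid 4 := cable 1 (1 : Fin 3) h
/-- `φ_{1,2,34}` -/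
def phi1_2_34 (h : Braid 3) : Braid 4 := cable 1 (2 : Fin 3) h

end words

/-- The hexagon relations (in `B_3 / N_{PB_3}`) and the pentagon relation (in `B_4 / N`) for a pair
`(m, f)`. Here `σ_1 = sg 3 0`, `σ_2 = sg 3 1`, `x_{12} = σ_1²`, `x_{23} = σ_2²`,
`x_{13} = σ_2 σ_1² σ_2⁻¹`. -/
structure IsGTPair (N : NFI) (m : ℤ) (f : PB 3) : Prop where
  hexagon₁ :
    ((sg 3 0 * (sg 3 0 ^ 2) ^ m * f.1⁻¹ * sg 3 1 * (sg 3 1 ^ 2) ^ m * f.1 : Braid 3) :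
      Braid 3 ⧸ N.sub3) =
    ((f.1⁻¹ * sg 3 0 * sg 3 1 * ((sg 3 1 * sg 3 0 ^ 2 * (sg 3 1)⁻¹) * sg 3 1 ^ 2) ^ m : Braid 3) :
      Braid 3 ⧸ N.sub3)
  hexagon₂ :
    ((f.1⁻¹ * sg 3 1 * (sg 3 1 ^ 2) ^ m * f.1 * sg 3 0 * (sg 3 0 ^ 2) ^ m : Braid 3) :
      Braid 3 ⧸ N.sub3) =
    ((sg 3 1 * sg 3 0 * (sg 3 0 ^ 2 * (sg 3 1 * sg 3 0 ^ 2 * (sg 3 1)⁻¹)) ^ m * f.1 : Braid 3) :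
      Braid 3 ⧸ N.sub3)
  pentagon :
    ((phi234 f.1 * phi1_23_4 f.1 * phi123 f.1 : Braid 4) : Braid 4 ⧸ N.sub4) =
    ((phi1_2_34 f.1 * phi12_3_4 f.1 : Braid 4) : Braid 4 ⧸ N.sub4)

theorem hexagon_braid {G : Type*} [Group G] {a b F : G} {m : ℤ} (hab : a * b * a = b * a * b)
    (h : a * (a ^ 2) ^ m * (F⁻¹ * (b * (b ^ 2) ^ m) * F) =
      F⁻¹ * a * b * (b * a ^ 2 * b⁻¹ * b ^ 2) ^ m) :
    (a * (a ^ 2) ^ m) * (F⁻¹ * (b * (b ^ 2) ^ m) * F) * (a * (a ^ 2) ^ m) =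
      (F⁻¹ * (b * (b ^ 2) ^ m) * F) * (a * (a ^ 2) ^ m) * (F⁻¹ * (b * (b ^ 2) ^ m) * F) := by
  have hz : b * a ^ 2 * b⁻¹ * b ^ 2 = b * a ^ 2 * b := by group
  rw [hz] at h
  have hc : Commute (b * a ^ 2 * b) a := by
    change b * a ^ 2 * b * a = a * (b * a ^ 2 * b)
    calc b * a ^ 2 * b * a = b * a * (a * b * a) := by rw [pow_two]; group
      _ = (b * a * b) * (a * b) := by rw [hab]; group
      _ = a * (b * a ^ 2 * b) := by rw [← hab, pow_two]; group
  have hs : SemiconjBy (a * b) a b := by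
    change a * b * a = b * (a * b)
    rw [hab, mul_assoc]
  have hs' : (b ^ 2) ^ m * (a * b) = a * b * (a ^ 2) ^ m :=
    ((hs.pow_right 2).zpow_right m).symm
  have hc1 := (hc.zpow_left m).eq
  have hc2 := ((hc.zpow_left m).pow_right 2).zpow_right m |>.eq
  rw [mul_assoc (F⁻¹ * (b * (b ^ 2) ^ m) * F), h]
  calc F⁻¹ * a * b * (b * a ^ 2 * b) ^ m * (a * (a ^ 2) ^ m)
      = F⁻¹ * a * b * ((b * a ^ 2 * b) ^ m * a) * (a ^ 2) ^ m := by simp only [mul_assoc]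
    _ = F⁻¹ * (a * b * a) * ((b * a ^ 2 * b) ^ m * (a ^ 2) ^ m) := by
      rw [hc1]; simp only [mul_assoc]
    _ = F⁻¹ * b * (a * b * (a ^ 2) ^ m) * (b * a ^ 2 * b) ^ m := by
      rw [hab, hc2]; simp only [mul_assoc]
    _ = _ := by rw [← hs']; simp only [mul_assoc, mul_inv_cancel_left]

theorem pentagon_braid {G : Type*} [Group G] {s t F₁ F₂ F₃ G₁ G₂ : G} (h₁ : F₂ * s = s * F₂)
    (h₂ : G₂ * t = t * G₂) (h : F₃ * F₂ * F₁ = G₂ * G₁)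
    (h₃ : s * (F₃⁻¹ * t * F₃) * s = (F₃⁻¹ * t * F₃) * s * (F₃⁻¹ * t * F₃)) :
    (F₁⁻¹ * s * F₁) * (G₁⁻¹ * t * G₁) * (F₁⁻¹ * s * F₁) =
      (G₁⁻¹ * t * G₁) * (F₁⁻¹ * s * F₁) * (G₁⁻¹ * t * G₁) := by
  have e₁ : F₁⁻¹ * s * F₁ = (F₂ * F₁)⁻¹ * s * (F₂ * F₁) := by
    have : s = F₂⁻¹ * s * F₂ := by rw [mul_assoc, ← h₁, inv_mul_cancel_left]
    nth_rw 1 [this]; group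
  have e₂ : G₁⁻¹ * t * G₁ = (F₂ * F₁)⁻¹ * (F₃⁻¹ * t * F₃) * (F₂ * F₁) := by
    have : t = G₂⁻¹ * t * G₂ := by rw [mul_assoc, ← h₂, inv_mul_cancel_left]
    have e : G₁⁻¹ * t * G₁ = (G₂ * G₁)⁻¹ * t * (G₂ * G₁) := by nth_rw 1 [this]; group
    rw [e, ← h]; group
  rw [e₁, e₂]
  have := congrArg (fun x => (F₂ * F₁)⁻¹ * x * (F₂ * F₁)) h₃
  simpa only [mul_assoc, mul_inv_cancel_left, mul_inv_rev] using this

namespace IsGTPair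

variable {N : NFI} {m : ℤ} {f : PB 3}

/-- The values `σ_1 x_{12}^m` and `f⁻¹ σ_2 x_{23}^m f` on the generators of `B_3`. -/
def gen3 (m : ℤ) (f : PB 3) : ℕ → Braid 3
  | 0 => sg 3 0 * (sg 3 0 ^ 2) ^ m
  | _ => f.1⁻¹ * (sg 3 1 * (sg 3 1 ^ 2) ^ m) * f.1

/-- The values `σ_1 x_{12}^m`, `φ_{123}(f)⁻¹ σ_2 x_{23}^m φ_{123}(f)` and
`φ_{12,3,4}(f)⁻¹ σ_3 x_{34}^m φ_{12,3,4}(f)` on the generators of `B_4`. -/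
def gen4 (m : ℤ) (f : PB 3) : ℕ → Braid 4
  | 0 => sg 4 0 * (sg 4 0 ^ 2) ^ m
  | 1 => (phi123 f.1)⁻¹ * (sg 4 1 * (sg 4 1 ^ 2) ^ m) * phi123 f.1
  | _ => (phi12_3_4 f.1)⁻¹ * (sg 4 2 * (sg 4 2 ^ 2) ^ m) * phi12_3_4 f.1

theorem gen3_braid (h : IsGTPair N m f) :
    (gen3 m f 0 * gen3 m f 1 * gen3 m f 0 : Braid 3)⁻¹ *
      (gen3 m f 1 * gen3 m f 0 * gen3 m f 1) ∈ N.sub3 := by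
  have hb := congrArg (QuotientGroup.mk' N.sub3) ((isBraid_sg 3).braid 0 (by omega))
  have := hexagon_braid (a := QuotientGroup.mk' N.sub3 (sg 3 0))
    (b := QuotientGroup.mk' N.sub3 (sg 3 1)) (F := QuotientGroup.mk' N.sub3 f.1) (m := m)
    (by simpa only [map_mul] using hb)
    (by simpa only [← map_mul, ← map_inv, ← map_pow, ← map_zpow, mul_assoc] using
          (show QuotientGroup.mk' N.sub3 _ = QuotientGroup.mk' N.sub3 _ from h.hexagon₁))
  rw [← QuotientGroup.eq]
  change QuotientGroup.mk' N.sub3 _ = QuotientGroup.mk' N.sub3 _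
  simpa only [gen3, map_mul, map_inv, map_pow, map_zpow] using this

theorem isBraid_gen3 (h : IsGTPair N m f) :
    IsBraid 3 fun i => (gen3 m f i : Braid 3 ⧸ N.sub3) where
  comm i j h1 h2 := by omega
  braid i hi := by
    obtain rfl : i = 0 := by omega
    exact QuotientGroup.eq.mpr h.gen3_braid

/-- `φ_{12,3,4}(f)` commutes with `σ_1`, and so on. -/
theorem cable_comm (f : PB 3) (p : Fin 3) :
    Commute (cable 1 p f.1) (sg 4 p.1) := by
  have := cable_mul_shift (k := 1) f.1 p (sg 2 0)
  rw [show rho 3 f.1 = 1 from f.2, Equiv.Perm.one_apply, blockShift_sg _ (by omega)] at this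
  exact this

theorem isBraid_gen4 (h : IsGTPair N m f) :
    IsBraid 4 fun i => (gen4 m f i : Braid 4 ⧸ N.sub4) where
  comm i j h1 h2 := by
    obtain ⟨rfl, rfl⟩ : i = 0 ∧ j = 2 := by omega
    have h1 : Commute (sg 4 0) (phi12_3_4 f.1) := (cable_comm f 0).symm
    have h2 : Commute (sg 4 0) (sg 4 2) := (isBraid_sg 4).comm 0 2 (by omega) (by omega)
    have h3 : Commute (sg 4 0) (gen4 m f 2) :=
      (h1.inv_right.mul_right (h2.mul_right ((h2.pow_right 2).zpow_right m))).mul_right h1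
    have h4 : Commute (gen4 m f 0) (gen4 m f 2) :=
      h3.mul_left ((h3.pow_left 2).zpow_left m)
    exact congrArg (QuotientGroup.mk' N.sub4) h4.eq
  braid i hi := by
    have h3 := h.gen3_braid
    obtain rfl | rfl : i = 0 ∨ i = 1 := by omega
    · refine QuotientGroup.eq.mpr ?_
      have := h3.2.1
      simp only [gen3, map_mul, map_inv, map_pow, map_zpow,
        shift_sg (show 0 + 3 ≤ 3 + 1 by omega) (show 0 + 1 < 3 by omega),
        shift_sg (show 0 + 3 ≤ 3 + 1 by omega) (show 1 + 1 < 3 by omega)] at this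
      exact this
    · have h5 := h3.2.2.1
      simp only [gen3, map_mul, map_inv, map_pow, map_zpow,
        shift_sg (show 1 + 3 ≤ 3 + 1 by omega) (show 0 + 1 < 3 by omega),
        shift_sg (show 1 + 3 ≤ 3 + 1 by omega) (show 1 + 1 < 3 by omega)] at h5
      have h5' := QuotientGroup.eq.mpr h5
      have e1 : Commute (phi1_23_4 f.1) (sg 4 1 * (sg 4 1 ^ 2) ^ m) :=
        have c : Commute (phi1_23_4 f.1) (sg 4 1) := cable_comm f 1
        c.mul_right ((c.pow_right 2).zpow_right m)
      have e2 : Commute (phi1_2_34 f.1) (sg 4 2 * (sg 4 2 ^ 2) ^ m) :=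
        have c : Commute (phi1_2_34 f.1) (sg 4 2) := cable_comm f 2
        c.mul_right ((c.pow_right 2).zpow_right m)
      let q := QuotientGroup.mk' N.sub4
      exact pentagon_braid (s := q (sg 4 1 * (sg 4 1 ^ 2) ^ m)) (t := q (sg 4 2 * (sg 4 2 ^ 2) ^ m))
        (F₁ := q (phi123 f.1)) (F₂ := q (phi1_23_4 f.1)) (F₃ := q (phi234 f.1))
        (G₁ := q (phi12_3_4 f.1)) (G₂ := q (phi1_2_34 f.1)) (congrArg (QuotientGroup.mk' N.sub4) e1.eq)
        (congrArg (QuotientGroup.mk' N.sub4) e2.eq) h.pentagon h5'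

/-- The homomorphism `T^{B_2}_{m,f} : B_2 → B_2 / N_{PB_2}`, `σ_1 ↦ σ_1 x_{12}^m`. -/
def T2 (_ : IsGTPair N m f) : Braid 2 →* Braid 2 ⧸ N.sub2 :=
  lift (fun _ => ((sg 2 0 * (sg 2 0 ^ 2) ^ m : Braid 2) : Braid 2 ⧸ N.sub2))
    ⟨fun _ _ _ _ => rfl, fun _ _ => rfl⟩

/-- The homomorphism `T^{B_3}_{m,f} : B_3 → B_3 / N_{PB_3}`. -/
def T3 (h : IsGTPair N m f) : Braid 3 →* Braid 3 ⧸ N.sub3 := lift _ h.isBraid_gen3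

/-- The homomorphism `T^{B_4}_{m,f} : B_4 → B_4 / N`. -/
def T4 (h : IsGTPair N m f) : Braid 4 →* Braid 4 ⧸ N.sub4 := lift _ h.isBraid_gen4

/-- `(m, f)` represents a GT-shadow: the homomorphisms `PB_n → PB_n / N_{PB_n}`, `n = 4, 3, 2`,
obtained from `T^{B_n}_{m,f}` by restriction are onto. -/
structure IsShadow (h : IsGTPair N m f) : Prop where
  onto4 : (PB 4).map h.T4 = (PB 4).map (QuotientGroup.mk' N.sub4)
  onto3 : (PB 3).map h.T3 = (PB 3).map (QuotientGroup.mk' N.sub3)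
  onto2 : (PB 2).map h.T2 = (PB 2).map (QuotientGroup.mk' N.sub2)

end IsGTPair

/-- The free subgroup `F_2 = ⟨x_{12}, x_{23}⟩` of `PB_3`. -/
def F2 : Subgroup (Braid 3) := Subgroup.closure {sg 3 0 ^ 2, sg 3 1 ^ 2}

/-- `(m, f)` represents a charming GT-shadow: `f N_{PB_3}` has a representative in `[F_2, F_2]`,
and the restriction `F_2 → F_2 / (N_{PB_3} ∩ F_2) ⊆ B_3 / N_{PB_3}` of `T^{B_3}_{m,f}` is onto. -/
structure IsGTPair.IsCharming {N : NFI} {m : ℤ} {f : PB 3} (h : IsGTPair N m f) : Prop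
    extends h.IsShadow where
  comm : ∃ f₁ ∈ ⁅F2, F2⁆, (f₁ : Braid 3 ⧸ N.sub3) = (f.1 : Braid 3 ⧸ N.sub3)
  ontoF2 : F2.map h.T3 = F2.map (QuotientGroup.mk' N.sub3)

/-- `ℤ / N_ord × PB_3 / N_{PB_3}`. -/
abbrev PairSpace (N : NFI) : Type := ZMod N.ord × (PB 3 ⧸ N.sub3.subgroupOf (PB 3))

/-- The class `[(m, f)]`. -/
noncomputable def cls (N : NFI) (m : ℤ) (f : PB 3) : PairSpace N := ((m : ZMod N.ord), QuotientGroup.mk f)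

/-- The set `GT♥(N)` of charming GT-shadows. -/
def GTHeart (N : NFI) : Set (PairSpace N) :=
  {q | ∃ (m : ℤ) (f : PB 3) (h : IsGTPair N m f), q = cls N m f ∧ h.IsCharming}

/-- The reduction `(m + K_ord ℤ, f K_{PB_3}) ↦ (m + N_ord ℤ, f N_{PB_3})` for `K ≤ N`. -/
noncomputable def reduce {K N : NFI} (hKN : K ≤ N) (q : PairSpace K) : PairSpace N :=
  (ZMod.castHom (NFI.ord_dvd hKN) _ q.1,
    QuotientGroup.map _ _ (MonoidHom.id _)
      (Subgroup.comap_mono (f := (PB 3).subtype) (NFI.sub3_mono hKN)) q.2)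

namespace IsGTPair

variable {K N : NFI} {m : ℤ} {f : PB 3}

theorem mono (hKN : K ≤ N) (h : IsGTPair K m f) : IsGTPair N m f where
  hexagon₁ := QuotientGroup.eq.mpr (NFI.sub3_mono hKN (QuotientGroup.eq.mp h.hexagon₁))
  hexagon₂ := QuotientGroup.eq.mpr (NFI.sub3_mono hKN (QuotientGroup.eq.mp h.hexagon₂))
  pentagon := QuotientGroup.eq.mpr (hKN (QuotientGroup.eq.mp h.pentagon))

theorem map_T {n : ℕ} {A B : Subgroup (Braid n)} [A.Normal] [B.Normal] (hAB : A ≤ B)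
    (s : ℕ → Braid n) (hA : IsBraid n fun i => (s i : Braid n ⧸ A))
    (hB : IsBraid n fun i => (s i : Braid n ⧸ B)) {P : Subgroup (Braid n)}
    (h : P.map (lift _ hA) = P.map (QuotientGroup.mk' A)) :
    P.map (lift _ hB) = P.map (QuotientGroup.mk' B) := by
  have e : lift _ hB = (QuotientGroup.map A B (MonoidHom.id _) hAB).comp (lift _ hA) :=
    hom_ext fun i hi => by
      rw [lift_sg hB hi, MonoidHom.comp_apply, lift_sg hA hi]; rfl
  rw [e, ← Subgroup.map_map, h, Subgroup.map_map]
  rfl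

theorem IsCharming.mono (hKN : K ≤ N) {h : IsGTPair K m f} (hc : h.IsCharming) :
    (h.mono hKN).IsCharming where
  onto4 := map_T hKN _ _ _ hc.onto4
  onto3 := map_T (NFI.sub3_mono hKN) _ _ _ hc.onto3
  onto2 := map_T (NFI.sub2_mono hKN) (fun _ => sg 2 0 * (sg 2 0 ^ 2) ^ m) _ _ hc.onto2
  comm := by
    obtain ⟨f₁, h₁, h₂⟩ := hc.comm
    exact ⟨f₁, h₁, QuotientGroup.eq.mpr (NFI.sub3_mono hKN (QuotientGroup.eq.mp h₂))⟩
  ontoF2 := map_T (NFI.sub3_mono hKN) _ _ _ hc.ontoF2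

end IsGTPair

theorem reduce_cls {K N : NFI} (hKN : K ≤ N) (m : ℤ) (f : PB 3) :
    reduce hKN (cls K m f) = cls N m f :=
  Prod.ext (map_intCast (ZMod.castHom (NFI.ord_dvd hKN) (ZMod N.ord)) m) rfl

/-- The natural map `GT♥(K) → GT♥(N)` for `K ≤ N`. -/
noncomputable def GTHeart.restrict {K N : NFI} (hKN : K ≤ N) (q : GTHeart K) : GTHeart N :=
  ⟨reduce hKN q.1, by
    obtain ⟨m, f, h, hq, hc⟩ := q.2
    exact ⟨m, f, h.mono hKN, by rw [hq, reduce_cls], hc.mono hKN⟩⟩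

/-! ### Genuine GT-shadows -/

namespace PaB

/-- The object `12`. -/
def ob12 : PaB 2 := ⟨.node .leaf .leaf, rfl, 1⟩

/-- The object `21`. -/
def ob21 : PaB 2 := ⟨.node .leaf .leaf, rfl, Equiv.swap 0 1⟩

/-- The object `(12)3`. -/
def ob12_3 : PaB 3 := ⟨.node (.node .leaf .leaf) .leaf, rfl, 1⟩

/-- The object `1(23)`. -/
def ob1_23 : PaB 3 := ⟨.node .leaf (.node .leaf .leaf), rfl, 1⟩

/-- The morphism `12 → 21` with the braid `σ_1 x_{12}^m`; the braiding `β` is `betaMor 0`, and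
`betaMor m` is the composition of `x_{12}^m : 12 → 12` and `β`. -/
def betaMor (m : ℤ) : ob12 ⟶ ob21 :=
  ofBraid (sg 2 0 * (sg 2 0 ^ 2) ^ m) (by
    have : adjSwap 2 0 = Equiv.swap 0 1 := rfl
    rw [map_mul, map_zpow, map_pow, rho_sg (by omega), this, pow_two, Equiv.swap_mul_self, one_zpow]
    simp [ob12, ob21])

/-- The morphism `(12)3 → 1(23)` with the braid `f ∈ PB_3`; the associator `α` is `alphaMor 1`, and
`alphaMor f` is the composition of `f : (12)3 → (12)3` and `α`. -/
def alphaMor (f : PB 3) : ob12_3 ⟶ ob1_23 :=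
  ofBraid f.1 (by rw [show rho 3 f.1 = 1 from f.2]; simp [ob12_3, ob1_23])

end PaB

/-- An element of `ℤ / N_ord × PB_3 / N_{PB_3}` is genuine if it is the class of a pair `(m, f)`
such that, for some continuous automorphism `T` of the completed operad, the image of `T(β)` in
`PaB(2) / ∼_N` is the class of `β · x_{12}^m` and the image of `T(α)` in `PaB(3) / ∼_N` is the class
of `α · f`. -/
def IsGenuine (N : NFI) (q : PairSpace N) : Prop :=
  ∃ (m : ℤ) (f : PB 3) (T : GTHat), q = cls N m f ∧
    (T.toHomeo _ _ (ProHom.of (PaB.betaMor 0))).val (relOf N.sub2) = ⟦PaB.betaMor m⟧ ∧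
    (T.toHomeo _ _ (ProHom.of (PaB.alphaMor 1))).val (relOf N.sub3) = ⟦PaB.alphaMor f⟧

end GTSh

/-! Suppose that a charming shadow lifts to every K ≤ N. The sets GT♥(K) are finite, so along a
cofinal chain below N (`NFI.infCore`) the fibres over the shadow form an inverse system of nonempty
finite sets, and such a system has a thread (`exists_section`). Representatives (m_j, f_j) of the
thread converge modulo every normal subgroup of finite index, and the hexagon and pentagon relations
hold in the limit (`IsPairSeq`). It remains to turn such a limit into an automorphism of the
completed operad, in all arities at once.

This is a coherence theorem in the manner of Mac Lane. It is carried out modulo a normal subgroup M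
of B_N, for pairs that satisfy the relations modulo `pull M 3` and `pull M 4` (`Good`): then each
strand in the relations may be replaced by any number of parallel strands, possibly by none. At the
left comb ((12)3)⋯ the generator σ_j goes to σ_j x^m conjugated by an associator (`twGen`), and the
braid relations follow from the first hexagon and the pentagon (`Good.isBraid`). Every
parenthesization is reached from the comb by a product of associators (`combTo`), and by the
pentagon each move of parentheses multiplies this product by a single associator
(`Good.combTo_move`). The resulting twist `tw` is functorial and has the expected values on moves
and on generators. `braid_induction` reduces its compatibility with insertions to these values; the
hexagons enter through crossings of whole blocks (`Good.tw_cross_left`, `Good.tw_cross_right`,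
`Good.tw_cable`). Charming makes the twist onto modulo M (`Good.range_twComb`). The subgroups `core
n j` are of finite index, cofinal, and killed by every homomorphism from B_n to B_n modulo `core n
j`, so the twist is a surjection of a finite set to itself there, hence a bijection. The limit is a
homeomorphism (`IsPairSeq.homeo`).

Conversely, let T be an automorphism with the given values modulo N. Its values on β and α modulo
any L ≤ N give a pair that lifts the shadow. Compatibility with composition and insertions yields
the hexagons and the pentagon (`IsValue.isGTPair`); continuity, bijectivity and the density of the
braids in the completion yield surjectivity on pure braids (`IsValue.isShadow`). The charming
conditions modulo K are extracted from a much deeper L. As PB_3 is generated by F_2 and the central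
full twist Δ², one has f = x_12^a x_23^b u Δ^{2k} with u in [F_2, F_2]. Linking numbers detect the
exponents, and the pentagon with two empty blocks makes them vanish up to the precision needed
(`Good.exists_commutator`). Finally T raises Δ² to the power 2m + 1 (`IsGTPair.T3_halfTwist`), and
the linking number of the strands 1 and 3, which is zero on F_2, removes the full twist from a
preimage of an element of F_2 (`IsGTPair.map_F2`). -/

namespace GTSh

open CategoryTheory Braid

/-! ### Block crossings -/

section cross

variable {G : Type*} [Group G]

/-- The crossing of the block of `a` strands at the position `j` and the block of `b` strands to
its right. -/
def cross (s : ℕ → G) (j a : ℕ) : ℕ → G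
  | 0 => 1
  | b + 1 => up s (j + b) a * cross s j a b

theorem up_add (s : ℕ → G) (j a : ℕ) : ∀ a', up s j (a + a') = up s j a * up s (j + a) a'
  | 0 => by simp [up]
  | a' + 1 => by rw [← add_assoc, up, up_add s j a a', up, mul_assoc, add_assoc]

theorem cross_add_right (s : ℕ → G) (j a b : ℕ) :
    ∀ b', cross s j a (b + b') = cross s (j + b) a b' * cross s j a b
  | 0 => by simp [cross]
  | b' + 1 => by rw [← add_assoc, cross, cross_add_right s j a b b', cross, mul_assoc, add_assoc]

theorem cross_zero_left (s : ℕ → G) (j : ℕ) : ∀ b, cross s j 0 b = 1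
  | 0 => rfl
  | b + 1 => by rw [cross, cross_zero_left s j b]; simp [up]

theorem cross_one_right (s : ℕ → G) (j a : ℕ) : cross s j a 1 = up s j a := by simp [cross]

theorem cross_one_left (s : ℕ → G) (j : ℕ) : ∀ b, cross s j 1 b = dn s j b
  | 0 => rfl
  | b + 1 => by rw [cross, cross_one_left s j b]; simp [up, dn]

/-- The second family `s'` is arbitrary so that `y` may shift the indices of the generators, not
merely commute with them. -/
theorem up_semiconj {y : G} {s s' : ℕ → G} {q : ℕ} : ∀ {m : ℕ},
    (∀ i, q ≤ i → i < q + m → y * s i = s' i * y) → y * up s q m = up s' q m * y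
  | 0, _ => by simp [up]
  | m + 1, h => by
    rw [up, ← mul_assoc, up_semiconj (m := m) fun i h1 h2 => h i h1 (by omega), mul_assoc,
      h _ (by omega) (by omega), ← mul_assoc, up]

theorem cross_semiconj {y : G} {s s' : ℕ → G} {q c : ℕ} : ∀ {d : ℕ},
    (∀ i, q ≤ i → i + 1 < q + c + d → y * s i = s' i * y) →
      y * cross s q c d = cross s' q c d * y
  | 0, _ => by simp [cross]
  | d + 1, h => by
    rw [cross, ← mul_assoc, up_semiconj fun i h1 h2 => h i (by omega) (by omega), mul_assoc,
      cross_semiconj (d := d) fun i h1 h2 => h i h1 (by omega), ← mul_assoc, cross]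

theorem up_shift_index (s : ℕ → G) (q k : ℕ) : ∀ m, up (fun i => s (i + k)) q m = up s (q + k) m
  | 0 => rfl
  | m + 1 => by rw [up, up_shift_index s q k m, up, Nat.add_right_comm]

theorem cross_shift_index (s : ℕ → G) (q k a : ℕ) :
    ∀ b, cross (fun i => s (i + k)) q a b = cross s (q + k) a b
  | 0 => rfl
  | b + 1 => by
    rw [cross, cross_shift_index s q k a b, cross, up_shift_index, Nat.add_right_comm]

variable {N : ℕ} {s : ℕ → G}

namespace IsBraid

theorem cross_comm (h : IsBraid N s) {j a i : ℕ} : ∀ {b : ℕ}, j + a + b ≤ N →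
    (i + 2 ≤ j ∨ j + a + b ≤ i ∧ i + 1 < N) → cross s j a b * s i = s i * cross s j a b
  | 0, _, _ => by simp [cross]
  | b + 1, h1, h2 => by
    rw [cross, mul_assoc, h.cross_comm (b := b) (by omega) (by omega), ← mul_assoc,
      h.up_comm (by omega), mul_assoc]

theorem cross_add_left (h : IsBraid N s) {j a a' : ℕ} : ∀ {b : ℕ}, j + a + a' + b ≤ N →
    cross s j (a + a') b = cross s j a b * cross s (j + a) a' b
  | 0, _ => by simp [cross]
  | b + 1, h1 => by
    have e : cross s j a b * up s (j + b + a) a' = up s (j + b + a) a' * cross s j a b :=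
      up_semiconj fun i h2 h3 => h.cross_comm (by omega) (by omega)
    rw [cross, h.cross_add_left (b := b) (by omega), up_add, cross, cross,
      show j + a + b = j + b + a by omega]
    simp only [mul_assoc]
    rw [← mul_assoc (up s (j + b + a) a'), ← e, mul_assoc]

theorem cross_left (h : IsBraid N s) {j a i : ℕ} : ∀ {b : ℕ}, j + a + b ≤ N → j ≤ i →
    i + 1 < j + a → cross s j a b * s i = s (i + b) * cross s j a b
  | 0, _, _, _ => by simp [cross]
  | b + 1, h1, h2, h3 => by
    rw [cross, mul_assoc, h.cross_left (b := b) (by omega) h2 h3, ← mul_assoc,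
      h.up_shift (by omega) (by omega) (by omega), mul_assoc, add_assoc]

theorem cross_right (h : IsBraid N s) {j a i : ℕ} : ∀ {b : ℕ}, j + a + b ≤ N → j ≤ i →
    i + 1 < j + b → cross s j a b * s (i + a) = s i * cross s j a b
  | 0, _, _, _ => by omega
  | b + 1, h1, h2, h3 => by
    by_cases hi : i + 1 < j + b
    · rw [cross, mul_assoc, h.cross_right (b := b) (by omega) h2 hi, ← mul_assoc,
        h.up_comm (by omega), mul_assoc]
    -- The generator exchanges the last two strands of the right block, so the recursion does not
    -- reach it. The passages of these two strands are pulled past each other by `up_up`.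
    · obtain ⟨b, rfl⟩ : ∃ b', b = b' + 1 := ⟨b - 1, by omega⟩
      obtain rfl : i = j + b := by omega
      have e := h.up_up (j := j + b) (l := j + b) (m := a + 1) (r := a) le_rfl (by omega) (by omega)
      have e1 : up s (j + b) (a + 1) = up s (j + b) a * s (j + b + a) := rfl
      rw [cross, cross, mul_assoc, mul_assoc, h.cross_comm (b := b) (by omega) (by omega),
        ← mul_assoc (up s (j + b) a), ← e1, ← mul_assoc, ← add_assoc, ← e, up_succ']
      simp only [mul_assoc]

theorem cross_cross_left (h : IsBraid N s) {j a b q c d : ℕ} (h1 : j + a + b ≤ N) (h2 : j ≤ q)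
    (h3 : q + c + d ≤ j + a) :
    cross s j a b * cross s q c d = cross s (q + b) c d * cross s j a b := by
  rw [← cross_shift_index]
  exact cross_semiconj fun i h4 h5 => h.cross_left h1 (by omega) (by omega)

theorem cross_cross_comm (h : IsBraid N s) {j a b q c d : ℕ} (h1 : j + a + b ≤ q)
    (h2 : q + c + d ≤ N) :
    cross s j a b * cross s q c d = cross s q c d * cross s j a b :=
  cross_semiconj fun i h4 h5 => h.cross_comm (by omega) (by omega)

/-- Both sides are the crossing of the joined block a + b with the block c, once after and once
before the crossing of a and b. So this is the naturality of a crossing in its left block. -/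
theorem cross_yang_baxter (h : IsBraid N s) {q a b c : ℕ} (h1 : q + a + b + c ≤ N) :
    cross s q b c * cross s (q + b) a c * cross s q a b =
      cross s (q + c) a b * cross s q a c * cross s (q + a) b c := by
  rw [← h.cross_add_left (by omega), mul_assoc, ← h.cross_add_left (by omega), add_comm b a]
  exact h.cross_cross_left (by omega) le_rfl (by omega)

end IsBraid

end cross

/-! ### The permutation of the strands, on natural numbers -/

/-- The permutation `ρ(g)` of the positions, extended by the identity to all natural numbers. -/
def rhoN (n : ℕ) : Braid n →* Equiv.Perm ℕ :=
  lift (fun j => Equiv.swap j (j + 1))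
    { comm := fun i j h1 h2 => by
        ext x
        simp only [Equiv.Perm.mul_apply, Equiv.swap_apply_def]
        split_ifs <;> omega
      braid := fun i h1 => by
        ext x
        simp only [Equiv.Perm.mul_apply, Equiv.swap_apply_def]
        split_ifs <;> omega }

theorem rhoN_sg {n j : ℕ} (h : j + 1 < n) : rhoN n (sg n j) = Equiv.swap j (j + 1) := lift_sg _ h

theorem rhoN_val {n : ℕ} (g : Braid n) : ∀ x : Fin n, rhoN n g x = rho n g x := by
  induction g using Braid.induction with
  | one => simp
  | gen j hj =>
    intro x
    rw [rhoN_sg hj, rho_sg hj, adjSwap_val hj, Equiv.swap_apply_def]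
  | mul x y hx hy => intro z; rw [map_mul, map_mul, Equiv.Perm.mul_apply, hy, hx]; rfl
  | inv x hx =>
    intro z
    rw [map_inv, map_inv, Equiv.Perm.inv_eq_iff_eq, hx, ← Equiv.Perm.mul_apply, mul_inv_cancel]
    rfl

theorem rhoN_of_le {n : ℕ} (g : Braid n) : ∀ x, n ≤ x → rhoN n g x = x := by
  induction g using Braid.induction with
  | one => simp
  | gen j hj =>
    intro x hx
    rw [rhoN_sg hj, Equiv.swap_apply_of_ne_of_ne (by omega) (by omega)]
  | mul x y hx hy => intro z hz; rw [map_mul, Equiv.Perm.mul_apply, hy z hz, hx z hz]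
  | inv x hx => intro z hz; rw [map_inv, Equiv.Perm.inv_eq_iff_eq, hx z hz]

theorem rhoN_lt {n : ℕ} (g : Braid n) {x : ℕ} (hx : x < n) : rhoN n g x < n := by
  rw [rhoN_val g ⟨x, hx⟩]; exact (rho n g _).2

theorem rhoN_inv_lt {n : ℕ} (g : Braid n) {x : ℕ} (hx : x < n) : (rhoN n g)⁻¹ x < n := by
  rw [← map_inv]; exact rhoN_lt _ hx

theorem rhoN_eq_one {n : ℕ} {g : Braid n} (hg : g ∈ PB n) : rhoN n g = 1 := by
  ext x
  by_cases hx : x < n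
  · rw [rhoN_val g ⟨x, hx⟩, show rho n g = 1 from hg]; rfl
  · exact rhoN_of_le g x (by omega)

/-- The sizes of the blocks after a braid. -/
def mv {n : ℕ} (g : Braid n) (w : ℕ → ℕ) : ℕ → ℕ := fun i => w ((rhoN n g)⁻¹ i)

theorem mv_one {n : ℕ} (w : ℕ → ℕ) : mv (1 : Braid n) w = w := by ext; simp [mv]

theorem mv_mul {n : ℕ} (g h : Braid n) (w : ℕ → ℕ) : mv (g * h) w = mv g (mv h w) := by
  ext; simp [mv]

theorem mv_pure {n : ℕ} {g : Braid n} (hg : g ∈ PB n) (w : ℕ → ℕ) : mv g w = w := by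
  ext; simp [mv, rhoN_eq_one hg]

theorem mv_sg {n j : ℕ} (h : j + 1 < n) (w : ℕ → ℕ) (i : ℕ) :
    mv (sg n j) w i = if i = j then w (j + 1) else if i = j + 1 then w j else w i := by
  rw [mv, rhoN_sg h, Equiv.swap_inv, Equiv.swap_apply_def]
  split_ifs <;> rfl

/-- The offset of the `j`-th block. -/
def offs (w : ℕ → ℕ) (j : ℕ) : ℕ := ∑ i ∈ Finset.range j, w i

theorem offs_zero (w : ℕ → ℕ) : offs w 0 = 0 := rfl

theorem offs_succ (w : ℕ → ℕ) (j : ℕ) : offs w (j + 1) = offs w j + w j :=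
  Finset.sum_range_succ _ _

theorem offs_mono (w : ℕ → ℕ) {i j : ℕ} (h : i ≤ j) : offs w i ≤ offs w j :=
  Finset.sum_le_sum_of_subset (Finset.range_mono h)

theorem offs_congr {w w' : ℕ → ℕ} {j : ℕ} (h : ∀ i < j, w i = w' i) : offs w j = offs w' j :=
  Finset.sum_congr rfl fun i hi => h i (Finset.mem_range.mp hi)

theorem offs_mv_sg {n j : ℕ} (h : j + 1 < n) (w : ℕ → ℕ) : ∀ i,
    offs (mv (sg n j) w) i = if i = j + 1 then offs w j + w (j + 1) else offs w i
  | 0 => by simp [offs_zero]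
  | i + 1 => by
    rw [offs_succ, offs_mv_sg h w i, mv_sg h]
    rcases (by omega : i < j ∨ i = j ∨ i = j + 1 ∨ j + 1 < i) with c | c | c | c
    · rw [if_neg (by omega), if_neg (by omega), if_neg (by omega), if_neg (by omega), offs_succ]
    · subst c; simp
    · subst c; simp [offs_succ]; omega
    · rw [if_neg (by omega), if_neg (by omega), if_neg (by omega), if_neg (by omega), offs_succ]

theorem offs_mv {n : ℕ} (g : Braid n) : ∀ w, offs (mv g w) n = offs w n := by
  induction g using Braid.induction with
  | one => simp [mv_one]
  | gen j hj => intro w; rw [offs_mv_sg hj, if_neg (by omega)]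
  | mul x y hx hy => intro w; rw [mv_mul, hx, hy]
  | inv x hx => intro w; rw [← hx, ← mv_mul, mul_inv_cancel, mv_one]

/-! ### Cabling of all strands -/

/-- The sizes of `n` blocks that fit to the right of the position `p` into `N` positions. -/
abbrev Sizes (N p n : ℕ) : Type := {w : ℕ → ℕ // p + offs w n ≤ N}

/-- The action of a braid on the sizes of the blocks. -/
def mvEquiv (N p : ℕ) {n : ℕ} (g : Braid n) : Sizes N p n ≃ Sizes N p n where
  toFun w := ⟨mv g w.1, by rw [offs_mv]; exact w.2⟩
  invFun w := ⟨mv g⁻¹ w.1, by rw [offs_mv]; exact w.2⟩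
  left_inv w := Subtype.ext (by simp only [← mv_mul, inv_mul_cancel, mv_one])
  right_inv w := Subtype.ext (by simp only [← mv_mul, mul_inv_cancel, mv_one])

/-- The action of `σ_{j+1}` on pairs (sizes of the blocks, braid composed so far). -/
def cabPerm (N p n j : ℕ) : Equiv.Perm (Sizes N p n × Braid N) :=
  Equiv.prodShear (mvEquiv N p (sg n j))
    fun w => Equiv.mulLeft (cross (sg N) (p + offs w.1 j) (w.1 j) (w.1 (j + 1)))

theorem cabPerm_apply (N p n j : ℕ) (x : Sizes N p n × Braid N) :
    cabPerm N p n j x = (mvEquiv N p (sg n j) x.1,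
      cross (sg N) (p + offs x.1.1 j) (x.1.1 j) (x.1.1 (j + 1)) * x.2) := rfl

/-- In the braid component, the commutation relation is the commutation of crossings with disjoint
supports, and the braid relation is the Yang-Baxter equation for three adjacent blocks. -/
theorem isBraid_cabPerm (N p n : ℕ) : IsBraid n (cabPerm N p n) where
  comm i j h1 h2 := by
    have hi : i + 1 < n := by omega
    refine Equiv.ext fun ⟨⟨w, hw⟩, b⟩ => Prod.ext (Subtype.ext ?_) ?_
    · simp only [Equiv.Perm.mul_apply, cabPerm_apply, mvEquiv, Equiv.coe_fn_mk, ← mv_mul,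
        (isBraid_sg n).comm i j h1 h2]
    · simp only [Equiv.Perm.mul_apply, cabPerm_apply, mvEquiv, Equiv.coe_fn_mk, ← mul_assoc]
      congr 1
      rw [offs_mv_sg h2, offs_mv_sg hi, if_neg (by omega), if_neg (by omega), mv_sg hi, mv_sg hi,
        mv_sg h2, mv_sg h2, if_neg (by omega), if_neg (by omega), if_neg (by omega),
        if_neg (by omega), if_neg (by omega), if_neg (by omega), if_neg (by omega),
        if_neg (by omega)]
      have e1 := offs_mono w (show i + 1 + 1 ≤ j by omega)
      have e2 := offs_mono w (show j + 1 + 1 ≤ n by omega)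
      rw [offs_succ, offs_succ] at e1 e2
      exact (isBraid_sg N).cross_cross_comm (by omega) (by omega)
  braid j h := by
    have hj : j + 1 < n := by omega
    refine Equiv.ext fun ⟨⟨w, hw⟩, b⟩ => Prod.ext (Subtype.ext ?_) ?_
    · simp only [Equiv.Perm.mul_apply, cabPerm_apply, mvEquiv, Equiv.coe_fn_mk, ← mv_mul,
        ← mul_assoc, (isBraid_sg n).braid j h]
    · simp only [Equiv.Perm.mul_apply, cabPerm_apply, mvEquiv, Equiv.coe_fn_mk, ← mul_assoc]
      congr 1
      have e2 := offs_mono w (show j + 1 + 1 + 1 ≤ n by omega)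
      rw [offs_succ, offs_succ, offs_succ] at e2
      simp [offs_mv_sg h, offs_mv_sg hj, mv_sg h, mv_sg hj, offs_succ,
        show ¬ j = j + 1 + 1 by omega, show ¬ j + 1 + 1 = j by omega]
      have := (isBraid_sg N).cross_yang_baxter (q := p + offs w j) (a := w j) (b := w (j + 1))
        (c := w (j + 2)) (by omega)
      simpa only [add_assoc] using this

/-- `B_n` acting on pairs (sizes of the blocks, braid composed so far). -/
def cabHom (N p n : ℕ) : Braid n →* Equiv.Perm (Sizes N p n × Braid N) :=
  lift (cabPerm N p n) (isBraid_cabPerm N p n)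

/-- The braid in `B_N` obtained from `g ∈ B_n` by replacing the strand that originates at the
position `i` by `w i` parallel strands, for all `i`, and adding `p` strands on the left (and further
strands on the right). -/
def cab (N p : ℕ) {n : ℕ} (w : ℕ → ℕ) (g : Braid n) : Braid N :=
  -- The value 1 for blocks that do not fit makes `cab_mul` hold without hypotheses, because `mv`
  -- preserves the total size.
  if h : p + offs w n ≤ N then (cabHom N p n g (⟨w, h⟩, 1)).2 else 1

theorem cabHom_apply {N p n : ℕ} (g : Braid n) : ∀ (w : Sizes N p n) (b : Braid N),
    cabHom N p n g (w, b) = (mvEquiv N p g w, cab N p w.1 g * b) := by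
  have key : ∀ (g : Braid n) (w : Sizes N p n), cab N p w.1 g = (cabHom N p n g (w, 1)).2 :=
    fun g w => dif_pos w.2
  simp only [key]
  induction g using Braid.induction with
  | one => intro w b; simp [mvEquiv, mv_one]
  | gen j hj => intro w b; simp [cabHom, lift_sg _ hj, cabPerm_apply]
  | mul x y hx hy =>
    intro w b
    rw [map_mul, Equiv.Perm.mul_apply, Equiv.Perm.mul_apply, hy w b, hy w 1, hx, hx _ (_ * 1)]
    simp [mul_assoc, mvEquiv, mv_mul]
  | inv x hx =>
    have k : ∀ (w : Sizes N p n) (b : Braid N), cabHom N p n x⁻¹ (w, b) =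
        (mvEquiv N p x⁻¹ w, (cabHom N p n x (mvEquiv N p x⁻¹ w, 1)).2⁻¹ * b) := by
      intro w b
      rw [map_inv, Equiv.Perm.inv_eq_iff_eq, hx]
      simp [mvEquiv, ← mv_mul, mv_one]
    intro w b
    rw [k w b, k w 1]
    simp

section

variable {N p n : ℕ}

theorem cab_of_not {w : ℕ → ℕ} (h : ¬ p + offs w n ≤ N) (g : Braid n) : cab N p w g = 1 :=
  dif_neg h

/-- Cabling is a cocycle: when g starts, the blocks have already been permuted by h. It is a
homomorphism only on pure braids. -/
theorem cab_mul (w : ℕ → ℕ) (g h : Braid n) :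
    cab N p w (g * h) = cab N p (mv h w) g * cab N p w h := by
  by_cases hw : p + offs w n ≤ N
  · rw [cab, dif_pos hw, map_mul, Equiv.Perm.mul_apply, cabHom_apply, cabHom_apply]
    simp [mvEquiv]
  · rw [cab_of_not hw, cab_of_not hw, cab_of_not (by rwa [offs_mv]), one_mul]

theorem cab_one (w : ℕ → ℕ) : cab N p w (1 : Braid n) = 1 := by
  have := cab_mul (N := N) (p := p) w (1 : Braid n) 1
  rw [mv_one, one_mul] at this
  exact (mul_eq_left.mp this.symm)

theorem cab_inv (w : ℕ → ℕ) (g : Braid n) : cab N p w g⁻¹ = (cab N p (mv g⁻¹ w) g)⁻¹ := by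
  have := cab_mul (N := N) (p := p) w g g⁻¹
  rw [mul_inv_cancel, cab_one] at this
  exact eq_inv_of_mul_eq_one_right this.symm

theorem cab_sg {w : ℕ → ℕ} (hw : p + offs w n ≤ N) {j : ℕ} (hj : j + 1 < n) :
    cab N p w (sg n j) = cross (sg N) (p + offs w j) (w j) (w (j + 1)) := by
  rw [cab, dif_pos hw]
  simp [cabHom, lift_sg _ hj, cabPerm_apply]

theorem cab_mul_pure (w : ℕ → ℕ) (g : Braid n) {h : Braid n} (hh : h ∈ PB n) :
    cab N p w (g * h) = cab N p w g * cab N p w h := by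
  rw [cab_mul, mv_pure hh]

theorem cab_inv_pure (w : ℕ → ℕ) {g : Braid n} (hg : g ∈ PB n) :
    cab N p w g⁻¹ = (cab N p w g)⁻¹ := by
  rw [cab_inv, mv_pure (inv_mem hg)]

theorem mv_congr {w w' : ℕ → ℕ} (h : ∀ i < n, w i = w' i) (g : Braid n) :
    ∀ i < n, mv g w i = mv g w' i := fun _ hi => h _ (rhoN_inv_lt g hi)

theorem cab_congr (g : Braid n) : ∀ {w w' : ℕ → ℕ}, (∀ i < n, w i = w' i) →
    cab N p w g = cab N p w' g := by
  induction g using Braid.induction with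
  | one => intros; rw [cab_one, cab_one]
  | gen j hj =>
    intro w w' h
    by_cases hw : p + offs w n ≤ N
    · rw [cab_sg hw hj, cab_sg (by rwa [← offs_congr h]) hj, h j (by omega), h _ hj,
        offs_congr fun i hi => h i (by omega)]
    · rw [cab_of_not hw, cab_of_not (by rwa [← offs_congr h])]
  | mul x y hx hy => intro w w' h; rw [cab_mul, cab_mul, hy h, hx (mv_congr h y)]
  | inv x hx => intro w w' h; rw [cab_inv, cab_inv, hx (mv_congr h _)]

/-- Cabling as a homomorphism on pure braids. -/
def cabPB (N p : ℕ) {n : ℕ} (w : ℕ → ℕ) : PB n →* Braid N where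
  toFun g := cab N p w g.1
  map_one' := cab_one w
  map_mul' g h := cab_mul_pure w g.1 h.2

end

end GTSh

namespace GTSh

open CategoryTheory Braid

/-! ### Cablings of cablings -/

theorem mv_up {n q : ℕ} : ∀ {a : ℕ} (_ : q + a < n) (W : ℕ → ℕ) (i : ℕ),
    mv (up (sg n) q a) W i =
      if i < q then W i else if i = q then W (q + a) else if i ≤ q + a then W (i - 1) else W i
  | 0, h, W, i => by
    rw [up, mv_one]
    split_ifs <;> first | rfl | (congr 1 <;> omega)
  | a + 1, h, W, i => by
    rw [up, mv_mul, mv_up (a := a) (by omega)]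
    simp only [mv_sg (show q + a + 1 < n by omega)]
    split_ifs <;> first | rfl | omega | (congr 1; omega)

theorem mv_cross {n q a : ℕ} : ∀ {b : ℕ} (_ : q + a + b ≤ n) (W : ℕ → ℕ) (i : ℕ),
    mv (cross (sg n) q a b) W i =
      if i < q then W i else if i < q + b then W (i + a) else if i < q + a + b then W (i - b)
        else W i
  | 0, h, W, i => by
    rw [cross, mv_one]
    split_ifs <;> first | rfl | omega
  | b + 1, h, W, i => by
    rw [cross, mv_mul, mv_up (by omega)]
    simp only [mv_cross (b := b) (show q + a + b ≤ n by omega)]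
    split_ifs <;> first | rfl | omega | (congr 1; omega)

/-- The total size of the `l` blocks from the position `q` on. -/
def bsum (W : ℕ → ℕ) (q l : ℕ) : ℕ := ∑ x ∈ Finset.range l, W (q + x)

theorem bsum_succ (W : ℕ → ℕ) (q l : ℕ) : bsum W q (l + 1) = bsum W q l + W (q + l) :=
  Finset.sum_range_succ _ _

theorem bsum_congr {W W' : ℕ → ℕ} {q q' l : ℕ} (h : ∀ x < l, W (q + x) = W' (q' + x)) :
    bsum W q l = bsum W' q' l :=
  Finset.sum_congr rfl fun i hi => h i (Finset.mem_range.mp hi)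

theorem offs_add (W : ℕ → ℕ) (q l : ℕ) : offs W (q + l) = offs W q + bsum W q l :=
  Finset.sum_range_add _ _ _

theorem cab_up {N P n q : ℕ} : ∀ {a : ℕ} (_ : q + a < n) {W : ℕ → ℕ} (_ : P + offs W n ≤ N),
    cab N P W (up (sg n) q a) = cross (sg N) (P + offs W q) (bsum W q a) (W (q + a))
  | 0, h, W, hW => by simp [up, cab_one, bsum, cross_zero_left]
  | a + 1, h, W, hW => by
    have hb := offs_mono W (show q + a + 1 + 1 ≤ n by omega)
    rw [offs_succ, offs_succ, offs_add] at hb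
    rw [up, cab_mul, cab_sg hW (by omega), cab_up (by omega) (by rwa [offs_mv]), mv_sg (by omega),
      if_pos rfl, offs_mv_sg (by omega), if_neg (by omega), bsum_succ,
      (isBraid_sg N).cross_add_left (by rw [← add_assoc]; omega), offs_add,
      bsum_congr (W' := W) (q' := q)]
    · simp only [add_assoc]
    · intro x hx
      rw [mv_sg (by omega), if_neg (by omega), if_neg (by omega)]

/-- This is the associativity of cabling on a generator: blocks of blocks cross as blocks of the
total sizes. -/
theorem cab_cross {N P n q a : ℕ} : ∀ {b : ℕ} (_ : q + a + b ≤ n) {W : ℕ → ℕ}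
    (_ : P + offs W n ≤ N),
    cab N P W (cross (sg n) q a b) = cross (sg N) (P + offs W q) (bsum W q a) (bsum W (q + a) b)
  | 0, h, W, hW => by simp [cross, cab_one, bsum]
  | b + 1, h, W, hW => by
    have e : mv (cross (sg n) q a b) W (q + b + a) = W (q + a + b) := by
      rw [mv_cross (by omega), if_neg (by omega), if_neg (by omega), if_neg (by omega)]
      congr 1; omega
    have e1 : bsum (mv (cross (sg n) q a b) W) (q + b) a = bsum W q a :=
      bsum_congr fun x hx => by
        rw [mv_cross (by omega), if_neg (by omega), if_neg (by omega), if_pos (by omega)]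
        congr 1; omega
    have e2 : bsum (mv (cross (sg n) q a b) W) q b = bsum W (q + a) b :=
      bsum_congr fun x hx => by
        rw [mv_cross (by omega), if_neg (by omega), if_pos (by omega)]
        congr 1; omega
    have e3 : offs (mv (cross (sg n) q a b) W) q = offs W q :=
      offs_congr fun x hx => by rw [mv_cross (by omega), if_pos hx]
    rw [cross, cab_mul, cab_up (by omega) (by rwa [offs_mv]), cab_cross (by omega) hW, bsum_succ,
      cross_add_right, e, e1, offs_add, e2, e3]
    simp only [add_assoc]

/-- The sizes of the blocks obtained by merging blocks according to `w`, from the `p`-th on. -/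
def mrg (p : ℕ) (w W : ℕ → ℕ) (i : ℕ) : ℕ := bsum W (p + offs w i) (w i)

theorem offs_mrg (p : ℕ) (w W : ℕ → ℕ) :
    ∀ j, offs W p + offs (mrg p w W) j = offs W (p + offs w j)
  | 0 => by simp [offs_zero]
  | j + 1 => by
    rw [offs_succ, offs_succ, ← add_assoc, offs_mrg p w W j, ← add_assoc, offs_add W _ (w j)]
    rfl

/-- The associativity of cabling, together with two statements about sizes that carry the induction:
in a product the left factor acts on sizes which the right factor has moved, so moving must commute
with merging and must leave the blocks before p alone. -/
theorem cab_cab_aux {N P n p r : ℕ} (g : Braid r) : ∀ {w W : ℕ → ℕ}, p + offs w r ≤ n →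
    P + offs W n ≤ N →
    cab N P W (cab n p w g) = cab N (P + offs W p) (mrg p w W) g ∧
    (∀ i < r, mrg p (mv g w) (mv (cab n p w g) W) i = mv g (mrg p w W) i) ∧
    (∀ x < p, mv (cab n p w g) W x = W x) := by
  induction g using Braid.induction with
  | one => intro w W _ _; simp [cab_one, mv_one]
  | gen j hj =>
    intro w W hw hW
    have e2 := offs_mono w (show j + 1 + 1 ≤ r by omega)
    rw [offs_succ, offs_succ] at e2
    have hb : P + offs W p + offs (mrg p w W) r ≤ N := by
      rw [add_assoc, offs_mrg]; have := offs_mono W hw; omega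
    rw [cab_sg hw hj]
    refine ⟨?_, fun i hi => ?_, fun x hx => ?_⟩
    · rw [cab_cross (by omega) hW, cab_sg hb hj, add_assoc P, offs_mrg]
      simp only [mrg, offs_succ, add_assoc]
    · rw [mv_sg hj]
      rcases (by omega : i < j ∨ i = j ∨ i = j + 1 ∨ j + 1 < i) with c | c | c | c
      · have := offs_mono w (show i + 1 ≤ j by omega)
        rw [offs_succ] at this
        rw [if_neg (by omega), if_neg (by omega), mrg, mrg, offs_mv_sg hj, if_neg (by omega),
          mv_sg hj, if_neg (by omega), if_neg (by omega)]
        exact bsum_congr fun x hx => by rw [mv_cross (by omega), if_pos (by omega)]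
      · subst c
        rw [if_pos rfl, mrg, mrg, offs_mv_sg hj, if_neg (by omega), mv_sg hj, if_pos rfl, offs_succ]
        exact bsum_congr fun x hx => by
          rw [mv_cross (by omega), if_neg (by omega), if_pos (by omega)]; congr 1; omega
      · subst c
        rw [if_neg (by omega), if_pos rfl, mrg, mrg, offs_mv_sg hj, if_pos rfl, mv_sg hj,
          if_neg (by omega), if_pos rfl]
        exact bsum_congr fun x hx => by
          rw [mv_cross (by omega), if_neg (by omega), if_neg (by omega), if_pos (by omega)]
          congr 1; omega
      · have := offs_mono w (show j + 1 + 1 ≤ i by omega)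
        rw [offs_succ, offs_succ] at this
        rw [if_neg (by omega), if_neg (by omega), mrg, mrg, offs_mv_sg hj, if_neg (by omega),
          mv_sg hj, if_neg (by omega), if_neg (by omega)]
        exact bsum_congr fun x hx => by
          rw [mv_cross (by omega), if_neg (by omega), if_neg (by omega), if_neg (by omega)]
    · rw [mv_cross (by omega), if_pos (by omega)]
  | mul x y hx hy =>
    intro w W hw hW
    obtain ⟨y1, y2, y3⟩ := hy hw hW
    obtain ⟨x1, x2, x3⟩ := hx (w := mv y w) (W := mv (cab n p w y) W) (by rwa [offs_mv])
      (by rwa [offs_mv])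
    refine ⟨?_, fun i hi => ?_, fun i hi => ?_⟩
    · rw [cab_mul, cab_mul, y1, x1, cab_mul, cab_congr x y2, offs_congr y3]
    · rw [cab_mul, mv_mul, mv_mul, mv_mul, x2 i hi, mv_congr y2 x i hi]
    · rw [cab_mul, mv_mul, x3 i hi, y3 i hi]
  | inv x hx =>
    intro w W hw hW
    -- The hypothesis on x is used at the sizes already moved by the inverse of x, so that x leads
    -- back to w and W.
    obtain ⟨x1, x2, x3⟩ := hx (w := mv x⁻¹ w) (W := mv (cab n p w x⁻¹) W)
      (by rwa [offs_mv]) (by rwa [offs_mv])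
    have hY : cab n p (mv x⁻¹ w) x * cab n p w x⁻¹ = 1 := by
      rw [← cab_mul, mul_inv_cancel, cab_one]
    have e1 : mv (cab n p (mv x⁻¹ w) x) (mv (cab n p w x⁻¹) W) = W := by
      rw [← mv_mul, hY, mv_one]
    have e2 : mv x (mv x⁻¹ w) = w := by rw [← mv_mul, mul_inv_cancel, mv_one]
    rw [e1] at x2 x3
    rw [e2] at x2
    have key : ∀ i < r, mrg p (mv x⁻¹ w) (mv (cab n p w x⁻¹) W) i = mv x⁻¹ (mrg p w W) i := by
      intro i hi
      rw [mv_congr x2 x⁻¹ i hi, ← mv_mul, inv_mul_cancel, mv_one]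
    refine ⟨?_, key, fun i hi => (x3 i hi).symm⟩
    have := cab_mul (N := N) (p := P) W (cab n p (mv x⁻¹ w) x) (cab n p w x⁻¹)
    rw [hY, cab_one, x1] at this
    rw [cab_inv (mrg p w W) x, ← cab_congr x key, ← offs_congr fun i hi => (x3 i hi).symm]
    exact (inv_eq_of_mul_eq_one_right this.symm).symm

theorem cab_cab {N P n p r : ℕ} (g : Braid r) {w W : ℕ → ℕ} (hw : p + offs w r ≤ n)
    (hW : P + offs W n ≤ N) :
    cab N P W (cab n p w g) = cab N (P + offs W p) (mrg p w W) g := (cab_cab_aux g hw hW).1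

/-! ### Naturality of cabling -/

/-- Blocks travel rigidly: a generator inside a block slides through every crossing by `cross_left`
and `cross_right` and comes out in the place to which the block has moved. -/
theorem cab_block {N p n : ℕ} (g : Braid n) : ∀ {w : ℕ → ℕ}, p + offs w n ≤ N →
    ∀ {j x : ℕ}, j < n → x + 1 < w j →
    cab N p w g * sg N (p + offs w j + x) =
      sg N (p + offs (mv g w) (rhoN n g j) + x) * cab N p w g := by
  have hs := isBraid_sg N
  induction g using Braid.induction with
  | one => intro w _ j x _ _; simp [cab_one, mv_one]
  | gen i hi =>
    intro w hw j x hj hx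
    have e := offs_mono w (show i + 1 + 1 ≤ n by omega)
    rw [offs_succ, offs_succ] at e
    have e' := offs_mono w (show j + 1 ≤ n by omega)
    rw [offs_succ] at e'
    rw [cab_sg hw hi, rhoN_sg hi, offs_mv_sg hi, Equiv.swap_apply_def]
    rcases (by omega : j < i ∨ j = i ∨ j = i + 1 ∨ i + 1 < j) with c | c | c | c
    · have := offs_mono w (show j + 1 ≤ i by omega)
      rw [offs_succ] at this
      rw [if_neg (show j ≠ i by omega), if_neg (show j ≠ i + 1 by omega), if_neg (by omega)]
      exact hs.cross_comm (by omega) (by omega)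
    · subst c
      rw [if_pos rfl, if_pos rfl, hs.cross_left (by omega) (by omega) (by omega)]
      congr 2; omega
    · subst c
      rw [if_neg (show i + 1 ≠ i by omega), if_pos rfl, if_neg (by omega), offs_succ,
        ← hs.cross_right (i := p + offs w i + x) (by omega) (by omega) (by omega)]
      congr 2; omega
    · have := offs_mono w (show i + 1 + 1 ≤ j by omega)
      rw [offs_succ, offs_succ] at this
      rw [if_neg (show j ≠ i by omega), if_neg (show j ≠ i + 1 by omega), if_neg (by omega)]
      exact hs.cross_comm (by omega) (by omega)
  | mul u v hu hv =>
    intro w hw j x hj hx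
    rw [cab_mul, mul_assoc, hv hw hj hx, ← mul_assoc, hu (by rwa [offs_mv]) (rhoN_lt v hj)
      (by simpa [mv] using hx), mv_mul, map_mul, Equiv.Perm.mul_apply, mul_assoc]
  | inv u hu =>
    intro w hw j x hj hx
    have := hu (w := mv u⁻¹ w) (by rwa [offs_mv]) (j := (rhoN n u)⁻¹ j) (x := x) (rhoN_inv_lt u hj)
      (by simpa [mv] using hx)
    rw [← mv_mul, mul_inv_cancel, mv_one, ← Equiv.Perm.mul_apply, mul_inv_cancel, Equiv.Perm.one_apply] at this
    rw [cab_inv, inv_mul_eq_iff_eq_mul, ← mul_assoc, map_inv, this, mul_inv_cancel_right]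

theorem cab_outside {N p n : ℕ} (g : Braid n) : ∀ {w : ℕ → ℕ}, p + offs w n ≤ N → ∀ {i : ℕ},
    (i + 2 ≤ p ∨ p + offs w n ≤ i ∧ i + 1 < N) →
    cab N p w g * sg N i = sg N i * cab N p w g := by
  have hs := isBraid_sg N
  induction g using Braid.induction with
  | one => intro w _ i _; simp [cab_one]
  | gen j hj =>
    intro w hw i hi
    have e := offs_mono w (show j + 1 + 1 ≤ n by omega)
    rw [offs_succ, offs_succ] at e
    rw [cab_sg hw hj]
    exact hs.cross_comm (by omega) (by omega)
  | mul u v hu hv =>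
    intro w hw i hi
    rw [cab_mul, mul_assoc, hv hw hi, ← mul_assoc, hu (by rwa [offs_mv]) (by rwa [offs_mv]),
      mul_assoc]
  | inv u hu =>
    intro w hw i hi
    rw [cab_inv, inv_mul_eq_iff_eq_mul, ← mul_assoc, hu (by rwa [offs_mv]) (by rwa [offs_mv]),
      mul_inv_cancel_right]

/-! ### Adding strands and cabling one strand -/

theorem mv_const {n : ℕ} (g : Braid n) (c : ℕ) : mv g (fun _ => c) = fun _ => c := rfl

theorem offs_const_one (j : ℕ) : offs (fun _ => 1) j = j := by simp [offs]

theorem shift_eq_cab {m N p : ℕ} (h : p + m ≤ N) (g : Braid m) :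
    shift p h g = cab N p (fun _ => 1) g := by
  induction g using Braid.induction with
  | one => rw [map_one, cab_one]
  | gen j hj =>
    rw [shift_sg h hj, cab_sg (by rwa [offs_const_one]) hj, offs_const_one]
    simp [cross, up]
  | mul x y hx hy => rw [map_mul, hx, hy, cab_mul, mv_const]
  | inv x hx => rw [map_inv, hx, cab_inv, mv_const]

theorem shift_self {n : ℕ} (g : Braid n) : shift 0 (by omega : 0 + n ≤ n) g = g := by
  have : shift 0 (by omega : 0 + n ≤ n) = MonoidHom.id (Braid n) :=
    hom_ext fun i hi => by rw [shift_sg _ hi, zero_add]; rfl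
  rw [this]; rfl

/-- The sizes `1, …, 1, k + 1, 1, …`, with `k + 1` at the position `p`. -/
def cabW (k p : ℕ) (i : ℕ) : ℕ := if i = p then k + 1 else 1

theorem offs_cabW (k p : ℕ) : ∀ i, offs (cabW k p) i = if p < i then i + k else i
  | 0 => by simp [offs_zero]
  | i + 1 => by
    rw [offs_succ, offs_cabW k p i, cabW]
    split_ifs <;> omega

theorem mv_cabW {n k : ℕ} (g : Braid n) (p : ℕ) : mv g (cabW k p) = cabW k (rhoN n g p) := by
  ext i
  simp only [mv, cabW, Equiv.Perm.inv_eq_iff_eq]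

theorem cable_eq_cab {n k : ℕ} (g : Braid n) : ∀ (p : Fin n),
    cable k p g = cab (n + k) 0 (cabW k p) g := by
  induction g using Braid.induction with
  | one => intro p; rw [cable_one, cab_one]
  | gen j hj =>
    intro p
    have hp := p.2
    rw [cable_sg hj, cab_sg (by rw [offs_cabW, if_pos hp]; omega) hj, offs_cabW, cabW, cabW]
    rcases (by omega : p.1 < j ∨ p.1 = j ∨ p.1 = j + 1 ∨ j + 1 < p.1) with c | c | c | c
    · rw [cableGen_lt c, if_pos c, if_neg (by omega), if_neg (by omega)]
      simp [cross, up]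
    · rw [cableGen_eq c, if_neg (by omega), if_pos c.symm, if_neg (by omega), cross_one_right,
        zero_add]
    · rw [cableGen_eq' c, if_neg (by omega), if_neg (by omega), if_pos c.symm, cross_one_left,
        zero_add]
    · rw [cableGen_gt c, if_neg (by omega), if_neg (by omega), if_neg (by omega)]
      simp [cross, up]
  | mul x y hx hy => intro p; rw [cable_mul, hx, hy, cab_mul, mv_cabW, rhoN_val]
  | inv x hx =>
    intro p
    rw [cable_inv, hx, cab_inv, mv_cabW, ← map_inv, rhoN_val]

/-! ### Pulling back subgroups -/

/-- The pure braids all of whose cablings lie in `M`. -/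
def pull {N : ℕ} (M : Subgroup (Braid N)) (n : ℕ) : Subgroup (Braid n) where
  -- The sizes may be zero, so deletion of strands is among the cablings; linking numbers depend on
  -- this later.
  carrier := {g | g ∈ PB n ∧ ∀ p w, cab N p w g ∈ M}
  mul_mem' {g h} hg hh := ⟨mul_mem hg.1 hh.1, fun p w => by
    rw [cab_mul_pure w g hh.1]; exact mul_mem (hg.2 p w) (hh.2 p w)⟩
  one_mem' := ⟨one_mem _, fun p w => by rw [cab_one]; exact one_mem _⟩
  inv_mem' {g} hg := ⟨inv_mem hg.1, fun p w => by
    rw [cab_inv_pure w hg.1]; exact inv_mem (hg.2 p w)⟩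

instance PB_normal (n : ℕ) : (PB n).Normal := MonoidHom.normal_ker (rho n)

instance pull_normal {N : ℕ} (M : Subgroup (Braid N)) [hM : M.Normal] (n : ℕ) :
    (pull M n).Normal where
  conj_mem h hh g := ⟨(PB_normal n).conj_mem h hh.1 g, fun p w => by
    rw [cab_mul, cab_mul, mv_pure hh.1, cab_inv]
    exact hM.conj_mem _ (hh.2 p _) _⟩

/-- Only finitely many conditions count: cablings that do not fit are trivial, those that fit have p
and all sizes at most N, and sizes beyond the n-th are irrelevant. -/
instance pull_finiteIndex {N : ℕ} (M : Subgroup (Braid N)) [M.FiniteIndex] (n : ℕ) :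
    (pull M n).FiniteIndex := by
  let I := Fin (N + 1) × (Fin n → Fin (N + 1))
  let W : (Fin n → Fin (N + 1)) → ℕ → ℕ := fun w i => if h : i < n then w ⟨i, h⟩ else 0
  have h3 : (⨅ x : I, M.comap (cabPB (n := n) N x.1 (W x.2))).FiniteIndex :=
    Subgroup.finiteIndex_iInf fun p => finiteIndex_comap _ _
  have h4 : ((⨅ x : I, M.comap (cabPB (n := n) N x.1 (W x.2))).map (PB n).subtype).FiniteIndex := by
    refine ⟨?_⟩
    rw [Subgroup.index_map_subtype]
    exact mul_ne_zero h3.index_ne_zero (PB_finiteIndex n).index_ne_zero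
  refine Subgroup.finiteIndex_of_le
    (H := (⨅ x : I, M.comap (cabPB (n := n) N x.1 (W x.2))).map (PB n).subtype) ?_
  rintro _ ⟨y, hy, rfl⟩
  refine ⟨y.2, fun p w => ?_⟩
  by_cases hw : p + offs w n ≤ N
  · have hi : ∀ i < n, w i < N + 1 := fun i hi => by
      have := offs_mono w (show i + 1 ≤ n by omega)
      rw [offs_succ] at this; omega
    have := Subgroup.mem_iInf.mp hy (⟨p, by omega⟩, fun i => ⟨w i, hi i i.2⟩)
    change cab N p _ y.1 ∈ M at this
    rwa [cab_congr (w' := w)] at this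
    intro i hi
    simp only [W, dif_pos hi]
  · rw [cab_of_not hw]; exact one_mem _

/-- This is what `pull` is for. The braids g and h need not be pure; their quotient is, so it does
not disturb the block sizes, and its cablings lie in M. -/
theorem cab_mk_eq {N n p : ℕ} {M : Subgroup (Braid N)} [M.Normal] {g h : Braid n} (w : ℕ → ℕ)
    (e : (g : Braid n ⧸ pull M n) = h) :
    (cab N p w g : Braid N ⧸ M) = cab N p w h := by
  rw [QuotientGroup.eq] at e ⊢
  have h2 : h = g * (g⁻¹ * h) := by group
  rw [h2, cab_mul_pure w g e.1, ← mul_assoc, inv_mul_cancel, one_mul]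
  exact e.2 p w

end GTSh

namespace GTSh

open CategoryTheory Braid

/-! ### Local modifications of parenthesizations -/

namespace Paren

theorem size_pos : ∀ t : Paren, 0 < t.size
  | leaf => Nat.one_pos
  | node l _ => Nat.add_pos_left l.size_pos _

/-- `At u u' q t t'`: the parenthesization `t'` is obtained from `t` by replacing the part `u`,
which starts at the position `q`, by `u'`. -/
inductive At (u u' : Paren) : ℕ → Paren → Paren → Prop
  | here : At u u' 0 u u'
  | left {q l l' r} : At u u' q l l' → At u u' q (node l r) (node l' r)
  | right {q l r r'} : At u u' q r r' → At u u' (l.size + q) (node l r) (node l r')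

namespace At

variable {u u' t t' s s' : Paren} {q p k : ℕ}

theorem size_eq (hu : u.size = u'.size) (h : At u u' q t t') : t.size = t'.size := by
  induction h with
  | here => exact hu
  | left _ ih => simp [size, ih]
  | right _ ih => simp [size, ih]

theorem le_size (h : At u u' q t t') : q + u.size ≤ t.size := by
  induction h with
  | here => simp
  | left _ ih => simp only [size]; omega
  | right _ ih => simp only [size]; omega

theorem symm (h : At u u' q t t') : At u' u q t' t := by
  induction h with
  | here => exact here
  | left _ ih => exact ih.left
  | right _ ih => exact ih.right

theorem split (h : At u u' q t t') (v : Paren) : ∃ s, At u v q t s ∧ At v u' q s t' := by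
  induction h with
  | here => exact ⟨v, here, here⟩
  | left _ ih => obtain ⟨s, h1, h2⟩ := ih; exact ⟨_, h1.left, h2.left⟩
  | right _ ih => obtain ⟨s, h1, h2⟩ := ih; exact ⟨_, h1.right, h2.right⟩

theorem graft_in (h : At u u' q t t') : ∀ {s : Paren} {p : ℕ}, p < s.size →
    At u u' (p + q) (graft t s p) (graft t' s p)
  | leaf, p, hp => by
    obtain rfl : p = 0 := by simpa [size] using hp
    simpa [graft] using h
  | node l r, p, hp => by
    simp only [size] at hp
    simp only [graft]
    split_ifs with c
    · exact (graft_in h c).left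
    · have := (graft_in h (s := r) (p := p - l.size) (by omega)).right (l := l)
      rwa [show l.size + (p - l.size + q) = p + q by omega] at this

theorem graft_lt (hu : u.size = u'.size) (ht : t.size = k + 1) (h : At u u' q s s') :
    ∀ {p : ℕ}, p < q → At u u' (q + k) (graft t s p) (graft t s' p) := by
  induction h with
  | here => intro p hp; omega
  | @left q l l' r h ih =>
    intro p hp
    have h1 := h.le_size
    have h2 := h.size_eq hu
    have := u.size_pos
    rw [graft, graft, if_pos (by omega), if_pos (by omega)]
    exact (ih hp).left
  | @right q l r r' h ih =>
    intro p hp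
    rw [graft, graft]
    split_ifs with c
    · have := h.right (l := graft t l p)
      have e := size_graft t l p c
      rwa [show (graft t l p).size + q = l.size + q + k by omega] at this
    · rw [add_assoc]
      exact (ih (by omega)).right

theorem graft_ge (hu : u.size = u'.size) (h : At u u' q s s') :
    ∀ {p : ℕ}, q + u.size ≤ p → p < s.size → At u u' q (graft t s p) (graft t s' p) := by
  induction h with
  | here => intro p hp hp'; omega
  | @left q l l' r h ih =>
    intro p hp hp'
    have h2 := h.size_eq hu
    rw [graft, graft, h2]
    split_ifs with c
    · exact (ih hp (by omega)).left
    · exact h.left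
  | @right q l r r' h ih =>
    intro p hp hp'
    simp only [size] at hp'
    rw [graft, graft, if_neg (by omega), if_neg (by omega)]
    exact (ih (by omega) (by omega)).right

/-- The positions i and i' may differ, since a generator carries the substituted leaf from one place
of the pair to the other. -/
theorem graft_inside (hu : u.size = u'.size) {i i' : ℕ} (hi : i < u.size) (hi' : i' < u'.size)
    (h : At u u' q s s') :
    At (graft t u i) (graft t u' i') q (graft t s (q + i)) (graft t s' (q + i')) := by
  induction h with
  | here => simpa using here
  | @left q l l' r h ih =>
    have h1 := h.le_size
    have h2 := h.size_eq hu
    rw [graft, graft, if_pos (by omega), if_pos (by omega)]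
    exact ih.left
  | @right q l r r' h ih =>
    rw [graft, graft, if_neg (by omega), if_neg (by omega),
      show l.size + q + i - l.size = q + i by omega,
      show l.size + q + i' - l.size = q + i' by omega]
    exact ih.right

end At

/-- `t'` is obtained from `t` by moving a pair of parentheses to the right. -/
def AssocMove (t t' : Paren) : Prop :=
  ∃ q x y z, At (node (node x y) z) (node x (node y z)) q t t'

theorem assoc_size (x y z : Paren) : (node (node x y) z).size = (node x (node y z)).size := by
  simp only [size]; omega

theorem AssocMove.size_eq {t t' : Paren} (h : AssocMove t t') : t.size = t'.size := by
  obtain ⟨q, x, y, z, h⟩ := h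
  exact h.size_eq (assoc_size x y z)

/-- The parenthesization `((12)3)⋯` of a sequence of length `n + 1`. -/
def comb : ℕ → Paren
  | 0 => leaf
  | n + 1 => node (comb n) leaf

theorem size_comb : ∀ n, (comb n).size = n + 1
  | 0 => rfl
  | n + 1 => by rw [comb, size, size_comb n]; rfl

open Relation in
theorem eqvGen_left {l l' : Paren} (r : Paren) (h : EqvGen AssocMove l l') :
    EqvGen AssocMove (node l r) (node l' r) := by
  induction h with
  | rel _ _ h => obtain ⟨q, x, y, z, h⟩ := h; exact .rel _ _ ⟨q, x, y, z, h.left⟩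
  | refl => exact .refl _
  | symm _ _ _ ih => exact .symm _ _ ih
  | trans _ _ _ _ _ ih1 ih2 => exact .trans _ _ _ ih1 ih2

-- One move pulls the left half x of the right factor out of its parentheses; then x and y are
-- absorbed into the comb one after the other.
open Relation in
theorem eqvGen_node_comb : ∀ (r : Paren) (a : ℕ),
    EqvGen AssocMove (node (comb a) r) (comb (a + r.size))
  | leaf, a => .refl _
  | node x y, a => by
    refine .trans _ _ _ (.symm _ _ (.rel _ _ ⟨0, comb a, x, y, .here⟩)) ?_
    refine .trans _ _ _ (eqvGen_left y (eqvGen_node_comb x a)) ?_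
    rw [size, ← add_assoc]
    exact eqvGen_node_comb y (a + x.size)

-- Moves connect all parenthesizations of a given length, through the left comb. The index is one
-- less than the size because `comb n` has n + 1 entries.
open Relation in
theorem eqvGen_comb : ∀ t : Paren, EqvGen AssocMove t (comb (t.size - 1))
  | leaf => .refl _
  | node l r => by
    refine .trans _ _ _ (eqvGen_left r (eqvGen_comb l)) ?_
    have := eqvGen_node_comb r (l.size - 1)
    have h := l.size_pos
    rwa [show l.size - 1 + r.size = (node l r).size - 1 by simp only [size]; omega] at this

/-- Every braid is composed of moves of parentheses, and of generators at pairs of neighbours which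
are enclosed in parentheses. -/
theorem braid_induction {n : ℕ} {P : Paren → Paren → Braid n → Prop}
    (one : ∀ t, t.size = n → P t t 1)
    (move : ∀ q x y z t t', t.size = n → At (node (node x y) z) (node x (node y z)) q t t' →
      P t t' 1)
    (gen : ∀ i t, t.size = n → i + 1 < n → At (node leaf leaf) (node leaf leaf) i t t →
      P t t (sg n i))
    (mul : ∀ t t' t'' g g', t.size = n → t'.size = n → t''.size = n → P t t' g → P t' t'' g' →
      P t t'' (g' * g))
    (inv : ∀ t t' g, t.size = n → t'.size = n → P t t' g → P t' t g⁻¹)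
    {t t' : Paren} (ht : t.size = n) (ht' : t'.size = n) (g : Braid n) : P t t' g := by
  have key : ∀ t t', Relation.EqvGen AssocMove t t' →
      t.size = t'.size ∧ (t.size = n → P t t' 1) := by
    intro t t' h
    induction h with
    | rel t t' h =>
      refine ⟨h.size_eq, fun ht => ?_⟩
      obtain ⟨q, x, y, z, h⟩ := h
      exact move q x y z t t' ht h
    | refl t => exact ⟨rfl, one t⟩
    | symm t t' _ ih =>
      refine ⟨ih.1.symm, fun ht => ?_⟩
      have e := ih.1.trans ht
      simpa using inv t t' 1 e ht (ih.2 e)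
    | trans t t' t'' _ _ ih1 ih2 =>
      refine ⟨ih1.1.trans ih2.1, fun ht => ?_⟩
      have e := ih1.1.symm.trans ht
      simpa using mul t t' t'' 1 1 ht e (ih2.1.symm.trans e) (ih1.2 ht) (ih2.2 e)
  have key2 : ∀ t t', t.size = n → t'.size = n → P t t' 1 := by
    intro t t' ht ht'
    have h1 := eqvGen_comb t
    have h2 := eqvGen_comb t'
    rw [ht] at h1
    rw [ht'] at h2
    exact (key t t' (.trans _ _ _ h1 (.symm _ _ h2))).2 ht
  -- The parenthesization may be changed at will by the unit braid, so each generator can be treated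
  -- where its two strands are enclosed together.
  have conj : ∀ s t t' g, s.size = n → t.size = n → t'.size = n → P s s g → P t t' g := by
    intro s t t' g hs ht ht' h
    simpa using mul t s t' _ 1 ht hs ht' (mul t s s 1 g ht hs hs (key2 t s ht hs) h)
      (key2 s t' hs ht')
  refine conj t t t' g ht ht ht' ?_
  clear ht' t'
  induction g using Braid.induction with
  | one => exact one t ht
  | gen i hi =>
    -- `comb (n - 2)` has n - 1 entries; a pair substituted for the i-th one gives n entries, of
    -- which i and i + 1 form the pair.
    have h1 : i < (comb (n - 2)).size := by rw [size_comb]; omega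
    have h2 := size_graft (node leaf leaf) (comb (n - 2)) i h1
    rw [size_comb] at h2
    simp only [size] at h2
    exact conj (graft (node leaf leaf) (comb (n - 2)) i) _ _ _ (by omega) ht ht (gen i _ (by omega) hi (by
      simpa using At.here.graft_in (u := node leaf leaf) (u' := node leaf leaf) h1))
  | mul x y hx hy => exact mul t t t _ _ ht ht ht hy hx
  | inv x hx => exact inv t t _ ht ht hx

end Paren

end GTSh

namespace GTSh

open CategoryTheory Braid

/-! ### Cabled braidings and associators -/

/-- The sizes of two blocks. -/
def sz2 (a b : ℕ) : ℕ → ℕ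
  | 0 => a
  | 1 => b
  | _ => 0

/-- The sizes of three blocks. -/
def sz3 (a b c : ℕ) : ℕ → ℕ
  | 0 => a
  | 1 => b
  | 2 => c
  | _ => 0

/-- The sizes of four blocks. -/
def sz4 (a b c d : ℕ) : ℕ → ℕ
  | 0 => a
  | 1 => b
  | 2 => c
  | 3 => d
  | _ => 0

theorem offs_sz3 (a b c : ℕ) : offs (sz3 a b c) 3 = a + b + c := by
  simp [offs, Finset.sum_range_succ, sz3]

theorem offs_sz4 (a b c d : ℕ) : offs (sz4 a b c d) 4 = a + b + c + d := by
  simp [offs, Finset.sum_range_succ, sz4]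

/-- The braid `σ_{j+1} x_{j+1,j+2}^m` in `B_n`. -/
def bp (n : ℕ) (m : ℤ) (j : ℕ) : Braid n := sg n j * (sg n j ^ 2) ^ m

/-- The braiding of two blocks, twisted by `m`. -/
def BB (N : ℕ) (m : ℤ) (q a b : ℕ) : Braid N := cab N q (sz2 a b) (bp 2 m 0)

/-- The associator of three blocks given by `f`. -/
def FF (N : ℕ) (f : PB 3) (q a b c : ℕ) : Braid N := cab N q (sz3 a b c) f.1

theorem sq_mem_PB {n j : ℕ} (h : j + 1 < n) : sg n j ^ 2 ∈ PB n := by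
  change rho n _ = 1
  rw [map_pow, rho_sg h, adjSwap, dif_pos h, pow_two, Equiv.swap_mul_self]

theorem shift_bp {k N p j : ℕ} {m : ℤ} (h : p + k ≤ N) (hj : j + 1 < k) :
    shift p h (bp k m j) = bp N m (p + j) := by
  simp only [bp, map_mul, map_zpow, map_pow, shift_sg h hj]

theorem rhoN_bp {n j : ℕ} {m : ℤ} (h : j + 1 < n) : rhoN n (bp n m j) = Equiv.swap j (j + 1) := by
  rw [bp, map_mul, rhoN_eq_one (zpow_mem (sq_mem_PB h) m), mul_one, rhoN_sg h]

theorem mv_bp {n j : ℕ} {m : ℤ} (h : j + 1 < n) (w : ℕ → ℕ) :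
    mv (bp n m j) w = mv (sg n j) w := by
  unfold mv; rw [rhoN_bp h, rhoN_sg h]

theorem mv_bp_zero (m : ℤ) (a b c : ℕ) : mv (bp 3 m 0) (sz3 a b c) = sz3 b a c := by
  ext i
  rw [mv_bp (by omega), mv_sg (by omega)]
  match i with
  | 0 => rfl
  | 1 => rfl
  | 2 => rfl
  | i + 3 => simp [sz3]

theorem mv_bp_one (m : ℤ) (a b c : ℕ) : mv (bp 3 m 1) (sz3 a b c) = sz3 a c b := by
  ext i
  rw [mv_bp (by omega), mv_sg (by omega)]
  match i with
  | 0 => rfl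
  | 1 => rfl
  | 2 => rfl
  | i + 3 => simp [sz3]

/-- The twisted generator of B_n is itself a cabling, with single strands, of the one in B_2, so
`cab_cab` applies. -/
theorem cab_bp {N q n j : ℕ} {m : ℤ} {w : ℕ → ℕ} (hw : q + offs w n ≤ N) (hj : j + 1 < n) :
    cab N q w (bp n m j) = BB N m (q + offs w j) (w j) (w (j + 1)) := by
  have e : bp n m j = cab n j (fun _ => 1) (bp 2 m 0) := by
    rw [← shift_eq_cab (by omega), shift_bp _ (by omega), add_zero]
  rw [e, cab_cab _ (by rw [offs_const_one]; omega) hw, BB]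
  refine cab_congr _ fun i hi => ?_
  match i, hi with
  | 0, _ => simp [mrg, bsum, offs_zero, sz2]
  | 1, _ => simp [mrg, bsum, offs_const_one, sz2]

theorem BB_one_one {N : ℕ} {m : ℤ} {q : ℕ} (h : q + 1 < N) : BB N m q 1 1 = bp N m q := by
  have := shift_eq_cab (p := q) (N := N) (m := 2) (by omega) (bp 2 m 0)
  rw [shift_bp _ (by omega), add_zero] at this
  rw [this, BB]
  refine cab_congr _ fun i hi => ?_
  match i, hi with
  | 0, _ => rfl
  | 1, _ => rfl

theorem FF_one_one_one {N : ℕ} {f : PB 3} {q : ℕ} (h : q + 3 ≤ N) :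
    FF N f q 1 1 1 = shift q h f.1 := by
  rw [shift_eq_cab, FF]
  refine cab_congr _ fun i hi => ?_
  match i, hi with
  | 0, _ => rfl
  | 1, _ => rfl
  | 2, _ => rfl

theorem cab_commute {N q n : ℕ} {y : Braid N} (g : Braid n) : ∀ {w : ℕ → ℕ}, q + offs w n ≤ N →
    (∀ i, q ≤ i → i + 1 < q + offs w n → Commute y (sg N i)) → Commute y (cab N q w g) := by
  induction g using Braid.induction with
  | one => intro w _ _; rw [cab_one]; exact Commute.one_right y
  | gen j hj =>
    intro w hw h
    have e := offs_mono w (show j + 1 + 1 ≤ n by omega)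
    rw [offs_succ, offs_succ] at e
    rw [cab_sg hw hj]
    exact cross_semiconj fun i h1 h2 => h i (by omega) (by omega)
  | mul u v hu hv =>
    intro w hw h
    rw [cab_mul]
    exact (hu (by rwa [offs_mv]) (by rwa [offs_mv])).mul_right (hv hw h)
  | inv u hu =>
    intro w hw h
    rw [cab_inv]
    exact (hu (by rwa [offs_mv]) (by rwa [offs_mv])).inv_right

theorem FF_commute {N : ℕ} {f : PB 3} {q a b c : ℕ} {y : Braid N} (hN : q + a + b + c ≤ N)
    (h : ∀ i, q ≤ i → i + 1 < q + a + b + c → Commute y (sg N i)) : Commute y (FF N f q a b c) := by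
  refine cab_commute f.1 (by rw [offs_sz3]; omega) fun i h1 h2 => h i h1 ?_
  rw [offs_sz3] at h2; omega

theorem bp_commute {N j : ℕ} {m : ℤ} {y : Braid N} (h : Commute y (sg N j)) :
    Commute y (bp N m j) := h.mul_right ((h.pow_right 2).zpow_right m)

/-- Since f is pure, every block returns to its place. Hence generators inside one block slide
through unchanged, and those away from all three blocks commute. -/
theorem FF_sg {N : ℕ} {f : PB 3} {q a b c i : ℕ} (hN : q + a + b + c ≤ N)
    (h : i + 2 ≤ q ∨ (q ≤ i ∧ i + 1 < q + a) ∨ (q + a ≤ i ∧ i + 1 < q + a + b) ∨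
      (q + a + b ≤ i ∧ i + 1 < q + a + b + c) ∨ (q + a + b + c ≤ i ∧ i + 1 < N)) :
    Commute (FF N f q a b c) (sg N i) := by
  have hw : q + offs (sz3 a b c) 3 ≤ N := by rw [offs_sz3]; omega
  have key : ∀ {j x : ℕ}, j < 3 → x + 1 < sz3 a b c j →
      Commute (FF N f q a b c) (sg N (q + offs (sz3 a b c) j + x)) := by
    intro j x hj hx
    have := cab_block f.1 hw hj hx
    rwa [mv_pure f.2, rhoN_eq_one f.2, Equiv.Perm.one_apply] at this
  rcases h with h | h | h | h | h
  · exact cab_outside f.1 hw (.inl h)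
  · obtain ⟨x, rfl⟩ := Nat.exists_eq_add_of_le h.1
    exact key (j := 0) (x := x) (by omega) (by simp only [sz3]; omega)
  · obtain ⟨x, rfl⟩ := Nat.exists_eq_add_of_le h.1
    have := key (j := 1) (x := x) (by omega) (by simp only [sz3]; omega)
    simpa [offs, Finset.sum_range_succ, sz3] using this
  · obtain ⟨x, rfl⟩ := Nat.exists_eq_add_of_le h.1
    have := key (j := 2) (x := x) (by omega) (by simp only [sz3]; omega)
    simpa [offs, Finset.sum_range_succ, sz3, add_assoc] using this
  · exact cab_outside f.1 hw (.inr (by rw [offs_sz3]; omega))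

/-! ### The hexagon and pentagon relations for blocks -/

/-- The hexagon relations modulo `A` and the pentagon relation modulo `C`. -/
structure IsPairMod (A : Subgroup (Braid 3)) (C : Subgroup (Braid 4)) (m : ℤ) (f : PB 3) :
    Prop where
  hexagon₁ :
    ((sg 3 0 * (sg 3 0 ^ 2) ^ m * f.1⁻¹ * sg 3 1 * (sg 3 1 ^ 2) ^ m * f.1 : Braid 3) :
      Braid 3 ⧸ A) =
    ((f.1⁻¹ * sg 3 0 * sg 3 1 * ((sg 3 1 * sg 3 0 ^ 2 * (sg 3 1)⁻¹) * sg 3 1 ^ 2) ^ m : Braid 3) :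
      Braid 3 ⧸ A)
  hexagon₂ :
    ((f.1⁻¹ * sg 3 1 * (sg 3 1 ^ 2) ^ m * f.1 * sg 3 0 * (sg 3 0 ^ 2) ^ m : Braid 3) :
      Braid 3 ⧸ A) =
    ((sg 3 1 * sg 3 0 * (sg 3 0 ^ 2 * (sg 3 1 * sg 3 0 ^ 2 * (sg 3 1)⁻¹)) ^ m * f.1 : Braid 3) :
      Braid 3 ⧸ A)
  pentagon :
    ((phi234 f.1 * phi1_23_4 f.1 * phi123 f.1 : Braid 4) : Braid 4 ⧸ C) =
    ((phi1_2_34 f.1 * phi12_3_4 f.1 : Braid 4) : Braid 4 ⧸ C)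

theorem IsPairMod.mono {A A' : Subgroup (Braid 3)} {C C' : Subgroup (Braid 4)} {m : ℤ} {f : PB 3}
    (hA : A ≤ A') (hC : C ≤ C') (h : IsPairMod A C m f) : IsPairMod A' C' m f where
  hexagon₁ := QuotientGroup.eq.mpr (hA (QuotientGroup.eq.mp h.hexagon₁))
  hexagon₂ := QuotientGroup.eq.mpr (hA (QuotientGroup.eq.mp h.hexagon₂))
  pentagon := QuotientGroup.eq.mpr (hC (QuotientGroup.eq.mp h.pentagon))

theorem cable_sg_zero : cable 1 (0 : Fin 2) (sg 2 0) = sg 3 0 * sg 3 1 :=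
  (cable_sg (by omega) _).trans ((cableGen_eq (n := 2) (k := 1) (j := 0) rfl).trans
    (by simp [up]))

theorem cable_sg_one : cable 1 (1 : Fin 2) (sg 2 0) = sg 3 1 * sg 3 0 :=
  (cable_sg (by omega) _).trans ((cableGen_eq' (n := 2) (k := 1) (j := 0) rfl).trans
    (by simp [dn]))

theorem hexagon_word₁ {G : Type*} [Group G] (a b : G) :
    b * a * (a * b) = b * a ^ 2 * b⁻¹ * b ^ 2 := by rw [pow_two, pow_two]; group

theorem hexagon_word₂ {G : Type*} [Group G] {a b : G} (h : a * b * a = b * a * b) :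
    a * b * (b * a) = a ^ 2 * (b * a ^ 2 * b⁻¹) := by
  symm
  calc a ^ 2 * (b * a ^ 2 * b⁻¹) = a * (a * b * a) * a * b⁻¹ := by rw [pow_two]; group
    _ = a * (b * a * b) * a * b⁻¹ := by rw [h]
    _ = a * b * (a * b * a) * b⁻¹ := by group
    _ = a * b * (b * a * b) * b⁻¹ := by rw [h]
    _ = _ := by group

/-- It identifies the right side of the first hexagon, up to f, with the twisted braiding whose
first strand is doubled: under the doubling σ_1² becomes x_13 x_23. -/
theorem cable_bp_zero (m : ℤ) :
    cable 1 (0 : Fin 2) (bp 2 m 0) =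
      sg 3 0 * sg 3 1 * (sg 3 1 * sg 3 0 ^ 2 * (sg 3 1)⁻¹ * sg 3 1 ^ 2) ^ m := by
  have h0 := cable_sg_zero
  have h1 := cable_sg_one
  -- The second of the two crossings meets the doubled strand in the other position, hence the
  -- different words for the two factors.
  have hs : rho 2 (sg 2 0) 0 = 1 := by rw [rho_sg (by omega)]; rfl
  have hx : cable 1 (0 : Fin 2) (sg 2 0 ^ 2) =
      sg 3 1 * sg 3 0 ^ 2 * (sg 3 1)⁻¹ * sg 3 1 ^ 2 := by
    rw [pow_two, cable_mul, hs, h0, h1]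
    exact hexagon_word₁ _ _
  have hp : cable 1 (0 : Fin 2) ((sg 2 0 ^ 2) ^ m) = (cable 1 (0 : Fin 2) (sg 2 0 ^ 2)) ^ m :=
    map_zpow (cablePB (0 : Fin 2)) ⟨_, sq_mem_PB (by omega : 0 + 1 < 2)⟩ m
  rw [bp, cable_mul, show rho 2 ((sg 2 0 ^ 2) ^ m) = 1 from
    zpow_mem (sq_mem_PB (by omega : 0 + 1 < 2)) m, Equiv.Perm.one_apply, h0, hp, hx]

theorem cable_bp_one (m : ℤ) :
    cable 1 (1 : Fin 2) (bp 2 m 0) =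
      sg 3 1 * sg 3 0 * (sg 3 0 ^ 2 * (sg 3 1 * sg 3 0 ^ 2 * (sg 3 1)⁻¹)) ^ m := by
  have h0 := cable_sg_zero
  have h1 := cable_sg_one
  have hs : rho 2 (sg 2 0) 1 = 0 := by rw [rho_sg (by omega)]; rfl
  have hb : sg 3 0 * sg 3 1 * sg 3 0 = sg 3 1 * sg 3 0 * sg 3 1 :=
    (isBraid_sg 3).braid 0 (by omega)
  have hx : cable 1 (1 : Fin 2) (sg 2 0 ^ 2) =
      sg 3 0 ^ 2 * (sg 3 1 * sg 3 0 ^ 2 * (sg 3 1)⁻¹) := by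
    rw [pow_two, cable_mul, hs, h0, h1]
    exact hexagon_word₂ hb
  have hp : cable 1 (1 : Fin 2) ((sg 2 0 ^ 2) ^ m) = (cable 1 (1 : Fin 2) (sg 2 0 ^ 2)) ^ m :=
    map_zpow (cablePB (1 : Fin 2)) ⟨_, sq_mem_PB (by omega : 0 + 1 < 2)⟩ m
  rw [bp, cable_mul, show rho 2 ((sg 2 0 ^ 2) ^ m) = 1 from
    zpow_mem (sq_mem_PB (by omega : 0 + 1 < 2)) m, Equiv.Perm.one_apply, h1, hp, hx]

section

variable {N : ℕ} {M : Subgroup (Braid N)} [M.Normal] {m : ℤ} {f : PB 3}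

/-- The hexagon and pentagon relations hold for all blocks, modulo `M`. -/
abbrev Good (M : Subgroup (Braid N)) (m : ℤ) (f : PB 3) : Prop :=
  IsPairMod (pull M 3) (pull M 4) m f

/-- The first hexagon says that the doubled twisted braiding is composed of two twisted braidings
and three associators. Cabling by the sizes (a, b, c) commutes with the doubling by `cab_cab`, so
the same holds for blocks. -/
theorem Good.hex₁ (h : Good M m f) {q a b c : ℕ} (hN : q + a + b + c ≤ N) :
    (FF N f q c a b * BB N m q a c * (FF N f q a c b)⁻¹ * BB N m (q + a) b c * FF N f q a b c :
      Braid N ⧸ M) = BB N m q (a + b) c := by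
  have hw : ∀ {a b c}, q + a + b + c ≤ N → q + offs (sz3 a b c) 3 ≤ N := fun h => by
    rw [offs_sz3]; omega
  -- The hexagon is solved for the doubled braiding; the word is bracketed to the right so that each
  -- `cab_mul` splits off one factor.
  have e1 : ((f.1 * (bp 3 m 0 * (f.1⁻¹ * (bp 3 m 1 * f.1))) : Braid 3) : Braid 3 ⧸ pull M 3) =
      ((cable 1 (0 : Fin 2) (bp 2 m 0) : Braid 3) : Braid 3 ⧸ pull M 3) := by
    have := congrArg (fun x => (f.1 : Braid 3 ⧸ pull M 3) * x) h.hexagon₁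
    simp only [← QuotientGroup.mk_mul] at this
    rw [cable_bp_zero]
    refine Eq.trans ?_ (this.trans ?_)
    · congr 1; simp only [bp]; group
    · congr 1; simp only [mul_assoc, mul_inv_cancel_left]
  have e2 := cab_mk_eq (p := q) (sz3 a b c) e1
  have e3 : cab N q (sz3 a b c) (cable 1 (0 : Fin 2) (bp 2 m 0)) = BB N m q (a + b) c := by
    rw [cable_eq_cab, cab_cab _ (by rw [offs_cabW]; simp) (hw hN), BB]
    refine cab_congr _ fun i hi => ?_
    match i, hi with
    | 0, _ => simp [mrg, bsum, offs_zero, cabW, sz2, sz3, Finset.sum_range_succ]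
    | 1, _ => simp [mrg, bsum, offs_cabW, cabW, sz2, sz3]
  rw [e3, cab_mul, cab_mul, cab_mul, cab_mul, cab_inv_pure _ f.2, mv_mul, mv_mul, mv_mul,
    mv_pure f.2, mv_pure (inv_mem f.2), mv_bp_one, mv_bp_zero, cab_bp (hw (by omega)) (by omega),
    cab_bp (hw hN) (by omega)] at e2
  rw [← e2]
  simp only [QuotientGroup.mk_mul, QuotientGroup.mk_inv, FF, mul_assoc, offs_zero, add_zero, sz3,
    offs_succ, zero_add]

theorem Good.hex₂ (h : Good M m f) {q a b c : ℕ} (hN : q + a + b + c ≤ N) :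
    ((FF N f q b c a)⁻¹ * BB N m (q + b) a c * FF N f q b a c * BB N m q a b * (FF N f q a b c)⁻¹ :
      Braid N ⧸ M) = BB N m q a (b + c) := by
  have hw : ∀ {a b c}, q + a + b + c ≤ N → q + offs (sz3 a b c) 3 ≤ N := fun h => by
    rw [offs_sz3]; omega
  have e1 : ((f.1⁻¹ * (bp 3 m 1 * (f.1 * (bp 3 m 0 * f.1⁻¹))) : Braid 3) : Braid 3 ⧸ pull M 3) =
      ((cable 1 (1 : Fin 2) (bp 2 m 0) : Braid 3) : Braid 3 ⧸ pull M 3) := by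
    have := congrArg (fun x => x * (f.1⁻¹ : Braid 3 ⧸ pull M 3)) h.hexagon₂
    simp only [← QuotientGroup.mk_mul, ← QuotientGroup.mk_inv] at this
    rw [cable_bp_one]
    refine Eq.trans ?_ (this.trans ?_)
    · congr 1; simp only [bp]; group
    · congr 1; simp only [mul_inv_cancel_right]
  have e2 := cab_mk_eq (p := q) (sz3 a b c) e1
  have e3 : cab N q (sz3 a b c) (cable 1 (1 : Fin 2) (bp 2 m 0)) = BB N m q a (b + c) := by
    rw [cable_eq_cab, cab_cab _ (by rw [offs_cabW]; simp) (hw hN), BB]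
    refine cab_congr _ fun i hi => ?_
    match i, hi with
    | 0, _ => simp [mrg, bsum, offs_zero, cabW, sz2, sz3]
    | 1, _ => simp [mrg, bsum, offs_cabW, cabW, sz2, sz3, Finset.sum_range_succ]
  rw [e3, cab_mul, cab_mul, cab_mul, cab_mul, cab_inv_pure _ f.2, cab_inv_pure _ f.2, mv_mul,
    mv_mul, mv_mul, mv_pure (inv_mem f.2), mv_pure f.2, mv_bp_zero, mv_bp_one,
    cab_bp (hw (by omega)) (by omega), cab_bp (hw hN) (by omega)] at e2
  rw [← e2]
  simp only [QuotientGroup.mk_mul, QuotientGroup.mk_inv, FF, mul_assoc, offs_zero, add_zero, sz3,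
    offs_succ, zero_add]

/-- Each of the five maps PB_3 → PB_4 is a cabling, so cabling the pentagon by (a, x, y, z) merges
it into associators of blocks. -/
theorem Good.pent (h : Good M m f) {q a x y z : ℕ} (hN : q + a + x + y + z ≤ N) :
    (FF N f (q + a) x y z * FF N f q a (x + y) z * FF N f q a x y : Braid N ⧸ M) =
      FF N f q a x (y + z) * FF N f q (a + x) y z := by
  have hw : q + offs (sz4 a x y z) 4 ≤ N := by rw [offs_sz4]; omega
  have hp : ∀ p : Fin 3, cable 1 p f.1 ∈ PB 4 := fun p => by
    have := rho_cable (k := 1) f.1 p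
    rw [show rho 3 f.1 = 1 from f.2, blockPerm_one] at this
    exact this
  have hp' : ∀ (p : ℕ) (hp : p + 3 ≤ 4), shift p hp f.1 ∈ PB 4 := fun p hp => by
    have := rho_blockShift (n := 2) (k := 2) ⟨p, by omega⟩ f.1
    rw [show rho 3 f.1 = 1 from f.2, blockPerm_one] at this
    exact this
  have e := cab_mk_eq (p := q) (sz4 a x y z) h.pentagon
  have c0 : cab N q (sz4 a x y z) (phi12_3_4 f.1) = FF N f q (a + x) y z := by
    rw [phi12_3_4, cable_eq_cab, cab_cab _ (by rw [offs_cabW]; simp) hw, FF]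
    refine cab_congr _ fun i hi => ?_
    match i, hi with
    | 0, _ => simp [mrg, bsum, offs_zero, cabW, sz3, sz4, Finset.sum_range_succ]
    | 1, _ => simp [mrg, bsum, offs_cabW, cabW, sz3, sz4]
    | 2, _ => simp [mrg, bsum, offs_cabW, cabW, sz3, sz4]
  have c1 : cab N q (sz4 a x y z) (phi1_23_4 f.1) = FF N f q a (x + y) z := by
    rw [phi1_23_4, cable_eq_cab, cab_cab _ (by rw [offs_cabW]; simp) hw, FF]
    refine cab_congr _ fun i hi => ?_
    match i, hi with
    | 0, _ => simp [mrg, bsum, offs_zero, cabW, sz3, sz4]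
    | 1, _ => simp [mrg, bsum, offs_cabW, cabW, sz3, sz4, Finset.sum_range_succ]
    | 2, _ => simp [mrg, bsum, offs_cabW, cabW, sz3, sz4]
  have c2 : cab N q (sz4 a x y z) (phi1_2_34 f.1) = FF N f q a x (y + z) := by
    rw [phi1_2_34, cable_eq_cab, cab_cab _ (by rw [offs_cabW]; simp) hw, FF]
    refine cab_congr _ fun i hi => ?_
    match i, hi with
    | 0, _ => simp [mrg, bsum, offs_zero, cabW, sz3, sz4]
    | 1, _ => simp [mrg, bsum, offs_cabW, cabW, sz3, sz4]
    | 2, _ => simp [mrg, bsum, offs_cabW, cabW, sz3, sz4, Finset.sum_range_succ]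
  have c3 : cab N q (sz4 a x y z) (phi123 f.1) = FF N f q a x y := by
    rw [phi123, shift_eq_cab, cab_cab _ (by simp [offs_const_one]) hw, FF]
    refine cab_congr _ fun i hi => ?_
    match i, hi with
    | 0, _ => simp [mrg, bsum, offs_zero, sz3, sz4]
    | 1, _ => simp [mrg, bsum, offs_const_one, sz3, sz4]
    | 2, _ => simp [mrg, bsum, offs_const_one, sz3, sz4]
  have c4 : cab N q (sz4 a x y z) (phi234 f.1) = FF N f (q + a) x y z := by
    rw [phi234, shift_eq_cab, cab_cab _ (by simp [offs_const_one]) hw, FF, offs_succ,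
      offs_zero, zero_add]
    refine cab_congr _ fun i hi => ?_
    match i, hi with
    | 0, _ => simp [mrg, bsum, offs_zero, sz3, sz4]
    | 1, _ => simp [mrg, bsum, offs_const_one, sz3, sz4]
    | 2, _ => simp [mrg, bsum, offs_const_one, sz3, sz4]
  -- Purity keeps the sizes the same for all factors of the pentagon.
  have p1 : phi123 f.1 ∈ PB 4 := hp' 0 (by omega)
  have p2 : phi1_23_4 f.1 ∈ PB 4 := hp 1
  have p3 : phi12_3_4 f.1 ∈ PB 4 := hp 0
  rw [cab_mul_pure _ _ p1, cab_mul_pure _ _ p2, cab_mul_pure _ _ p3, c0, c1,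
    c2, c3, c4] at e
  exact e

end

end GTSh

namespace GTSh

open CategoryTheory Braid Paren

/-! ### Coherence -/

section

variable (N : ℕ) (f : PB 3)

/-- The product of associators that leads from `((12)3)⋯` to `(((12)⋯)a) t`. -/
def combNode : ℕ → Paren → Braid N
  | _, leaf => 1
  | a, node x y => FF N f 0 a x.size y.size * combNode a x * combNode (a + x.size) y

/-- The product of associators that leads from `((12)3)⋯` to `t`. -/
def combTo : Paren → Braid N
  | leaf => 1
  | node l r => combTo l * combNode N f l.size r

/-- The associator that leads from `((12)3)⋯` to the place where the strands at the positions
`j` and `j + 1` are neighbours. -/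
def nbr (j : ℕ) : Braid N := if j = 0 then 1 else FF N f 0 j 1 1

/-- The values on the generators of the braid group of the twist by `(m, f)`, at `((12)3)⋯`. -/
def twGen (m : ℤ) (j : ℕ) : Braid N := (nbr N f j)⁻¹ * bp N m j * nbr N f j

end

section

variable {N : ℕ} {f : PB 3} {m : ℤ}

theorem combNode_commute {y : Braid N} : ∀ {a : ℕ} {t : Paren}, a + t.size ≤ N →
    (∀ i, i + 1 < a + t.size → Commute y (sg N i)) → Commute y (combNode N f a t)
  | a, leaf, _, _ => Commute.one_right y
  | a, node x z, ha, h => by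
    simp only [size] at ha h
    refine ((FF_commute (by omega) fun i h1 h2 => h i (by omega)).mul_right
      (combNode_commute (by omega) fun i h1 => h i (by omega))).mul_right
      (combNode_commute (by omega) fun i h1 => h i (by omega))

theorem combNode_sg {i : ℕ} : ∀ {a : ℕ} {t : Paren}, a + t.size ≤ N →
    (i + 1 < a ∨ a + t.size ≤ i ∧ i + 1 < N) → Commute (combNode N f a t) (sg N i)
  | a, leaf, _, _ => Commute.one_left _
  | a, node x z, ha, h => by
    simp only [size] at ha h
    exact ((FF_sg (by omega) (by omega)).mul_left (combNode_sg (by omega) (by omega))).mul_left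
      (combNode_sg (by omega) (by omega))

theorem combTo_commute {y : Braid N} : ∀ {t : Paren}, t.size ≤ N →
    (∀ i, i + 1 < t.size → Commute y (sg N i)) → Commute y (combTo N f t)
  | leaf, _, _ => Commute.one_right y
  | node l r, ha, h => by
    simp only [size] at ha h
    exact (combTo_commute (by omega) fun i h1 => h i (by omega)).mul_right
      (combNode_commute (by omega) fun i h1 => h i (by omega))

theorem combTo_sg {i : ℕ} {t : Paren} (h : t.size ≤ i) (hi : i + 1 < N) :
    Commute (combTo N f t) (sg N i) :=
  (combTo_commute (by omega) fun j hj =>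
    ((isBraid_sg N).comm j i (by omega) hi).symm).symm

theorem nbr_commute {y : Braid N} {j : ℕ} (hj : j + 1 < N)
    (h : ∀ i ≤ j, Commute y (sg N i)) : Commute y (nbr N f j) := by
  unfold nbr
  split_ifs
  · exact Commute.one_right y
  · exact FF_commute (by omega) fun i h1 h2 => h i (by omega)

theorem twGen_commute {y : Braid N} {j : ℕ} (hj : j + 1 < N)
    (h : ∀ i ≤ j, Commute y (sg N i)) : Commute y (twGen N f m j) :=
  ((nbr_commute hj h).inv_right.mul_right (bp_commute (h j le_rfl))).mul_right (nbr_commute hj h)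

theorem nbr_sg {i j : ℕ} (hj : j + 1 < N) (h : i + 1 < j) : Commute (nbr N f j) (sg N i) := by
  rw [nbr, if_neg (by omega)]
  exact FF_sg (by omega) (by omega)

theorem twGen_comm {i j : ℕ} (hij : i + 2 ≤ j) (hj : j + 1 < N) :
    Commute (twGen N f m i) (twGen N f m j) := by
  have h1 : Commute (nbr N f j) (twGen N f m i) :=
    twGen_commute (by omega) fun k hk => nbr_sg hj (by omega)
  have h2 : Commute (sg N j) (twGen N f m i) :=
    twGen_commute (by omega) fun k hk => ((isBraid_sg N).comm k j (by omega) hj).symm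
  exact (h1.symm.inv_right.mul_right (bp_commute h2.symm)).mul_right h1.symm

variable {M : Subgroup (Braid N)} [M.Normal]

theorem commute_mk {x y : Braid N} (h : Commute x y) : Commute (x : Braid N ⧸ M) (y : Braid N ⧸ M) :=
  h.map (QuotientGroup.mk' M)

/-- The braid relation for three consecutive single strands already follows from the first hexagon,
by `hexagon_braid` on the strands q, q + 1, q + 2. -/
theorem Good.braid_shift (h : Good M m f) {q : ℕ} (hq : q + 3 ≤ N) :
    (bp N m q : Braid N ⧸ M) *
        ((FF N f q 1 1 1 : Braid N ⧸ M)⁻¹ * (bp N m (q + 1) : Braid N ⧸ M) * FF N f q 1 1 1) *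
        (bp N m q : Braid N ⧸ M) =
      ((FF N f q 1 1 1 : Braid N ⧸ M)⁻¹ * (bp N m (q + 1) : Braid N ⧸ M) * FF N f q 1 1 1) *
        (bp N m q : Braid N ⧸ M) *
        ((FF N f q 1 1 1 : Braid N ⧸ M)⁻¹ * (bp N m (q + 1) : Braid N ⧸ M) * FF N f q 1 1 1) := by
  let φ := (QuotientGroup.mk' M).comp (shift q hq)
  have hφ : ∀ x ∈ pull M 3, φ x = 1 := fun x hx =>
    (QuotientGroup.eq_one_iff _).mpr (by rw [shift_eq_cab]; exact hx.2 q _)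
  have hx := QuotientGroup.eq.mp h.hexagon₁
  have e := hφ _ hx
  rw [map_mul, map_inv, inv_mul_eq_one] at e
  have e0 : φ (sg 3 0) = (sg N q : Braid N ⧸ M) :=
    congrArg (QuotientGroup.mk' M) (shift_sg hq (by omega))
  have e1 : φ (sg 3 1) = (sg N (q + 1) : Braid N ⧸ M) :=
    congrArg (QuotientGroup.mk' M) (shift_sg hq (by omega))
  have ef : φ f.1 = (FF N f q 1 1 1 : Braid N ⧸ M) :=
    congrArg (QuotientGroup.mk' M) (FF_one_one_one hq).symm
  have := hexagon_braid (a := φ (sg 3 0)) (b := φ (sg 3 1)) (F := φ f.1) (m := m)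
    (by simpa only [map_mul] using congrArg φ ((isBraid_sg 3).braid 0 (by omega)))
    (by simpa only [← map_mul, ← map_inv, ← map_pow, ← map_zpow, mul_assoc] using e)
  rw [e0, e1, ef] at this
  exact this

/-- At i = 0 the relation is `Good.braid_shift`. Further right, both generators carry the
associators of the comb; the pentagon for the blocks i, 1, 1, 1 rewrites them as a common
conjugation of the relation in `Good.braid_shift`. -/
theorem Good.isBraid (h : Good M m f) : IsBraid N fun i => (twGen N f m i : Braid N ⧸ M) where
  comm i j h1 h2 := commute_mk (twGen_comm h1 h2)
  braid i hi := by
    have hb := h.braid_shift (q := i) (by omega)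
    by_cases h0 : i = 0
    · subst h0
      have e0 : twGen N f m 0 = bp N m 0 := by simp [twGen, nbr]
      have e1 : nbr N f 1 = FF N f 0 1 1 1 := if_neg (by omega)
      rw [e0]
      simp only [twGen, zero_add, e1, QuotientGroup.mk_mul, QuotientGroup.mk_inv] at hb ⊢
      exact hb
    · have e0 : nbr N f i = FF N f 0 i 1 1 := if_neg h0
      have e1 : nbr N f (i + 1) = FF N f 0 (i + 1) 1 1 := if_neg (by omega)
      have hp := h.pent (q := 0) (a := i) (x := 1) (y := 1) (z := 1) (by omega)
      rw [zero_add] at hp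
      simp only [twGen, e0, e1, QuotientGroup.mk_mul, QuotientGroup.mk_inv]
      exact pentagon_braid
        (commute_mk (bp_commute (FF_sg (by omega) (by omega)))).eq
        (commute_mk (bp_commute (FF_sg (by omega) (by omega)))).eq hp hb

/-- The heart of coherence. A move at the root of the subtree is the pentagon for a, x, y, z. A move
deeper inside concerns one factor only, and its associator commutes with the factors to the left of
it, which see the moved part within a single block. -/
theorem Good.combNode_move (h : Good M m f) {x y z : Paren} {q : ℕ} {t t' : Paren}
    (ht : At (node (node x y) z) (node x (node y z)) q t t') : ∀ {a : ℕ}, a + t.size ≤ N →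
    (combNode N f a t' : Braid N ⧸ M) =
      (FF N f (a + q) x.size y.size z.size : Braid N ⧸ M) * combNode N f a t := by
  induction ht with
  | here =>
    intro a ha
    simp only [size] at ha
    have hp := h.pent (q := 0) (a := a) (x := x.size) (y := y.size) (z := z.size) (by omega)
    have hc : (combNode N f a x : Braid N ⧸ M) * FF N f 0 (a + x.size) y.size z.size =
        FF N f 0 (a + x.size) y.size z.size * combNode N f a x :=
      commute_mk (combNode_commute (by omega) fun i hi => FF_sg (by omega) (by omega)).symm
    simp only [combNode, size, QuotientGroup.mk_mul, zero_add, add_zero, ← add_assoc] at hp hc ⊢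
    calc _ = (FF N f 0 a x.size (y.size + z.size) : Braid N ⧸ M) *
          ((combNode N f a x : Braid N ⧸ M) * FF N f 0 (a + x.size) y.size z.size) *
          combNode N f (a + x.size) y * combNode N f (a + x.size + y.size) z := by
            simp only [mul_assoc]
      _ = ((FF N f 0 a x.size (y.size + z.size) : Braid N ⧸ M) *
          FF N f 0 (a + x.size) y.size z.size) * combNode N f a x *
          combNode N f (a + x.size) y * combNode N f (a + x.size + y.size) z := by
            rw [hc]; simp only [mul_assoc]
      _ = _ := by rw [← hp]; simp only [mul_assoc]
  | @left q l l' r hl ih =>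
    intro a ha
    have hs := hl.size_eq (assoc_size x y z)
    have hle := hl.le_size
    simp only [size] at ha hle
    have hc : (FF N f 0 a l.size r.size : Braid N ⧸ M) * FF N f (a + q) x.size y.size z.size =
        FF N f (a + q) x.size y.size z.size * FF N f 0 a l.size r.size :=
      commute_mk (FF_commute (by omega) fun i h1 h2 => FF_sg (by omega) (by omega))
    simp only [combNode, QuotientGroup.mk_mul, ← hs]
    rw [ih (by omega), ← mul_assoc, hc]
    simp only [mul_assoc]
  | @right q l r r' hr ih =>
    intro a ha
    have hs := hr.size_eq (assoc_size x y z)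
    have hle := hr.le_size
    simp only [size] at ha hle
    have hc : ((FF N f 0 a l.size r.size * combNode N f a l : Braid N) : Braid N ⧸ M) *
        FF N f (a + l.size + q) x.size y.size z.size =
        FF N f (a + l.size + q) x.size y.size z.size *
          ((FF N f 0 a l.size r.size * combNode N f a l : Braid N) : Braid N ⧸ M) :=
      commute_mk (FF_commute (by omega) fun i h1 h2 =>
        (FF_sg (by omega) (by omega)).mul_left (combNode_sg (by omega) (by omega)))
    simp only [combNode, ← hs]
    rw [QuotientGroup.mk_mul, ih (by omega), ← mul_assoc, hc, mul_assoc, ← QuotientGroup.mk_mul,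
      add_assoc]

/-- At the root this is the definition of `combTo` and a commutation, since no block precedes x; the
pentagon enters only through `combNode_move`. -/
theorem Good.combTo_move (h : Good M m f) {x y z : Paren} {q : ℕ} {t t' : Paren}
    (ht : At (node (node x y) z) (node x (node y z)) q t t') : t.size ≤ N →
    (combTo N f t' : Braid N ⧸ M) =
      (FF N f q x.size y.size z.size : Braid N ⧸ M) * combTo N f t := by
  induction ht with
  | here =>
    intro ha
    simp only [size] at ha
    have hc : (combTo N f x : Braid N ⧸ M) * FF N f 0 x.size y.size z.size =
        FF N f 0 x.size y.size z.size * combTo N f x :=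
      commute_mk (combTo_commute (by omega) fun i hi => FF_sg (by omega) (by omega)).symm
    simp only [combTo, combNode, size, QuotientGroup.mk_mul]
    rw [← mul_assoc, ← mul_assoc, hc]
    simp only [mul_assoc]
  | @left q l l' r hl ih =>
    intro ha
    have hs := hl.size_eq (assoc_size x y z)
    simp only [size] at ha
    simp only [combTo, QuotientGroup.mk_mul, ← hs]
    rw [ih (by omega), mul_assoc]
  | @right q l r r' hr ih =>
    intro ha
    have hle := hr.le_size
    simp only [size] at ha hle
    have hc : (combTo N f l : Braid N ⧸ M) * FF N f (l.size + q) x.size y.size z.size =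
        FF N f (l.size + q) x.size y.size z.size * combTo N f l :=
      commute_mk (FF_commute (by omega) fun i h1 h2 => combTo_sg (by omega) (by omega))
    simp only [combTo, QuotientGroup.mk_mul]
    rw [h.combNode_move hr (by omega), ← mul_assoc, hc, mul_assoc]

/-- On an enclosed pair of leaves `combNode` is exactly `nbr`, so it undoes the conjugation in
`twGen`; the other factors commute. The case a = 0 is excluded because `nbr` is 1 there by
definition. -/
theorem combNode_gen {q : ℕ} {t t' : Paren} (ht : At (node leaf leaf) (node leaf leaf) q t t') :
    ∀ {a : ℕ}, 0 < a → a + t.size ≤ N →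
    combNode N f a t * twGen N f m (a + q) = bp N m (a + q) * combNode N f a t := by
  induction ht with
  | here =>
    intro a h0 ha
    have e : combNode N f a (node leaf leaf) = nbr N f a := by
      simp [combNode, size, nbr, if_neg h0.ne']
    rw [e, twGen, add_zero]
    group
  | @left q l l' r hl ih =>
    intro a h0 ha
    have hle := hl.le_size
    simp only [size] at ha hle
    have h1 : Commute (combNode N f (a + l.size) r) (twGen N f m (a + q)) :=
      twGen_commute (by omega) fun i hi => combNode_sg (by omega) (by omega)
    have h2 : Commute (FF N f 0 a l.size r.size) (bp N m (a + q)) :=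
      bp_commute (FF_sg (by omega) (by omega))
    rw [combNode, mul_assoc, h1.eq, ← mul_assoc, mul_assoc (FF _ _ _ _ _ _), ih h0 (by omega),
      ← mul_assoc, h2.eq]
    simp only [mul_assoc]
  | @right q l r r' hr ih =>
    intro a h0 ha
    have hle := hr.le_size
    simp only [size] at ha hle
    have h2 : Commute (FF N f 0 a l.size r.size * combNode N f a l) (bp N m (a + l.size + q)) :=
      bp_commute ((FF_sg (by omega) (by omega)).mul_left (combNode_sg (by omega) (by omega)))
    rw [combNode, ← add_assoc, mul_assoc, ih (by omega) (by omega), ← mul_assoc, h2.eq, mul_assoc]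

theorem combTo_gen {q : ℕ} {t t' : Paren} (ht : At (node leaf leaf) (node leaf leaf) q t t') :
    t.size ≤ N → combTo N f t * twGen N f m q = bp N m q * combTo N f t := by
  induction ht with
  | here => intro _; simp [combTo, combNode, twGen, nbr]
  | @left q l l' r hl ih =>
    intro ha
    have hle := hl.le_size
    simp only [size] at ha hle
    have h1 : Commute (combNode N f l.size r) (twGen N f m q) :=
      twGen_commute (by omega) fun i hi => combNode_sg (by omega) (by omega)
    rw [combTo, mul_assoc, h1.eq, ← mul_assoc, ih (by omega), mul_assoc]
  | @right q l r r' hr ih =>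
    intro ha
    have hle := hr.le_size
    simp only [size] at ha hle
    have h2 : Commute (combTo N f l) (bp N m (l.size + q)) :=
      bp_commute (combTo_sg (by omega) (by omega))
    rw [combTo, mul_assoc, combNode_gen hr l.size_pos (by omega), ← mul_assoc, h2.eq, mul_assoc]

/-! ### The twist of braids by a pair -/

open Classical in
/-- The twist by `(m, f)` of braids, at `((12)3)⋯`. -/
noncomputable def twComb (M : Subgroup (Braid N)) [M.Normal] (m : ℤ) (f : PB 3) :
    Braid N →* Braid N ⧸ M :=
  -- The trivial homomorphism is a mere default: for good pairs the relations hold, and the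
  -- functoriality of `tw` needs no hypothesis.
  if h : IsBraid N fun i => (twGen N f m i : Braid N ⧸ M) then lift _ h else 1

theorem Good.twComb_sg (h : Good M m f) {i : ℕ} (hi : i + 1 < N) :
    twComb M m f (sg N i) = twGen N f m i := by
  rw [twComb, dif_pos h.isBraid, lift_sg _ hi]

/-- The twist by `(m, f)` of a braid from `t` to `t'`. -/
noncomputable def tw (M : Subgroup (Braid N)) [M.Normal] (m : ℤ) (f : PB 3) (t t' : Paren)
    (g : Braid N) : Braid N ⧸ M :=
  combTo N f t' * twComb M m f g * (combTo N f t : Braid N ⧸ M)⁻¹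

theorem tw_mul (t t' t'' : Paren) (g g' : Braid N) :
    tw M m f t t'' (g' * g) = tw M m f t' t'' g' * tw M m f t t' g := by
  simp only [tw, map_mul]
  group

theorem tw_one (t : Paren) : tw M m f t t 1 = 1 := by simp [tw]

theorem tw_inv (t t' : Paren) (g : Braid N) : tw M m f t' t g⁻¹ = (tw M m f t t' g)⁻¹ := by
  simp only [tw, map_inv]
  group

/-- Together with `Good.tw_gen` this describes the twist completely, as moves and enclosed
generators are the inputs of `braid_induction`. -/
theorem Good.tw_move (h : Good M m f) {x y z : Paren} {q : ℕ} {t t' : Paren}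
    (ht : At (node (node x y) z) (node x (node y z)) q t t') (hN : t.size ≤ N) :
    tw M m f t t' 1 = FF N f q x.size y.size z.size := by
  rw [tw, map_one, mul_one, h.combTo_move ht hN, mul_inv_cancel_right]

theorem Good.tw_gen (h : Good M m f) {q : ℕ} {t : Paren}
    (ht : At (node leaf leaf) (node leaf leaf) q t t) (hN : t.size ≤ N) :
    tw M m f t t (sg N q) = bp N m q := by
  have := ht.le_size
  simp only [size] at this
  rw [tw, h.twComb_sg (by omega), ← QuotientGroup.mk_mul, combTo_gen ht hN, QuotientGroup.mk_mul,
    mul_inv_cancel_right]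

end

/-! ### The twist of block crossings -/

namespace Paren.At

theorem trans_nest {u u' v v' t t' : Paren} {q p : ℕ} (h : At u u' q v v') (h' : At v v' p t t') :
    At u u' (p + q) t t' := by
  induction h' with
  | here => simpa using h
  | left _ ih => exact ih.left
  | right _ ih => rw [add_assoc]; exact ih.right

theorem eq {u t t' : Paren} {q : ℕ} (h : At u u q t t') : t = t' := by
  induction h with
  | here => rfl
  | left _ ih => rw [ih]
  | right _ ih => rw [ih]

end Paren.At

section

variable {N : ℕ} {f : PB 3} {m : ℤ} {M : Subgroup (Braid N)} [M.Normal]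

/-- By induction on the tree x. The hexagon splits the crossing of a composed block with a strand
into crossings of its two halves, and `Good.hex₁` says that the twisted pieces compose to the
twisted braiding of the whole block. -/
theorem Good.tw_cross_left (h : Good M m f) : ∀ {x : Paren} {q : ℕ} {t t' : Paren},
    At (node x leaf) (node leaf x) q t t' → t.size ≤ N →
    tw M m f t t' (cross (sg N) q x.size 1) = BB N m q x.size 1
  | leaf, q, t, t', ht, hN => by
    obtain rfl := ht.eq
    have := ht.le_size
    simp only [size] at this
    rw [size, BB_one_one (by omega), ← h.tw_gen ht hN]
    simp [cross, up]
  | node x y, q, t, t', ht, hN => by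
    have hle := ht.le_size
    simp only [size] at hle
    -- The path of the hexagon, with • for the single strand: (xy)•, x(y•), x(•y), (x•)y, (•x)y,
    -- •(xy).
    obtain ⟨s₁, h₁, h₁'⟩ := ht.split (node x (node y leaf))
    obtain ⟨s₂, h₂, h₂'⟩ := h₁'.split (node x (node leaf y))
    obtain ⟨s₃, h₃, h₃'⟩ := h₂'.split (node (node x leaf) y)
    obtain ⟨s₄, h₄, h₅⟩ := h₃'.split (node (node leaf x) y)
    have e₁ := h₁.size_eq (assoc_size _ _ _)
    have e₂ := h₂.size_eq (by simp only [size]; omega)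
    have e₃ := h₃.size_eq (by simp only [size]; omega)
    have e₄ := h₄.size_eq (by simp only [size]; omega)
    have t₁ := h.tw_move h₁ hN
    have t₂ := h.tw_cross_left (At.here.right.trans_nest h₂) (by omega)
    have t₃ := h.tw_move h₃.symm (by omega)
    have t₄ := h.tw_cross_left (At.here.left.trans_nest h₄) (by omega)
    have t₅ := h.tw_move h₅ (by omega)
    have hx := h.hex₁ (q := q) (a := x.size) (b := y.size) (c := 1) (by omega)
    -- The units stand for the three moves along the path; the middle one runs against its direction
    -- and is therefore written as an inverse.
    have ec : cross (sg N) q (x.size + y.size) 1 =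
        1 * (cross (sg N) q x.size 1 * (1⁻¹ * (cross (sg N) (q + x.size) y.size 1 * 1))) := by
      rw [(isBraid_sg N).cross_add_left (by omega)]; simp
    simp only [size, add_zero] at t₁ t₂ t₃ t₄ t₅ ⊢
    rw [ec, tw_mul t s₄, tw_mul t s₃, tw_mul t s₂, tw_mul t s₁, tw_inv s₃ s₂, t₁, t₂, t₃, t₄, t₅,
      ← hx]
    simp only [mul_assoc, QuotientGroup.mk_inv]

theorem Good.tw_cross_right (h : Good M m f) : ∀ {x : Paren} {q : ℕ} {t t' : Paren},
    At (node leaf x) (node x leaf) q t t' → t.size ≤ N →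
    tw M m f t t' (cross (sg N) q 1 x.size) = BB N m q 1 x.size
  | leaf, q, t, t', ht, hN => by
    obtain rfl := ht.eq
    have := ht.le_size
    simp only [size] at this
    rw [size, BB_one_one (by omega), ← h.tw_gen ht hN]
    simp [cross, up]
  | node x y, q, t, t', ht, hN => by
    have hle := ht.le_size
    simp only [size] at hle
    obtain ⟨s₁, h₁, h₁'⟩ := ht.split (node (node leaf x) y)
    obtain ⟨s₂, h₂, h₂'⟩ := h₁'.split (node (node x leaf) y)
    obtain ⟨s₃, h₃, h₃'⟩ := h₂'.split (node x (node leaf y))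
    obtain ⟨s₄, h₄, h₅⟩ := h₃'.split (node x (node y leaf))
    have e₁ := h₁.size_eq (assoc_size _ _ _).symm
    have e₂ := h₂.size_eq (by simp only [size]; omega)
    have e₃ := h₃.size_eq (by simp only [size]; omega)
    have e₄ := h₄.size_eq (by simp only [size]; omega)
    have e₅ := h₅.size_eq (by simp only [size]; omega)
    have t₁ := h.tw_move h₁.symm (by omega)
    have t₂ := h.tw_cross_right (At.here.left.trans_nest h₂) (by omega)
    have t₃ := h.tw_move h₃ (by omega)
    have t₄ := h.tw_cross_right (At.here.right.trans_nest h₄) (by omega)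
    have t₅ := h.tw_move h₅.symm (by omega)
    have hx := h.hex₂ (q := q) (a := 1) (b := x.size) (c := y.size) (by omega)
    have ec : cross (sg N) q 1 (x.size + y.size) =
        1⁻¹ * (cross (sg N) (q + x.size) 1 y.size * (1 * (cross (sg N) q 1 x.size * 1⁻¹))) := by
      rw [cross_add_right]; simp
    simp only [size, add_zero] at t₁ t₂ t₃ t₄ t₅ ⊢
    rw [ec, tw_mul t s₄, tw_mul t s₃, tw_mul t s₂, tw_mul t s₁, tw_inv s₁ t, tw_inv t' s₄,
      t₁, t₂, t₃, t₄, t₅, ← hx]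
    simp only [mul_assoc, QuotientGroup.mk_inv]

end

end GTSh

namespace GTSh

open CategoryTheory Braid Paren

/-! ### The permutation of a cabled braid -/

theorem exists_block {w : ℕ → ℕ} : ∀ {n i : ℕ}, i < offs w n →
    ∃ j x, j < n ∧ x < w j ∧ i = offs w j + x
  | 0, i, h => by simp [offs_zero] at h
  | n + 1, i, h => by
    rw [offs_succ] at h
    by_cases hi : i < offs w n
    · obtain ⟨j, x, h1, h2, h3⟩ := exists_block hi
      exact ⟨j, x, by omega, h2, h3⟩
    · exact ⟨n, i - offs w n, by omega, by omega, by omega⟩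

theorem rhoN_cross {n q a b : ℕ} (h : q + a + b ≤ n) (i : ℕ) :
    rhoN n (cross (sg n) q a b) i =
      if i < q then i else if i < q + a then i + b else if i < q + a + b then i - a else i := by
  have key : ∀ j, (rhoN n (cross (sg n) q a b))⁻¹ j = _ := mv_cross h id
  rw [← Equiv.Perm.eq_inv_iff_eq, key]
  simp only [id]
  split_ifs <;> omega

theorem rhoN_cab {N p n : ℕ} (g : Braid n) : ∀ {w : ℕ → ℕ}, p + offs w n ≤ N →
    (∀ {j x : ℕ}, j < n → x < w j →
      rhoN N (cab N p w g) (p + offs w j + x) = p + offs (mv g w) (rhoN n g j) + x) ∧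
    ∀ {i : ℕ}, (i < p ∨ p + offs w n ≤ i) → rhoN N (cab N p w g) i = i := by
  induction g using Braid.induction with
  | one => intro w _; simp [cab_one, mv_one]
  | gen i hi =>
    intro w hw
    have e := offs_mono w (show i + 1 + 1 ≤ n by omega)
    rw [offs_succ, offs_succ] at e
    refine ⟨fun {j x} hj hx => ?_, fun {j} hj => ?_⟩
    · rw [cab_sg hw hi, rhoN_sg hi, offs_mv_sg hi, Equiv.swap_apply_def, rhoN_cross (by omega)]
      rcases (by omega : j < i ∨ j = i ∨ j = i + 1 ∨ i + 1 < j) with c | c | c | c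
      · have := offs_mono w (show j + 1 ≤ i by omega)
        rw [offs_succ] at this
        split_ifs <;> omega
      · subst c; split_ifs <;> omega
      · subst c
        rw [offs_succ]
        split_ifs <;> omega
      · have := offs_mono w (show i + 1 + 1 ≤ j by omega)
        rw [offs_succ, offs_succ] at this
        split_ifs <;> omega
    · rw [cab_sg hw hi, rhoN_cross (by omega)]
      split_ifs <;> omega
  | mul u v hu hv =>
    intro w hw
    obtain ⟨v1, v2⟩ := hv hw
    obtain ⟨u1, u2⟩ := hu (w := mv v w) (by rwa [offs_mv])
    refine ⟨fun {j x} hj hx => ?_, fun {j} hj => ?_⟩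
    · rw [cab_mul, map_mul, Equiv.Perm.mul_apply, v1 hj hx, u1 (rhoN_lt v hj)
        (by simpa [mv] using hx), mv_mul, map_mul, Equiv.Perm.mul_apply]
    · rw [cab_mul, map_mul, Equiv.Perm.mul_apply, v2 hj, u2 (by rwa [offs_mv])]
  | inv u hu =>
    intro w hw
    obtain ⟨u1, u2⟩ := hu (w := mv u⁻¹ w) (by rwa [offs_mv])
    refine ⟨fun {j x} hj hx => ?_, fun {j} hj => ?_⟩
    · have := u1 (j := (rhoN n u)⁻¹ j) (x := x) (rhoN_inv_lt u hj) (by simpa [mv] using hx)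
      rw [← mv_mul, mul_inv_cancel, mv_one, ← Equiv.Perm.mul_apply, mul_inv_cancel,
        Equiv.Perm.one_apply] at this
      rw [cab_inv, map_inv, Equiv.Perm.inv_eq_iff_eq, map_inv, this]
    · rw [cab_inv, map_inv, Equiv.Perm.inv_eq_iff_eq, u2 (by rwa [offs_mv])]

theorem mem_PB_of_rhoN {n : ℕ} {g : Braid n} (h : rhoN n g = 1) : g ∈ PB n := by
  change rho n g = 1
  ext x
  rw [← rhoN_val, h]; rfl

theorem cab_mem_PB {N p n : ℕ} (w : ℕ → ℕ) {g : Braid n} (hg : g ∈ PB n) : cab N p w g ∈ PB N := by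
  by_cases hw : p + offs w n ≤ N
  · refine mem_PB_of_rhoN (Equiv.ext fun i => ?_)
    obtain ⟨h1, h2⟩ := rhoN_cab g hw
    by_cases hi : i < p ∨ p + offs w n ≤ i
    · exact h2 hi
    · obtain ⟨j, x, hj, hx, e⟩ := exists_block (w := w) (n := n) (i := i - p) (by omega)
      obtain rfl : i = p + offs w j + x := by omega
      rw [h1 hj hx, mv_pure hg, rhoN_eq_one hg]; rfl
  · rw [cab_of_not hw]; exact one_mem _

/-! ### The permutation of a twisted braid -/

/-- `ρ` on a quotient of `B_n` by a group of pure braids. -/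
def rhoQ {n : ℕ} {M : Subgroup (Braid n)} [M.Normal] (hM : M ≤ PB n) :
    Braid n ⧸ M →* Equiv.Perm (Fin n) := QuotientGroup.lift M (rho n) hM

section

variable {N : ℕ} {f : PB 3} {m : ℤ} {M : Subgroup (Braid N)} [M.Normal]

theorem FF_mem_PB (q a b c : ℕ) : FF N f q a b c ∈ PB N := cab_mem_PB _ f.2

theorem combNode_mem_PB : ∀ (a : ℕ) (t : Paren), combNode N f a t ∈ PB N
  | _, leaf => one_mem _
  | a, node x y => mul_mem (mul_mem (FF_mem_PB _ _ _ _) (combNode_mem_PB a x)) (combNode_mem_PB _ y)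

theorem combTo_mem_PB : ∀ t : Paren, combTo N f t ∈ PB N
  | leaf => one_mem _
  | node l r => mul_mem (combTo_mem_PB l) (combNode_mem_PB _ r)

theorem nbr_mem_PB (j : ℕ) : nbr N f j ∈ PB N := by
  unfold nbr
  split_ifs
  · exact one_mem _
  · exact FF_mem_PB _ _ _ _

theorem rho_twGen {j : ℕ} (hj : j + 1 < N) : rho N (twGen N f m j) = rho N (sg N j) := by
  have h1 : rho N (nbr N f j) = 1 := nbr_mem_PB j
  have h2 : rho N ((sg N j ^ 2) ^ m) = 1 := zpow_mem (sq_mem_PB hj) m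
  rw [twGen, bp, map_mul, map_mul, map_mul, map_inv, h1, h2]
  simp

/-- All associators are pure and x^m is pure, so permutations are kept. Hence the twist of a
morphism has the same source and target. -/
theorem Good.rhoQ_tw (h : Good M m f) (hM : M ≤ PB N) (t t' : Paren) (g : Braid N) :
    rhoQ hM (tw M m f t t' g) = rho N g := by
  have e : (rhoQ hM).comp (twComb M m f) = rho N := hom_ext fun i hi => by
    rw [MonoidHom.comp_apply, h.twComb_sg hi]
    exact rho_twGen hi
  have e1 : ∀ t, rhoQ hM (combTo N f t : Braid N ⧸ M) = 1 := fun t => combTo_mem_PB t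
  have e2 : rhoQ hM (twComb M m f g) = rho N g := congrArg (· g) e
  rw [tw, map_mul, map_mul, map_inv, e1, e1, e2]
  simp

end

/-! ### Compatibility of the twist with insertions -/

theorem Paren.graft_left {t l r : Paren} {p : ℕ} (h : p < l.size) :
    graft t (node l r) p = node (graft t l p) r := if_pos h

theorem Paren.graft_right {t l r : Paren} {p : ℕ} (h : l.size ≤ p) :
    graft t (node l r) p = node l (graft t r (p - l.size)) := if_neg (by omega)

theorem blockShift_FF {n k : ℕ} (p : Fin n) (f : PB 3) {q a b c : ℕ}
    (h : q + a + b + c ≤ k + 1) :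
    blockShift k p (FF (k + 1) f q a b c) = FF (n + k) f (p + q) a b c := by
  rw [blockShift, shift_eq_cab, FF, cab_cab _ (by rw [offs_sz3]; omega)
    (by rw [offs_const_one]; omega), FF, offs_const_one]
  exact cab_congr _ fun i _ => by simp [mrg, bsum]

/-- Putting a braid on a block translates positions and changes no sizes, so moves go to moves and
enclosed generators to enclosed generators. -/
theorem Good.tw_blockShift {n k : ℕ} {f : PB 3} {m : ℤ} {M : Subgroup (Braid (n + k))} [M.Normal]
    {L : Subgroup (Braid (k + 1))} [L.Normal] (hM : Good M m f) (hL : Good L m f) (p : Fin n)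
    (hLM : L ≤ M.comap (blockShift k p)) {s : Paren} (hs : s.size = n) {t t' : Paren}
    (ht : t.size = k + 1) (ht' : t'.size = k + 1) (g : Braid (k + 1)) :
    QuotientGroup.map L M (blockShift k p) hLM (tw L m f t t' g) =
      tw M m f (graft t s p) (graft t' s p) (blockShift k p g) := by
  have hp : p.1 < s.size := by rw [hs]; exact p.2
  have hsz : ∀ {t : Paren}, t.size = k + 1 → (graft t s p).size ≤ n + k := fun {t} ht => by
    have := size_graft t s p hp
    omega
  refine braid_induction (n := k + 1)
    (P := fun t t' g => QuotientGroup.map L M (blockShift k p) hLM (tw L m f t t' g) =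
      tw M m f (graft t s p) (graft t' s p) (blockShift k p g)) ?_ ?_ ?_ ?_ ?_ ht ht' g
  · intro t _; rw [tw_one, map_one, map_one, tw_one]
  · intro q x y z t t' ht h
    have hle := h.le_size
    simp only [size] at hle
    rw [hL.tw_move h ht.le, map_one, hM.tw_move (h.graft_in hp) (hsz ht), QuotientGroup.map_mk,
      blockShift_FF p f (by omega)]
  · intro i t ht hi h
    rw [hL.tw_gen h ht.le, blockShift_sg p hi, hM.tw_gen (h.graft_in hp) (hsz ht),
      QuotientGroup.map_mk, blockShift, shift_bp _ hi]
  · intro t t' t'' g g' _ _ _ h h'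
    rw [tw_mul t t', map_mul, h, h', map_mul, tw_mul _ (graft t' s p)]
  · intro t t' g _ _ h
    rw [tw_inv, map_inv, h, map_inv, tw_inv]

theorem bsum_cabW (k p a : ℕ) : ∀ l,
    bsum (cabW k p) a l = if a ≤ p ∧ p < a + l then l + k else l
  | 0 => by simp only [bsum, Finset.range_zero, Finset.sum_empty]; split_ifs <;> omega
  | l + 1 => by
    rw [bsum_succ, bsum_cabW k p a l, cabW]
    split_ifs <;> omega

theorem cable_FF {n k : ℕ} (p : Fin n) (f : PB 3) {q a b c : ℕ} (h : q + a + b + c ≤ n) :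
    cable k p (FF n f q a b c) = FF (n + k) f (if p.1 < q then q + k else q)
      (if q ≤ p.1 ∧ p.1 < q + a then a + k else a)
      (if q + a ≤ p.1 ∧ p.1 < q + a + b then b + k else b)
      (if q + a + b ≤ p.1 ∧ p.1 < q + a + b + c then c + k else c) := by
  have hp := p.2
  rw [cable_eq_cab, FF, cab_cab _ (by rw [offs_sz3]; omega)
    (by rw [offs_cabW]; split_ifs; omega), FF, offs_cabW, zero_add]
  refine cab_congr _ fun i hi => ?_
  match i, hi with
  | 0, _ => simp [mrg, bsum_cabW, offs_zero, sz3]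
  | 1, _ => simp [mrg, bsum_cabW, sz3, offs]
  | 2, _ => simp [mrg, bsum_cabW, sz3, offs, Finset.sum_range_succ, ← add_assoc]

theorem cable_mk_eq {n k : ℕ} {M : Subgroup (Braid (n + k))} [M.Normal] {L : Subgroup (Braid n)}
    [L.Normal] (hL : L ≤ PB n) (hLM : ∀ p : Fin n, ∀ x ∈ L, cable k p x ∈ M) {x y : Braid n}
    (p : Fin n) (h : (x : Braid n ⧸ L) = y) :
    (cable k p x : Braid (n + k) ⧸ M) = cable k p y := by
  rw [QuotientGroup.eq] at h ⊢
  have h2 : y = x * (x⁻¹ * y) := by group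
  rw [h2, cable_mul, show rho n (x⁻¹ * y) = 1 from hL h, Equiv.Perm.one_apply, ← mul_assoc,
    inv_mul_cancel, one_mul]
  exact hLM p _ h

/-- Checked on moves and generators. Cabling enlarges at most one of the three blocks of a move, so
a move stays a move. A generator at the cabled strand becomes the crossing of a block with a strand,
whose twist is known by the hexagons. Representatives y are used because cabling is defined on
braids, not on classes. -/
theorem Good.tw_cable {n k : ℕ} {f : PB 3} {m : ℤ} {M : Subgroup (Braid (n + k))} [M.Normal]
    {L : Subgroup (Braid n)} [L.Normal] (hM : Good M m f) (hL : Good L m f) (hLP : L ≤ PB n)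
    (hLM : ∀ p : Fin n, ∀ x ∈ L, cable k p x ∈ M) {u : Paren} (hu : u.size = k + 1) {t t' : Paren}
    (ht : t.size = n) (ht' : t'.size = n) (g : Braid n) :
    ∀ (p : Fin n) (y : Braid n), (y : Braid n ⧸ L) = tw L m f t t' g →
      (cable k p y : Braid (n + k) ⧸ M) =
        tw M m f (graft u t p) (graft u t' (rho n g p)) (cable k p g) := by
  have hrho : ∀ {t t' : Paren} {g y : Braid n}, (y : Braid n ⧸ L) = tw L m f t t' g →
      rho n y = rho n g := fun {t t' g y} h => by
    rw [← hL.rhoQ_tw hLP t t' g, ← h]; rfl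
  have hsz : ∀ {t : Paren} (p : Fin n), t.size = n → (graft u t p).size ≤ n + k := by
    intro t p ht
    have := size_graft u t p (by rw [ht]; exact p.2)
    omega
  refine braid_induction (n := n) (P := fun t t' g => ∀ (p : Fin n) (y : Braid n),
      (y : Braid n ⧸ L) = tw L m f t t' g → (cable k p y : Braid (n + k) ⧸ M) =
        tw M m f (graft u t p) (graft u t' (rho n g p)) (cable k p g)) ?_ ?_ ?_ ?_ ?_ ht ht' g
  · intro t _ p y hy
    rw [tw_one] at hy
    have := cable_mk_eq (M := M) hLP hLM p (y := 1) hy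
    rw [this, cable_one, map_one, Equiv.Perm.one_apply, tw_one]; rfl
  · intro q x y z t t' ht h p v hv
    have hle := h.le_size
    have hp := p.2
    have ha := assoc_size x y z
    have hg : ∀ {w : Paren} {i : ℕ}, i < w.size → (graft u w i).size = w.size + k :=
      fun {w i} hi => by have := size_graft u w i hi; omega
    rw [hL.tw_move h ht.le] at hv
    rw [cable_mk_eq hLP hLM p hv, cable_one, map_one, Equiv.Perm.one_apply]
    simp only [size] at hle ha
    rw [cable_FF p f (by omega)]
    -- The cabled strand lies to the left of the moved part, in x, in y, in z, or to the right.
    rcases (by omega : p.1 < q ∨ (q ≤ p.1 ∧ p.1 < q + x.size) ∨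
      (q + x.size ≤ p.1 ∧ p.1 < q + x.size + y.size) ∨
      (q + x.size + y.size ≤ p.1 ∧ p.1 < q + x.size + y.size + z.size) ∨
      q + x.size + y.size + z.size ≤ p.1) with c | c | c | c | c
    · rw [hM.tw_move (h.graft_lt (assoc_size x y z) hu c) (hsz p ht), if_pos c, if_neg (by omega),
        if_neg (by omega), if_neg (by omega)]
    · obtain ⟨i, hi⟩ := Nat.exists_eq_add_of_le c.1
      have := h.graft_inside (t := u) (assoc_size x y z) (i := i) (i' := i)
        (by simp only [size]; omega) (by simp only [size]; omega)
      rw [graft_left (l := node x y) (by simp only [size]; omega), graft_left (l := x) (by omega),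
        graft_left (l := x) (by omega), ← hi] at this
      rw [hM.tw_move this (hsz p ht), hg (by omega), if_neg (by omega), if_pos c,
        if_neg (by omega), if_neg (by omega)]
    · obtain ⟨i, hi⟩ := Nat.exists_eq_add_of_le (show q ≤ p.1 by omega)
      have := h.graft_inside (t := u) (assoc_size x y z) (i := i) (i' := i)
        (by simp only [size]; omega) (by simp only [size]; omega)
      rw [graft_left (l := node x y) (by simp only [size]; omega), graft_right (l := x) (by omega),
        graft_right (l := x) (by omega), graft_left (l := y) (by omega), ← hi] at this
      rw [hM.tw_move this (hsz p ht), hg (by omega), if_neg (by omega), if_neg (by omega),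
        if_pos c, if_neg (by omega)]
    · obtain ⟨i, hi⟩ := Nat.exists_eq_add_of_le (show q ≤ p.1 by omega)
      have := h.graft_inside (t := u) (assoc_size x y z) (i := i) (i' := i)
        (by simp only [size]; omega) (by simp only [size]; omega)
      rw [graft_right (l := node x y) (by simp only [size]; omega), graft_right (l := x) (by omega),
        graft_right (l := y) (by omega), ← hi, size, ← Nat.sub_sub] at this
      rw [hM.tw_move this (hsz p ht), hg (by omega), if_neg (by omega), if_neg (by omega),
        if_neg (by omega), if_pos c]
    · rw [hM.tw_move (h.graft_ge (assoc_size x y z) (by simp only [size]; omega) (by omega))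
        (hsz p ht), if_neg (by omega), if_neg (by omega), if_neg (by omega), if_neg (by omega)]
  · intro i t ht hi h p v hv
    have hle := h.le_size
    have hp := p.2
    have hw : 0 + offs (cabW k p) n ≤ n + k := by rw [offs_cabW, if_pos hp]; omega
    rw [hL.tw_gen h ht.le] at hv
    rw [cable_mk_eq hLP hLM p hv, cable_eq_cab, cable_eq_cab, cab_bp hw hi, cab_sg hw hi,
      offs_cabW, cabW, cabW, zero_add, rho_sg hi, adjSwap_val hi]
    rcases (by omega : p.1 < i ∨ p.1 = i ∨ p.1 = i + 1 ∨ i + 1 < p.1) with c | c | c | c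
    · rw [if_pos c, if_neg (by omega), if_neg (by omega), if_neg (by omega), if_neg (by omega),
        cross_one_right, up, up, one_mul, add_zero, BB_one_one (by omega),
        hM.tw_gen (h.graft_lt rfl hu c) (hsz p ht)]
    -- The cabled strand is the left one of the pair and ends as the right one.
    · have := h.graft_inside (t := u) rfl (i := 0) (i' := 1) (by simp [size]) (by simp [size])
      rw [graft_left (by simp [size]), graft_right (by simp [size]), graft, graft] at this
      have hx := hM.tw_cross_left this (by have := hsz p ht; rwa [c] at this)
      rw [hu] at hx
      rw [if_neg (by omega), if_pos c.symm, if_neg (by omega), if_pos c, c, ← hx, add_zero]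
    · have := h.graft_inside (t := u) rfl (i := 1) (i' := 0) (by simp [size]) (by simp [size])
      rw [graft_right (by simp [size]), graft_left (by simp [size]), graft, graft] at this
      have hx := hM.tw_cross_right this (by have := hsz p ht; rwa [c] at this)
      rw [hu] at hx
      rw [if_neg (by omega), if_neg (by omega), if_pos c.symm, if_neg (by omega), if_pos c, c, ← hx,
        add_zero]
    · rw [if_neg (by omega), if_neg (by omega), if_neg (by omega), if_neg (by omega),
        if_neg (by omega), cross_one_right, up, up, one_mul, add_zero, BB_one_one (by omega),
        hM.tw_gen (h.graft_ge rfl (by simp only [size]; omega) (by omega)) (hsz p ht)]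
  · intro t t' t'' g g' _ _ _ h h' p y hy
    obtain ⟨v, hv⟩ := QuotientGroup.mk_surjective (tw L m f t t' g)
    obtain ⟨v', hv'⟩ := QuotientGroup.mk_surjective (tw L m f t' t'' g')
    have hy' : (y : Braid n ⧸ L) = ((v' * v : Braid n) : Braid n ⧸ L) := by
      rw [hy, tw_mul t t', ← hv, ← hv', QuotientGroup.mk_mul]
    rw [cable_mk_eq hLP hLM p hy', cable_mul, QuotientGroup.mk_mul, h p v hv, hrho hv,
      h' (rho n g p) v' hv', cable_mul, map_mul, Equiv.Perm.mul_apply, tw_mul]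
  · intro t t' g _ _ h p y hy
    have hy' : ((y⁻¹ : Braid n) : Braid n ⧸ L) = tw L m f t t' g := by
      rw [QuotientGroup.mk_inv, hy, tw_inv, inv_inv]
    have h1 := h ((rho n g)⁻¹ p) y⁻¹ hy'
    have e : cable k ((rho n g)⁻¹ p) y⁻¹ = (cable k p y)⁻¹ := by
      have : rho n y = (rho n g)⁻¹ := by rw [← hrho hy', map_inv, inv_inv]
      rw [cable_inv, this, inv_inv, ← Equiv.Perm.mul_apply, mul_inv_cancel]; rfl
    rw [e, QuotientGroup.mk_inv, inv_eq_iff_eq_inv, ← Equiv.Perm.mul_apply, mul_inv_cancel,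
      Equiv.Perm.one_apply] at h1
    rw [h1, cable_inv, map_inv, tw_inv]

end GTSh

namespace GTSh

open CategoryTheory Braid Paren

/-! ### Surjectivity of the twist -/

theorem combTo_comb {N : ℕ} {f : PB 3} : ∀ n, combTo N f (comb n) = 1
  | 0 => rfl
  | n + 1 => by rw [comb, combTo, combTo_comb n, combNode, one_mul]

theorem at_comb {i : ℕ} : ∀ {j : ℕ}, i ≤ j → At (comb i) (comb i) 0 (comb j) (comb j)
  | 0, h => by
    obtain rfl : i = 0 := by omega
    exact .here
  | j + 1, h => by
    by_cases hi : i = j + 1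
    · subst hi; exact .here
    · exact (at_comb (j := j) (by omega)).left

/-- This is the origin of the exponent 2m + 1: it describes the effect of the twist on the squares
of the generators. -/
theorem bp_mul_self (n : ℕ) (m : ℤ) (i : ℕ) : bp n m i * bp n m i = (sg n i ^ 2) ^ (2 * m + 1) := by
  have h : Commute (sg n i) ((sg n i ^ 2) ^ m) := ((Commute.refl _).pow_right 2).zpow_right m
  rw [bp, mul_assoc, ← mul_assoc _ (sg n i), ← h.eq, zpow_add, two_mul, zpow_add, zpow_one, pow_two]
  have h2 : Commute ((sg n i * sg n i) ^ m) (sg n i) := by rw [← pow_two]; exact h.symm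
  have h3 := (h2.mul_right h2).eq
  rw [← mul_assoc, ← mul_assoc, mul_assoc (_ ^ m), h3, ← mul_assoc, h3]

theorem cab_sz3_sg_zero {N i : ℕ} (hi : i + 1 < N) : cab N i (sz3 1 1 0) (sg 3 0) = sg N i := by
  rw [cab_sg (by rw [offs_sz3]; omega) (by omega)]
  simp [sz3, cross, up, offs_zero]

theorem cab_sz3_bp_zero {N i : ℕ} (m : ℤ) (hi : i + 1 < N) :
    cab N i (sz3 1 1 0) (bp 3 m 0) = bp N m i := by
  rw [cab_bp (by rw [offs_sz3]; omega) (by omega), offs_zero, add_zero]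
  exact BB_one_one hi

section

variable {N : ℕ} {f : PB 3} {m : ℤ} {M : Subgroup (Braid N)} [M.Normal]

/-- The hypothesis in B_3 is carried to the strands i and i + 1 by deleting the third strand, that
is, by the sizes 1, 1, 0. It makes σ_i² a power of the twisted generator, and σ_i is the twisted
generator divided by a power of σ_i². -/
theorem mk_sg_mem_zpowers
    (h : sg 3 0 ^ 2 ∈ Subgroup.zpowers ((sg 3 0 ^ 2) ^ (2 * m + 1)) ⊔ pull M 3) {i : ℕ}
    (hi : i + 1 < N) : (sg N i : Braid N ⧸ M) ∈ Subgroup.zpowers (bp N m i : Braid N ⧸ M) := by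
  have hq : ((sg 3 0 ^ 2 : Braid 3) : Braid 3 ⧸ pull M 3) ∈
      Subgroup.zpowers (((sg 3 0 ^ 2) ^ (2 * m + 1) : Braid 3) : Braid 3 ⧸ pull M 3) := by
    have := Subgroup.mem_map_of_mem (QuotientGroup.mk' (pull M 3)) h
    rw [Subgroup.map_sup, QuotientGroup.map_mk'_self, sup_bot_eq, MonoidHom.map_zpowers] at this
    exact this
  obtain ⟨k, hk⟩ := hq
  let y : PB 3 := ⟨sg 3 0 ^ 2, sq_mem_PB (by omega)⟩
  have hy : cab N i (sz3 1 1 0) (sg 3 0 ^ 2) = sg N i ^ 2 := by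
    rw [pow_two, cab_mul, pow_two, cab_sz3_sg_zero hi, ← mv_bp (m := 0) (by omega), mv_bp_zero,
      cab_sz3_sg_zero hi]
  have e := cab_mk_eq (p := i) (M := M) (sz3 1 1 0)
    (g := ((sg 3 0 ^ 2) ^ (2 * m + 1)) ^ k) (h := sg 3 0 ^ 2) hk
  have e2 : cab N i (sz3 1 1 0) (((sg 3 0 ^ 2) ^ (2 * m + 1)) ^ k) =
      ((sg N i ^ 2) ^ (2 * m + 1)) ^ k := by
    have := (map_zpow (cabPB N i (sz3 1 1 0)) (y ^ (2 * m + 1)) k).trans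
      (congrArg (· ^ k) (map_zpow (cabPB N i (sz3 1 1 0)) y (2 * m + 1)))
    change cab N i (sz3 1 1 0) (((sg 3 0 ^ 2) ^ (2 * m + 1)) ^ k) =
      (cab N i (sz3 1 1 0) (sg 3 0 ^ 2) ^ (2 * m + 1)) ^ k at this
    rw [this, hy]
  rw [e2, hy, ← bp_mul_self] at e
  have hb : ((sg N i ^ 2 : Braid N) : Braid N ⧸ M) ∈
      Subgroup.zpowers (bp N m i : Braid N ⧸ M) := by
    rw [← e]
    exact zpow_mem (mul_mem (Subgroup.mem_zpowers _) (Subgroup.mem_zpowers _)) k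
  have hs : (sg N i : Braid N ⧸ M) =
      (bp N m i : Braid N ⧸ M) * (((sg N i ^ 2 : Braid N) : Braid N ⧸ M) ^ m)⁻¹ := by
    rw [eq_mul_inv_iff_mul_eq]; rfl
  rw [hs]
  exact mul_mem (Subgroup.mem_zpowers _) (inv_mem (zpow_mem hb m))

/-- The cabled power is the product of the twisted braidings of the block `comb k` with its right
neighbour, forth and back. These are the twists of genuine crossings along a loop at the comb, where
`combTo` is 1, so the product is a value of `twComb`. -/
theorem Good.cab_sq_mem_range (h : Good M m f) {i : ℕ} (hi : i + 1 < N) (h0 : 0 < i) :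
    (cab N 0 (sz3 i 1 1) ((sg 3 0 ^ 2) ^ (2 * m + 1)) : Braid N ⧸ M) ∈ (twComb M m f).range := by
  obtain ⟨k, rfl⟩ : ∃ k, i = k + 1 := ⟨i - 1, by omega⟩
  have hw : 0 + offs (sz3 (k + 1) 1 1) 3 ≤ N := by rw [offs_sz3]; omega
  have hw' : 0 + offs (sz3 1 (k + 1) 1) 3 ≤ N := by rw [offs_sz3]; omega
  rw [← bp_mul_self, cab_mul, mv_bp_zero, cab_bp hw (by omega), cab_bp hw' (by omega)]
  have hN : (comb (N - 1)).size = N := by rw [size_comb]; omega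
  have hc : At (comb (k + 1)) (comb (k + 1)) 0 (comb (N - 1)) (comb (N - 1)) := at_comb (by omega)
  obtain ⟨s, h1, h2⟩ := hc.split (node leaf (comb k))
  have hs := h1.size_eq (by simp [size, size_comb, add_comm])
  have t1 := h.tw_cross_left h1 hN.le
  have t2 := h.tw_cross_right h2 (by omega)
  rw [size_comb] at t1 t2
  refine ⟨cross (sg N) 0 1 (k + 1) * cross (sg N) 0 (k + 1) 1, ?_⟩
  have e := tw_mul (M := M) (m := m) (f := f) (comb (N - 1)) s (comb (N - 1))
    (cross (sg N) 0 (k + 1) 1) (cross (sg N) 0 1 (k + 1))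
  rw [t1, t2, tw, combTo_comb] at e
  simpa [sz3, offs_zero] using e

/-- Modulo M the associator `nbr` is a cabling of f, and f is a word in x_12^{2m+1} and f⁻¹
x_23^{2m+1} f, whose cablings lie in the range. So the associators lie in the range, hence the
twisted generators, and by `mk_sg_mem_zpowers` the generators. -/
theorem Good.range_twComb (h : Good M m f)
    (h₁ : sg 3 0 ^ 2 ∈ Subgroup.zpowers ((sg 3 0 ^ 2) ^ (2 * m + 1)) ⊔ pull M 3)
    (h₂ : f.1 ∈ Subgroup.closure {(sg 3 0 ^ 2) ^ (2 * m + 1),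
      f.1⁻¹ * (sg 3 1 ^ 2) ^ (2 * m + 1) * f.1} ⊔ pull M 3) :
    (twComb M m f).range = ⊤ := by
  have hgen : ∀ {i : ℕ}, i + 1 < N → (twGen N f m i : Braid N ⧸ M) ∈ (twComb M m f).range :=
    fun {i} hi => ⟨sg N i, h.twComb_sg hi⟩
  have hnbr : ∀ {i : ℕ}, i + 1 < N → (nbr N f i : Braid N ⧸ M) ∈ (twComb M m f).range := by
    intro i hi
    by_cases h0 : i = 0
    · rw [nbr, if_pos h0]; exact one_mem _
    have hw : 0 + offs (sz3 i 1 1) 3 ≤ N := by rw [offs_sz3]; omega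
    have hn : nbr N f i = FF N f 0 i 1 1 := if_neg h0
    have hfp := f.2
    let x : PB 3 := ⟨sg 3 0 ^ 2, sq_mem_PB (by omega)⟩
    let y : PB 3 := ⟨sg 3 1 ^ 2, sq_mem_PB (by omega)⟩
    -- The first generator is settled by `cab_sq_mem_range`; the second one, cabled by i, 1, 1, is
    -- the square of `twGen N f m i`. Purity is carried along so that cabling is multiplicative.
    have hcl : ∀ w ∈ Subgroup.closure {(sg 3 0 ^ 2) ^ (2 * m + 1),
        f.1⁻¹ * (sg 3 1 ^ 2) ^ (2 * m + 1) * f.1}, w ∈ PB 3 ∧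
        (cab N 0 (sz3 i 1 1) w : Braid N ⧸ M) ∈ (twComb M m f).range := by
      intro w hw'
      induction hw' using Subgroup.closure_induction with
      | mem w hw' =>
        rcases hw' with rfl | hw'
        · exact ⟨zpow_mem x.2 _, h.cab_sq_mem_range hi (by omega)⟩
        · rw [Set.mem_singleton_iff] at hw'
          subst hw'
          have hy : (sg 3 1 ^ 2) ^ (2 * m + 1) ∈ PB 3 := zpow_mem y.2 _
          refine ⟨mul_mem (mul_mem (inv_mem hfp) hy) hfp, ?_⟩
          rw [cab_mul_pure _ _ hfp, cab_mul_pure _ _ hy, cab_inv_pure _ hfp, ← bp_mul_self, cab_mul,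
            mv_bp_one, cab_bp hw (by omega)]
          have e1 : BB N m (0 + offs (sz3 i 1 1) 1) (sz3 i 1 1 1) (sz3 i 1 1 (1 + 1)) =
              bp N m i := by
            rw [← BB_one_one hi]; simp [sz3, offs]
          have e2 : (FF N f 0 i 1 1)⁻¹ * (bp N m i * bp N m i) * FF N f 0 i 1 1 =
              twGen N f m i * twGen N f m i := by
            rw [twGen, hn]; group
          rw [e1]
          change (((FF N f 0 i 1 1)⁻¹ * (bp N m i * bp N m i) * FF N f 0 i 1 1 : Braid N) :
            Braid N ⧸ M) ∈ _
          rw [e2]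
          exact mul_mem (hgen hi) (hgen hi)
      | one => exact ⟨one_mem _, by rw [cab_one]; exact one_mem _⟩
      | mul a b _ _ ha hb =>
        exact ⟨mul_mem ha.1 hb.1, by rw [cab_mul_pure _ _ hb.1]; exact mul_mem ha.2 hb.2⟩
      | inv a _ ha =>
        exact ⟨inv_mem ha.1, by rw [cab_inv_pure _ ha.1]; exact inv_mem ha.2⟩
    obtain ⟨w, hw1, z, hz, e⟩ := Subgroup.mem_sup_of_normal_right.mp h₂
    have e2 := cab_mk_eq (p := 0) (M := M) (sz3 i 1 1) (g := w) (h := f.1)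
      (QuotientGroup.eq.mpr (by rw [← e, inv_mul_cancel_left]; exact hz))
    rw [hn, FF, ← e2]
    exact (hcl w hw1).2
  rw [eq_top_iff]
  rintro q -
  obtain ⟨g, rfl⟩ := QuotientGroup.mk_surjective q
  induction g using Braid.induction with
  | one => exact one_mem _
  | gen i hi =>
    have h1 : (bp N m i : Braid N ⧸ M) ∈ (twComb M m f).range := by
      have := mul_mem (mul_mem (hnbr hi) (hgen hi)) (inv_mem (hnbr hi))
      simpa [twGen, mul_assoc] using this
    exact (Subgroup.zpowers_le.mpr h1) (mk_sg_mem_zpowers h₁ hi)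
  | mul a b ha hb => exact mul_mem ha hb
  | inv a ha => exact inv_mem ha

end

/-! ### A cofinal sequence of fully invariant subgroups -/

instance finite_hom (n : ℕ) (G : Type*) [Group G] [Finite G] : Finite (Braid n →* G) :=
  Finite.of_injective (fun φ (i : Fin n) => φ (sg n i)) fun _ _ h =>
    hom_ext fun i hi => congrFun h ⟨i, by omega⟩

/-- The intersection of the kernels of all homomorphisms from `B_n` to the symmetric groups of
degree at most `n + j`. -/
def core (n j : ℕ) : Subgroup (Braid n) :=
  ⨅ x : (i : Fin (n + j + 1)) × (Braid n →* Equiv.Perm (Fin i)), x.2.ker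

instance core_normal (n j : ℕ) : (core n j).Normal :=
  Subgroup.normal_iInf_normal fun x => MonoidHom.normal_ker x.2

instance core_finiteIndex (n j : ℕ) : (core n j).FiniteIndex :=
  Subgroup.finiteIndex_iInf fun x => inferInstanceAs (x.2.ker).FiniteIndex

theorem mem_core {n j : ℕ} {g : Braid n} :
    g ∈ core n j ↔ ∀ i, i ≤ n + j → ∀ φ : Braid n →* Equiv.Perm (Fin i), φ g = 1 := by
  rw [core, Subgroup.mem_iInf]
  exact ⟨fun h i hi φ => h ⟨⟨i, by omega⟩, φ⟩, fun h x => h x.1 (by omega) x.2⟩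

theorem core_anti {n i j : ℕ} (h : i ≤ j) : core n j ≤ core n i := fun g hg =>
  mem_core.mpr fun k hk φ => mem_core.mp hg k (by omega) φ

/-- Degrees up to n + j are allowed so that ρ itself is among the homomorphisms. -/
theorem core_le_PB (n j : ℕ) : core n j ≤ PB n := fun g hg =>
  mem_core.mp hg n (by omega) (rho n)

/-- The action on the cosets of M is one of the homomorphisms once n + j reaches the index, and only
elements of M fix the trivial coset. -/
theorem exists_core_le {n : ℕ} (M : Subgroup (Braid n)) [M.FiniteIndex] :
    ∃ j₀, ∀ j, j₀ ≤ j → core n j ≤ M := by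
  have e : (Braid n ⧸ M) ≃ Fin (Nat.card (Braid n ⧸ M)) := Finite.equivFin _
  refine ⟨Nat.card (Braid n ⧸ M), fun j hj g hg => ?_⟩
  have := mem_core.mp hg _ (by omega)
    (e.permCongrHom.toMonoidHom.comp (MulAction.toPermHom (Braid n) (Braid n ⧸ M)))
  have h2 : MulAction.toPermHom (Braid n) (Braid n ⧸ M) g = 1 :=
    e.permCongrHom.injective (this.trans (map_one _).symm)
  have h3 := congrArg (fun φ : Equiv.Perm (Braid n ⧸ M) => φ ((1 : Braid n) : Braid n ⧸ M)) h2
  have h4 : ((g * 1 : Braid n) : Braid n ⧸ M) = ((1 : Braid n) : Braid n ⧸ M) := h3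
  rw [mul_one, eq_comm, QuotientGroup.eq, inv_one, one_mul] at h4
  exact h4

/-- A homomorphism to a symmetric group that occurs in the definition of `core` factors through the
quotient; composed with φ it is again one of those that occur, so it kills g. -/
theorem core_invariant {n j : ℕ} (φ : Braid n →* Braid n ⧸ core n j) {g : Braid n}
    (hg : g ∈ core n j) : φ g = 1 := by
  obtain ⟨y, hy⟩ := QuotientGroup.mk_surjective (φ g)
  rw [← hy, QuotientGroup.eq_one_iff, mem_core]
  intro i hi ψ
  have := mem_core.mp hg i hi ((QuotientGroup.lift (core n j) ψ fun x hx =>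
    mem_core.mp hx i hi ψ).comp φ)
  rw [MonoidHom.comp_apply, ← hy] at this
  exact this

end GTSh

namespace GTSh

open CategoryTheory Braid Paren

/-! ### Completions of groupoids -/

namespace CompatRel

variable {C : Type} [Groupoid.{0} C]

/-- `R` is finer than `S`. -/
def Le (R S : CompatRel C) : Prop :=
  ∀ (x y : C) (f g : x ⟶ y), R.rel x y f g → S.rel x y f g

/-- The intersection of two compatible equivalence relations. -/
def inf (R S : CompatRel C) : CompatRel C where
  rel a b := R.rel a b ⊓ S.rel a b
  comp h h' := ⟨R.comp h.1 h'.1, S.comp h.2 h'.2⟩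
  finite a b := by
    have := R.finite a b
    have := S.finite a b
    refine Finite.of_injective (β := Quotient (R.rel a b) × Quotient (S.rel a b))
      (fun x => (Quotient.map (sa := R.rel a b ⊓ S.rel a b) (sb := R.rel a b) id
        (fun _ _ h => h.1) x, Quotient.map (sa := R.rel a b ⊓ S.rel a b) (sb := S.rel a b) id
        (fun _ _ h => h.2) x)) ?_
    rintro ⟨f⟩ ⟨g⟩ h
    have h1 : R.rel a b f g := Quotient.exact (s := R.rel a b) (Prod.ext_iff.mp h).1
    have h2 : S.rel a b f g := Quotient.exact (s := S.rel a b) (Prod.ext_iff.mp h).2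
    exact Quotient.sound (s := R.rel a b ⊓ S.rel a b) ⟨h1, h2⟩

theorem inf_le_left (R S : CompatRel C) : Le (R.inf S) R := fun _ _ _ _ h => h.1

theorem inf_le_right (R S : CompatRel C) : Le (R.inf S) S := fun _ _ _ _ h => h.2

/-- The relation with a single class of morphisms between any two objects. -/
def top (C : Type) [Groupoid.{0} C] : CompatRel C where
  rel _ _ := ⊤
  comp _ _ := trivial
  finite a b := by
    have : Subsingleton (Quotient (⊤ : Setoid (a ⟶ b))) :=
      ⟨by rintro ⟨f⟩ ⟨g⟩; exact Quotient.sound (s := ⊤) trivial⟩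
    exact Finite.of_subsingleton

end CompatRel

namespace ProHom

variable {C D : Type} [Groupoid.{0} C] [Groupoid.{0} D] {a b c : C}

theorem ext_val {γ δ : ProHom a b} (h : ∀ R, γ.val R = δ.val R) : γ = δ := by
  cases γ; cases δ
  simp only [mk.injEq]
  exact funext h

theorem val_eq_of_le {γ : ProHom a b} {R S : CompatRel C} (h : R.Le S) {g : a ⟶ b}
    (hg : γ.val R = ⟦g⟧) : γ.val S = ⟦g⟧ := by
  rw [← γ.compat R S h, hg]; rfl

theorem val_congr_of_le {γ δ : ProHom a b} {R S : CompatRel C} (h : R.Le S)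
    (e : γ.val R = δ.val R) : γ.val S = δ.val S := by
  rw [← γ.compat R S h, ← δ.compat R S h, e]

/-- The intersection of two relations gives one representative that serves both. -/
theorem exists_rep (γ : ProHom a b) (R S : CompatRel C) :
    ∃ g : a ⟶ b, γ.val R = ⟦g⟧ ∧ γ.val S = ⟦g⟧ := by
  obtain ⟨g, hg⟩ := Quotient.exists_rep (γ.val (R.inf S))
  exact ⟨g, val_eq_of_le (R.inf_le_left S) hg.symm, val_eq_of_le (R.inf_le_right S) hg.symm⟩

theorem comp_val {γ : ProHom a b} {η : ProHom b c} {R : CompatRel C} {f : a ⟶ b} {g : b ⟶ c}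
    (hf : γ.val R = ⟦f⟧) (hg : η.val R = ⟦g⟧) : (γ.comp η).val R = ⟦f ≫ g⟧ := by
  have : (γ.comp η).val R = Quotient.map₂ (fun f g => f ≫ g)
    (fun _ _ h _ _ h' => R.comp h h') (γ.val R) (η.val R) := rfl
  rw [this, hf, hg]; rfl

theorem map_val (F : C ⥤ D) {γ : ProHom a b} {R : CompatRel D} {f : a ⟶ b}
    (hf : γ.val (R.pullback F) = ⟦f⟧) : (γ.map F).val R = ⟦F.map f⟧ := by
  have : (γ.map F).val R = Quotient.map F.map (fun _ _ h => h) (γ.val (R.pullback F)) := rfl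
  rw [this, hf]; rfl

theorem continuous_val (R : CompatRel C) :
    @Continuous _ _ _ ⊥ (fun γ : ProHom a b => γ.val R) :=
  continuous_iff_le_induced.mpr (iInf_le _ R)

theorem continuous_of_val {X : Type*} [TopologicalSpace X] {φ : X → ProHom a b}
    (h : ∀ R, @Continuous _ _ _ ⊥ fun x => (φ x).val R) : Continuous φ :=
  continuous_iInf_rng.mpr fun R => continuous_induced_rng.mpr (h R)

theorem continuous_of_factors {X : Type*} {φ : ProHom a b → X} {R : CompatRel C}
    (h : ∀ γ δ, γ.val R = δ.val R → φ γ = φ δ) : @Continuous _ _ _ ⊥ φ := by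
  let _ : TopologicalSpace X := ⊥
  let _ : TopologicalSpace (Quotient (R.rel a b)) := ⊥
  have : DiscreteTopology (Quotient (R.rel a b)) := ⟨rfl⟩
  refine continuous_def.mpr fun s _ => ?_
  have : φ ⁻¹' s = (fun γ : ProHom a b => γ.val R) ⁻¹' ((fun γ => γ.val R) '' (φ ⁻¹' s)) := by
    ext γ
    refine ⟨fun hγ => ⟨γ, hγ, rfl⟩, ?_⟩
    rintro ⟨δ, hδ, e⟩
    change φ γ ∈ s
    rw [← h δ γ e]; exact hδ
  rw [this]
  exact (continuous_val R).isOpen_preimage _ (isOpen_discrete (α := Quotient (R.rel a b)) _)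

theorem exists_of_mem_open {U : Set (ProHom a b)} (hU : IsOpen U) {γ : ProHom a b} (hγ : γ ∈ U) :
    ∃ R : CompatRel C, ∀ δ : ProHom a b, δ.val R = γ.val R → δ ∈ U := by
  have key : ∀ V ∈ nhds γ, ∃ R : CompatRel C, ∀ δ : ProHom a b, δ.val R = γ.val R → δ ∈ V := by
    intro V hV
    rw [nhds_iInf] at hV
    obtain ⟨I, hI, W, hW, hW', rfl, -⟩ := Filter.mem_iInf'.mp hV
    -- A basic neighbourhood involves finitely many relations; their intersection dominates them
    -- all, and `CompatRel.top` serves the empty family.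
    have hR : ∀ S : Set (CompatRel C), S.Finite →
        ∃ R : CompatRel C, ∀ δ : ProHom a b, δ.val R = γ.val R → ∀ T ∈ S, δ.val T = γ.val T := by
      intro S hS
      induction S, hS using Set.Finite.induction_on with
      | empty => exact ⟨CompatRel.top C, by simp⟩
      | @insert T S _ _ ih =>
        obtain ⟨R, hR⟩ := ih
        refine ⟨R.inf T, fun δ hδ T' hT' => ?_⟩
        rcases hT' with rfl | hT'
        · exact val_congr_of_le (R.inf_le_right T') hδ
        · exact hR δ (val_congr_of_le (R.inf_le_left T) hδ) T' hT'
    obtain ⟨R, hR⟩ := hR I hI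
    refine ⟨R, fun δ hδ => Set.mem_iInter₂.mpr fun T hT => ?_⟩
    have hWT := hW T
    let _ : TopologicalSpace (Quotient (T.rel a b)) := ⊥
    rw [nhds_induced] at hWT
    obtain ⟨Z, hZ, hZ'⟩ := hWT
    refine hZ' ?_
    change δ.val T ∈ Z
    rw [hR δ hδ T hT]
    exact mem_of_mem_nhds hZ
  exact key U (hU.mem_nhds hγ)

end ProHom

/-! ### Completed parenthesized braids -/

theorem relOf_mono {n : ℕ} {L M : Subgroup (Braid n)} [L.Normal] [L.FiniteIndex] [M.Normal]
    [M.FiniteIndex] (h : L ≤ M) : (relOf L).Le (relOf M) := fun _ _ _ _ e =>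
  QuotientGroup.leftRel_apply.mpr (h (QuotientGroup.leftRel_apply.mp e))

/-- The loops at a related to the identity form a subgroup of the pure braids, and its cosets are
classes of loops, of which there are finitely many. -/
theorem exists_subgroup_of_compatRel {n : ℕ} (R : CompatRel (PaB n)) (a : PaB n) :
    ∃ N : Subgroup (Braid n), N.FiniteIndex ∧
      ∀ g ∈ N, ∃ h : rho n g = a.perm⁻¹ * a.perm, R.rel a a (PaB.ofBraid g h) (𝟙 a) := by
  have hr : ∀ g : PB n, rho n g.1 = a.perm⁻¹ * a.perm := fun g => by
    rw [inv_mul_cancel]; exact g.2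
  let N' : Subgroup (PB n) :=
    { carrier := {g | R.rel a a (PaB.ofBraid g.1 (hr g)) (𝟙 a)}
      mul_mem' := fun {g h} hg hh => by
        have := R.comp hh hg
        rw [Category.comp_id] at this
        exact this
      one_mem' := (R.rel a a).refl' _
      inv_mem' := fun {g} hg => by
        have := R.comp ((R.rel a a).refl' (Groupoid.inv (PaB.ofBraid g.1 (hr g)))) hg
        rw [Groupoid.inv_comp, Category.comp_id] at this
        exact (R.rel a a).symm' this }
  have hN' : ∀ g h : PB n, g⁻¹ * h ∈ N' ↔
      R.rel a a (PaB.ofBraid g.1 (hr g)) (PaB.ofBraid h.1 (hr h)) := by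
    intro g h
    constructor
    · intro e
      have := R.comp e ((R.rel a a).refl' (PaB.ofBraid g.1 (hr g)))
      rw [Category.id_comp] at this
      have e2 : (PaB.ofBraid (g⁻¹ * h).1 (hr _) : a ⟶ a) ≫ PaB.ofBraid g.1 (hr g) =
          PaB.ofBraid h.1 (hr h) := Subtype.ext (by
        change g.1 * (g.1⁻¹ * h.1) = h.1
        group)
      rw [e2] at this
      exact (R.rel a a).symm' this
    · intro e
      have := R.comp e ((R.rel a a).refl' (Groupoid.inv (PaB.ofBraid g.1 (hr g))))
      rw [Groupoid.comp_inv] at this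
      exact (R.rel a a).symm' this
  have hfin : Finite (PB n ⧸ N') := by
    have := R.finite a a
    refine Finite.of_injective (β := Quotient (R.rel a a)) (Quotient.map
      (fun g : PB n => (PaB.ofBraid g.1 (hr g) : a ⟶ a)) fun g h e => (hN' g h).mp ?_) ?_
    · exact QuotientGroup.leftRel_apply.mp e
    · rintro ⟨g⟩ ⟨h⟩ e
      exact QuotientGroup.eq.mpr ((hN' g h).mpr (Quotient.exact (s := R.rel a a) e))
  refine ⟨N'.map (PB n).subtype, ⟨?_⟩, ?_⟩
  · rw [Subgroup.index_map_subtype]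
    exact mul_ne_zero (Subgroup.finiteIndex_of_finite_quotient (H := N')).index_ne_zero
      (PB_finiteIndex n).index_ne_zero
  · rintro _ ⟨g, hg, rfl⟩
    exact ⟨hr g, hg⟩

/-- A compatible relation is controlled by the loops at one object for each permutation, because
objects with the same permutation are joined by the unit braid. There are finitely many
permutations, so a single `core n j` lies in all the subgroups concerned. -/
theorem exists_relOf_le {n : ℕ} (R : CompatRel (PaB n)) :
    ∃ j₀, ∀ j, j₀ ≤ j → (relOf (core n j)).Le R := by
  -- There are no objects of arity 0, and `comb (n - 1)` would have the wrong size.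
  by_cases hn : n = 0
  · exact ⟨0, fun j _ a => absurd a.size_eq (by have := a.shape.size_pos; omega)⟩
  let o : Equiv.Perm (Fin n) → PaB n := fun π => ⟨comb (n - 1), by rw [size_comb]; omega, π⟩
  choose N hfi hN using fun π => exists_subgroup_of_compatRel R (o π)
  have : (⨅ π, N π).FiniteIndex := Subgroup.finiteIndex_iInf hfi
  obtain ⟨j₀, hj₀⟩ := exists_core_le (⨅ π, N π)
  refine ⟨j₀, fun j hj x y f g e => ?_⟩
  have e1 : f.1⁻¹ * g.1 ∈ core n j := QuotientGroup.leftRel_apply.mp e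
  obtain ⟨hr, h⟩ := hN x.perm _ (Subgroup.mem_iInf.mp (hj₀ j hj e1) x.perm)
  -- The loop at the comb is carried to x by the unit braid and then composed with f; the result is
  -- g.
  let i : x ⟶ o x.perm := PaB.ofBraid 1 (by simp [o])
  have := R.comp (R.comp ((R.rel _ _).refl' i) h) ((R.rel _ _).refl' (Groupoid.inv i ≫ f))
  have e2 : (i ≫ PaB.ofBraid (f.1⁻¹ * g.1) hr) ≫ Groupoid.inv i ≫ f = g := Subtype.ext (by
    change f.1 * 1⁻¹ * (f.1⁻¹ * g.1 * 1) = g.1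
    group)
  have e3 : (i ≫ 𝟙 _) ≫ Groupoid.inv i ≫ f = f := by
    rw [Category.comp_id, ← Category.assoc, Groupoid.comp_inv, Category.id_comp]
  rw [e2, e3] at this
  exact (R.rel x y).symm' this

namespace ProHom

variable {n k : ℕ} {a b c : PaB n} {L M : Subgroup (Braid n)} [L.Normal] [L.FiniteIndex]
  [M.Normal] [M.FiniteIndex]

/-- The braid of a morphism of the completion, modulo a normal subgroup of finite index. -/
def md (M : Subgroup (Braid n)) [M.Normal] [M.FiniteIndex] (γ : ProHom a b) : Braid n ⧸ M :=
  Quotient.map (fun g : a ⟶ b => g.1) (fun _ _ h => h) (γ.val (relOf M))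

theorem md_eq {γ : ProHom a b} {g : a ⟶ b} (h : γ.val (relOf M) = ⟦g⟧) : γ.md M = g.1 := by
  rw [md, h]; rfl

theorem val_eq_of_md {γ : ProHom a b} {g : a ⟶ b} (h : γ.md M = g.1) :
    γ.val (relOf M) = ⟦g⟧ := by
  obtain ⟨g', hg'⟩ := Quotient.exists_rep (γ.val (relOf M))
  rw [md_eq hg'.symm] at h
  rw [← hg']
  exact Quotient.sound (QuotientGroup.leftRel_apply.mpr (QuotientGroup.eq.mp h))

theorem md_of (g : a ⟶ b) : (of g).md M = g.1 := rfl

theorem exists_md (γ : ProHom a b) (R : CompatRel (PaB n)) (M : Subgroup (Braid n)) [M.Normal]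
    [M.FiniteIndex] : ∃ g : a ⟶ b, γ.val R = ⟦g⟧ ∧ γ.md M = g.1 := by
  obtain ⟨g, h1, h2⟩ := γ.exists_rep R (relOf M)
  exact ⟨g, h1, md_eq h2⟩

theorem val_eq_iff {γ δ : ProHom a b} :
    γ.val (relOf M) = δ.val (relOf M) ↔ γ.md M = δ.md M := by
  refine ⟨fun h => by rw [md, h]; rfl, fun h => ?_⟩
  obtain ⟨g, hg⟩ := Quotient.exists_rep (δ.val (relOf M))
  rw [md_eq hg.symm] at h
  rw [val_eq_of_md h, hg]

theorem md_of_le {γ : ProHom a b} (h : L ≤ M) {x : Braid n} (hx : γ.md L = x) : γ.md M = x := by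
  obtain ⟨g, h1, h2⟩ := γ.exists_md (relOf L) L
  rw [md_eq (val_eq_of_le (relOf_mono h) h1)]
  rw [h2] at hx
  exact QuotientGroup.eq.mpr (h (QuotientGroup.eq.mp hx))

theorem md_comp (γ : ProHom a b) (η : ProHom b c) : (γ.comp η).md M = η.md M * γ.md M := by
  obtain ⟨g, h1, h2⟩ := γ.exists_md (relOf M) M
  obtain ⟨g', h1', h2'⟩ := η.exists_md (relOf M) M
  rw [md_eq (comp_val h1 h1'), h2, h2']; rfl

theorem rhoQ_md (hM : M ≤ PB n) (γ : ProHom a b) : rhoQ hM (γ.md M) = b.perm⁻¹ * a.perm := by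
  obtain ⟨g, h1, h2⟩ := γ.exists_md (relOf M) M
  rw [h2]; exact g.2

/-- A single morphism g represents γ modulo L and at the same time determines its image modulo M, so
statements about the completion become statements about braids. -/
theorem exists_md_map (γ : ProHom a b) (F : PaB n ⥤ PaB k) (M : Subgroup (Braid k)) [M.Normal]
    [M.FiniteIndex] (L : Subgroup (Braid n)) [L.Normal] [L.FiniteIndex] :
    ∃ g : a ⟶ b, (γ.map F).md M = (F.map g).1 ∧ γ.md L = g.1 := by
  obtain ⟨g, h1, h2⟩ := γ.exists_md ((relOf M).pullback F) L
  exact ⟨g, md_eq (map_val F h1), h2⟩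

theorem md_act (γ : ProHom a b) (θ : Equiv.Perm (Fin n)) :
    (γ.map (PaB.act θ)).md M = γ.md M := by
  obtain ⟨g, h1, h2⟩ := γ.exists_md_map (PaB.act θ) M M
  rw [h1, h2]; rfl

theorem ext_md {γ δ : ProHom a b} (h : ∀ j, γ.md (core n j) = δ.md (core n j)) : γ = δ := by
  refine ext_val fun R => ?_
  obtain ⟨j, hj⟩ := exists_relOf_le R
  exact val_congr_of_le (hj j le_rfl) (val_eq_iff.mpr (h j))

theorem continuous_of_md {a' b' : PaB k} {φ : ProHom a b → ProHom a' b'}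
    (h : ∀ j, ∃ i, ∀ γ δ : ProHom a b, γ.md (core n i) = δ.md (core n i) →
      (φ γ).md (core k j) = (φ δ).md (core k j)) : Continuous φ := by
  refine continuous_of_val fun R => ?_
  obtain ⟨j, hj⟩ := exists_relOf_le R
  obtain ⟨i, hi⟩ := h j
  exact continuous_of_factors (R := relOf (core n i)) fun γ δ e =>
    val_congr_of_le (hj j le_rfl) (val_eq_iff.mpr (hi γ δ (val_eq_iff.mp e)))

theorem exists_md_of_open {U : Set (ProHom a b)} (hU : IsOpen U) {γ : ProHom a b} (hγ : γ ∈ U) :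
    ∃ g : a ⟶ b, of g ∈ U := by
  obtain ⟨R, hR⟩ := exists_of_mem_open hU hγ
  obtain ⟨g, hg⟩ := Quotient.exists_rep (γ.val R)
  exact ⟨g, hR _ hg⟩

theorem isOpen_md (x : Braid n ⧸ M) : IsOpen {γ : ProHom a b | γ.md M = x} := by
  let _ : TopologicalSpace (Braid n ⧸ M) := ⊥
  have : DiscreteTopology (Braid n ⧸ M) := ⟨rfl⟩
  have h : Continuous (fun γ : ProHom a b => γ.md M) :=
    continuous_of_factors (R := relOf M) fun γ δ e => val_eq_iff.mp e
  exact (isOpen_discrete {x}).preimage h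

/-- By cofinality, compatible classes modulo all `core n j` with the right permutation form a
morphism of the completion. -/
theorem exists_ofCore (v : ∀ j, Braid n ⧸ core n j)
    (hc : ∀ i j, i ≤ j → ∀ x : Braid n, (x : Braid n ⧸ core n j) = v j →
      (x : Braid n ⧸ core n i) = v i)
    (hr : ∀ j, rhoQ (core_le_PB n j) (v j) = b.perm⁻¹ * a.perm) :
    ∃ γ : ProHom a b, ∀ j, γ.md (core n j) = v j := by
  have hg : ∀ j, ∃ g : a ⟶ b, (g.1 : Braid n ⧸ core n j) = v j := fun j => by
    obtain ⟨x, hx⟩ := QuotientGroup.mk_surjective (v j)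
    exact ⟨⟨x, by rw [← hr j, ← hx]; rfl⟩, hx⟩
  choose g hg using hg
  -- The value at R is read off at a level l R from which on the relations of `core n j` are finer
  -- than R; a higher level gives the same class.
  choose l hl using fun R : CompatRel (PaB n) => exists_relOf_le R
  have hgr : ∀ i j, i ≤ j → (relOf (core n i)).rel a b (g j) (g i) := fun i j hij =>
    QuotientGroup.leftRel_apply.mpr (QuotientGroup.eq.mp ((hc i j hij _ (hg j)).trans (hg i).symm))
  have key : ∀ R j, l R ≤ j → (⟦g j⟧ : Quotient (R.rel a b)) = ⟦g (l R)⟧ := fun R j hj =>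
    Quotient.sound (hl R (l R) le_rfl _ _ _ _ (hgr _ _ hj))
  refine ⟨⟨fun R => ⟦g (l R)⟧, fun R S h => ?_⟩, fun j => ?_⟩
  · rw [← key R (max (l R) (l S)) (le_max_left _ _), ← key S (max (l R) (l S)) (le_max_right _ _)]
    rfl
  · refine (md_eq (g := g j) ?_).trans (hg j)
    change (⟦g (l (relOf (core n j)))⟧ : Quotient ((relOf (core n j)).rel a b)) = ⟦g j⟧
    rw [← key _ (max (l (relOf (core n j))) j) (le_max_left _ _)]
    exact Quotient.sound (hgr _ _ (le_max_right _ _))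

end ProHom

end GTSh

namespace GTSh

open CategoryTheory Braid Paren Filter

/-! ### Compatible sequences of pairs -/

theorem pull_mono {N : ℕ} {L M : Subgroup (Braid N)} (h : L ≤ M) (n : ℕ) : pull L n ≤ pull M n :=
  fun _ hg => ⟨hg.1, fun p w => h (hg.2 p w)⟩

theorem Good.mono {N : ℕ} {L M : Subgroup (Braid N)} {m : ℤ} {f : PB 3} (hLM : L ≤ M) (h : Good L m f) : Good M m f :=
  IsPairMod.mono (pull_mono hLM 3) (pull_mono hLM 4) h

section

variable {N : ℕ} {f f' : PB 3} {m m' : ℤ} {L M : Subgroup (Braid N)} [L.Normal] [M.Normal]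

theorem FF_mk_congr (hf : (f.1 : Braid 3 ⧸ pull M 3) = f'.1) (q a b c : ℕ) :
    (FF N f q a b c : Braid N ⧸ M) = FF N f' q a b c := cab_mk_eq _ hf

theorem combNode_mk_congr (hf : (f.1 : Braid 3 ⧸ pull M 3) = f'.1) : ∀ (a : ℕ) (t : Paren),
    (combNode N f a t : Braid N ⧸ M) = combNode N f' a t
  | _, leaf => rfl
  | a, node l r => by
    have h1 := FF_mk_congr (M := M) hf 0 a l.size r.size
    have h2 := combNode_mk_congr hf a l
    have h3 := combNode_mk_congr hf (a + l.size) r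
    simp only [combNode, QuotientGroup.mk_mul, h1, h2, h3]

theorem combTo_mk_congr (hf : (f.1 : Braid 3 ⧸ pull M 3) = f'.1) : ∀ t : Paren,
    (combTo N f t : Braid N ⧸ M) = combTo N f' t
  | leaf => rfl
  | node l r => by
    have h2 := combTo_mk_congr hf l
    have h3 := combNode_mk_congr hf l.size r
    simp only [combTo, QuotientGroup.mk_mul, h2, h3]

theorem Good.tw_congr (h : Good M m f) (h' : Good M m' f')
    (hf : (f.1 : Braid 3 ⧸ pull M 3) = f'.1)
    (hm : (bp 3 m 0 : Braid 3 ⧸ pull M 3) = bp 3 m' 0) (t t' : Paren) (g : Braid N) :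
    tw M m f t t' g = tw M m' f' t t' g := by
  have e : twComb M m f = twComb M m' f' := hom_ext fun i hi => by
    have h1 : (bp N m i : Braid N ⧸ M) = bp N m' i := by
      rw [← cab_sz3_bp_zero m hi, ← cab_sz3_bp_zero m' hi]
      exact cab_mk_eq _ hm
    have h2 : (nbr N f i : Braid N ⧸ M) = nbr N f' i := by
      unfold nbr
      split_ifs
      · rfl
      · exact FF_mk_congr hf _ _ _ _
    rw [h.twComb_sg hi, h'.twComb_sg hi]
    simp only [twGen, QuotientGroup.mk_mul, QuotientGroup.mk_inv, h1, h2]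
  rw [tw, tw, e, combTo_mk_congr hf, combTo_mk_congr hf]

theorem Good.tw_of_le (hLM : L ≤ M) (h : Good L m f) {t t' : Paren} {g y : Braid N}
    (hy : (y : Braid N ⧸ L) = tw L m f t t' g) : (y : Braid N ⧸ M) = tw M m f t t' g := by
  have e : (QuotientGroup.map L M (MonoidHom.id _) hLM).comp (twComb L m f) = twComb M m f :=
    hom_ext fun i hi => by
      rw [MonoidHom.comp_apply, h.twComb_sg hi, (h.mono hLM).twComb_sg hi]; rfl
  have := congrArg (QuotientGroup.map L M (MonoidHom.id _) hLM) hy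
  rw [tw, map_mul, map_mul, map_inv] at this
  rw [tw, ← e]
  exact this

end

/-- A sequence of pairs that converges in the profinite completion, and whose limit satisfies the
hexagon and the pentagon relations and generates enough. -/
structure IsPairSeq (m : ℕ → ℤ) (f : ℕ → PB 3) : Prop where
  pair : ∀ (A : Subgroup (Braid 3)) [A.Normal] [A.FiniteIndex] (C : Subgroup (Braid 4)) [C.Normal]
    [C.FiniteIndex], ∀ᶠ j in atTop, IsPairMod A C (m j) (f j)
  cauchy_f : ∀ (A : Subgroup (Braid 3)) [A.Normal] [A.FiniteIndex], ∃ x : Braid 3,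
    ∀ᶠ j in atTop, ((f j).1 : Braid 3 ⧸ A) = x
  cauchy_m : ∀ (A : Subgroup (Braid 3)) [A.Normal] [A.FiniteIndex], ∃ x : Braid 3,
    ∀ᶠ j in atTop, (bp 3 (m j) 0 : Braid 3 ⧸ A) = x
  gen_sq : ∀ (A : Subgroup (Braid 3)) [A.Normal] [A.FiniteIndex], ∀ᶠ j in atTop,
    sg 3 0 ^ 2 ∈ Subgroup.zpowers ((sg 3 0 ^ 2) ^ (2 * m j + 1)) ⊔ A
  gen_f : ∀ (A : Subgroup (Braid 3)) [A.Normal] [A.FiniteIndex], ∀ᶠ j in atTop,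
    (f j).1 ∈ Subgroup.closure {(sg 3 0 ^ 2) ^ (2 * m j + 1),
      (f j).1⁻¹ * (sg 3 1 ^ 2) ^ (2 * m j + 1) * (f j).1} ⊔ A

namespace IsPairSeq

variable {m : ℕ → ℤ} {f : ℕ → PB 3} (S : IsPairSeq m f) {n k : ℕ}

/-- Finitely many conditions that hold eventually hold at a common index i. From then on the twist
modulo M is constant, since it depends only on the classes of f and of the twisted generator modulo
`pull M 3`. -/
theorem exists_index (S : IsPairSeq m f) (M : Subgroup (Braid n)) [M.Normal] [M.FiniteIndex] :
    ∃ i, Good M (m i) (f i) ∧ (twComb M (m i) (f i)).range = ⊤ ∧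
      ∀ᶠ j in atTop, Good M (m j) (f j) ∧
        ∀ t t' g, tw M (m j) (f j) t t' g = tw M (m i) (f i) t t' g := by
  obtain ⟨x, hx⟩ := S.cauchy_f (pull M 3)
  obtain ⟨y, hy⟩ := S.cauchy_m (pull M 3)
  have hG := S.pair (pull M 3) (pull M 4)
  obtain ⟨i, ⟨⟨⟨hx', hy'⟩, hG'⟩, h1⟩, h2⟩ :=
    ((((hx.and hy).and hG).and (S.gen_sq (pull M 3))).and (S.gen_f (pull M 3))).exists
  refine ⟨i, hG', Good.range_twComb hG' h1 h2, ?_⟩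
  filter_upwards [hx, hy, hG] with j hxj hyj hGj
  exact ⟨hGj, Good.tw_congr hGj hG' (hxj.trans hx'.symm) (hyj.trans hy'.symm)⟩

/-- An index from which on the twists modulo `M` do not change. -/
noncomputable def idx (M : Subgroup (Braid n)) [M.Normal] [M.FiniteIndex] : ℕ :=
  (S.exists_index M).choose

/-- The twist by the limit of the sequence, modulo `M`. -/
noncomputable def limTw (M : Subgroup (Braid n)) [M.Normal] [M.FiniteIndex] (t t' : Paren)
    (g : Braid n) : Braid n ⧸ M := tw M (m (S.idx M)) (f (S.idx M)) t t' g

variable {L M : Subgroup (Braid n)} [L.Normal] [L.FiniteIndex] [M.Normal] [M.FiniteIndex]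

theorem good_idx : Good M (m (S.idx M)) (f (S.idx M)) := (S.exists_index M).choose_spec.1

theorem eventually_tw (M : Subgroup (Braid n)) [M.Normal] [M.FiniteIndex] :
    ∀ᶠ j in atTop, Good M (m j) (f j) ∧ ∀ t t' g, tw M (m j) (f j) t t' g = S.limTw M t t' g :=
  (S.exists_index M).choose_spec.2.2

theorem limTw_mul (t t' t'' : Paren) (g g' : Braid n) :
    S.limTw M t t'' (g' * g) = S.limTw M t' t'' g' * S.limTw M t t' g := tw_mul _ _ _ _ _

theorem limTw_surjective (t t' : Paren) : Function.Surjective (S.limTw M t t') := fun x => by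
  have h := (S.exists_index M).choose_spec.2.1
  let F := f (S.idx M)
  obtain ⟨g, hg⟩ : (combTo n F t' : Braid n ⧸ M)⁻¹ * x * (combTo n F t : Braid n ⧸ M) ∈
      (twComb M (m (S.idx M)) F).range := by
    rw [show (twComb M (m (S.idx M)) F).range = ⊤ from h]; trivial
  refine ⟨g, ?_⟩
  change (combTo n F t' : Braid n ⧸ M) * twComb M (m (S.idx M)) F g *
    (combTo n F t : Braid n ⧸ M)⁻¹ = x
  rw [hg]; group

theorem limTw_of_le (hLM : L ≤ M) {t t' : Paren} {g y : Braid n}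
    (hy : (y : Braid n ⧸ L) = S.limTw L t t' g) : (y : Braid n ⧸ M) = S.limTw M t t' g := by
  obtain ⟨j, ⟨hL, hL'⟩, -, hM'⟩ := ((S.eventually_tw L).and (S.eventually_tw M)).exists
  rw [← hM']
  exact hL.tw_of_le hLM (by rw [hL', hy])

theorem rhoQ_limTw (hM : M ≤ PB n) (t t' : Paren) (g : Braid n) :
    rhoQ hM (S.limTw M t t' g) = rho n g := S.good_idx.rhoQ_tw hM t t' g

/-- `core n j` is killed by every homomorphism to the quotient by it, so the twist descends. -/
theorem limTw_congr {j : ℕ} (t t' : Paren) {g g' : Braid n}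
    (h : (g : Braid n ⧸ core n j) = g') :
    S.limTw (core n j) t t' g = S.limTw (core n j) t t' g' := by
  have e := core_invariant (twComb (core n j) (m (S.idx (core n j))) (f (S.idx (core n j))))
    (QuotientGroup.eq.mp h)
  rw [map_mul, map_inv, inv_mul_eq_one] at e
  rw [limTw, limTw, tw, tw, e]

/-- The twist by the limit of the sequence, as a map on `B_n` modulo `core n j`. -/
noncomputable def limQ (j : ℕ) (t t' : Paren) (x : Braid n ⧸ core n j) : Braid n ⧸ core n j :=
  S.limTw (core n j) t t' (Quotient.out x)

theorem limQ_mk {j : ℕ} (t t' : Paren) (g : Braid n) :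
    S.limQ j t t' (g : Braid n ⧸ core n j) = S.limTw (core n j) t t' g :=
  S.limTw_congr t t' (Quotient.out_eq _)

/-- A surjection of a finite set to itself is a bijection; the inverse automorphism therefore comes
without constructing an inverse pair. -/
theorem limQ_bijective (j : ℕ) (t t' : Paren) :
    Function.Bijective (S.limQ (n := n) j t t') := by
  have : Finite (Braid n ⧸ core n j) := Subgroup.finite_quotient_of_finiteIndex
  refine Finite.surjective_iff_bijective.mp fun x => ?_
  obtain ⟨g, hg⟩ := S.limTw_surjective t t' x
  exact ⟨g, by rw [limQ_mk, hg]⟩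

theorem limQ_of_le {i j : ℕ} (hij : i ≤ j) {t t' : Paren} {x y : Braid n}
    (h : (y : Braid n ⧸ core n j) = S.limQ j t t' x) :
    (y : Braid n ⧸ core n i) = S.limQ i t t' x := by
  rw [limQ_mk] at *
  exact S.limTw_of_le (core_anti hij) h

theorem rhoQ_limQ (j : ℕ) (t t' : Paren) (x : Braid n ⧸ core n j) :
    rhoQ (core_le_PB n j) (S.limQ j t t' x) = rhoQ (core_le_PB n j) x := by
  obtain ⟨g, rfl⟩ := QuotientGroup.mk_surjective x
  rw [limQ_mk]
  exact S.rhoQ_limTw _ t t' g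

theorem limQ_mul (j : ℕ) (t t' t'' : Paren) (x y : Braid n ⧸ core n j) :
    S.limQ j t t'' (y * x) = S.limQ j t' t'' y * S.limQ j t t' x := by
  obtain ⟨g, rfl⟩ := QuotientGroup.mk_surjective x
  obtain ⟨h, rfl⟩ := QuotientGroup.mk_surjective y
  rw [limQ_mk, limQ_mk, ← limTw_mul, ← limQ_mk]; rfl

theorem limTw_blockShift {M : Subgroup (Braid (n + k))} [M.Normal] [M.FiniteIndex]
    {L : Subgroup (Braid (k + 1))} [L.Normal] [L.FiniteIndex] (p : Fin n)
    (hLM : L ≤ M.comap (blockShift k p)) {s : Paren} (hs : s.size = n) {t t' : Paren}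
    (ht : t.size = k + 1) (ht' : t'.size = k + 1) (g : Braid (k + 1)) :
    QuotientGroup.map L M (blockShift k p) hLM (S.limTw L t t' g) =
      S.limTw M (graft t s p) (graft t' s p) (blockShift k p g) := by
  obtain ⟨j, ⟨hL, hL'⟩, hM, hM'⟩ := ((S.eventually_tw L).and (S.eventually_tw M)).exists
  rw [← hM', ← hL']
  exact Good.tw_blockShift hM hL p hLM hs ht ht' g

theorem limTw_cable {M : Subgroup (Braid (n + k))} [M.Normal] [M.FiniteIndex]
    {L : Subgroup (Braid n)} [L.Normal] [L.FiniteIndex] (hLP : L ≤ PB n)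
    (hLM : ∀ p : Fin n, ∀ x ∈ L, cable k p x ∈ M) {u : Paren} (hu : u.size = k + 1) {t t' : Paren}
    (ht : t.size = n) (ht' : t'.size = n) (g : Braid n) (p : Fin n) (y : Braid n)
    (hy : (y : Braid n ⧸ L) = S.limTw L t t' g) :
    (cable k p y : Braid (n + k) ⧸ M) =
      S.limTw M (graft u t p) (graft u t' (rho n g p)) (cable k p g) := by
  obtain ⟨j, ⟨hL, hL'⟩, hM, hM'⟩ := ((S.eventually_tw L).and (S.eventually_tw M)).exists
  rw [← hM']
  exact Good.tw_cable hM hL hLP hLM hu ht ht' g p y (by rw [hL', hy])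

/-! ### The automorphism of the completed operad -/

variable {a b c : PaB n}

theorem exists_lim (γ : ProHom a b) :
    ∃ δ : ProHom a b, ∀ j, δ.md (core n j) = S.limQ j a.shape b.shape (γ.md (core n j)) := by
  refine ProHom.exists_ofCore _ (fun i j hij x hx => ?_) fun j => ?_
  · obtain ⟨y, hy⟩ := QuotientGroup.mk_surjective (γ.md (core n j))
    rw [ProHom.md_of_le (core_anti hij) hy.symm]
    exact S.limQ_of_le hij (hx.trans (by rw [hy]))
  · rw [rhoQ_limQ, ProHom.rhoQ_md]

theorem exists_lim_inv (δ : ProHom a b) :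
    ∃ γ : ProHom a b, ∀ j, S.limQ j a.shape b.shape (γ.md (core n j)) = δ.md (core n j) := by
  choose v hv using fun j => (S.limQ_bijective (n := n) j a.shape b.shape).2 (δ.md (core n j))
  suffices h : ∃ γ : ProHom a b, ∀ j, γ.md (core n j) = v j by
    obtain ⟨γ, hγ⟩ := h
    exact ⟨γ, fun j => by rw [hγ, hv]⟩
  refine ProHom.exists_ofCore v (fun i j hij x hx => ?_) fun j => ?_
  · obtain ⟨y, hy⟩ := QuotientGroup.mk_surjective (δ.md (core n j))
    refine (S.limQ_bijective i a.shape b.shape).1 ?_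
    rw [hv, ProHom.md_of_le (core_anti hij) hy.symm]
    exact (S.limQ_of_le hij (hy.trans (by rw [hx, hv]))).symm
  · rw [← S.rhoQ_limQ j a.shape b.shape, hv, ProHom.rhoQ_md]

/-- The twist of the morphisms of the completion by the limit of the sequence. -/
noncomputable def homeo (a b : PaB n) : ProHom a b ≃ₜ ProHom a b where
  toFun γ := (S.exists_lim γ).choose
  invFun δ := (S.exists_lim_inv δ).choose
  left_inv γ := ProHom.ext_md fun j => (S.limQ_bijective j a.shape b.shape).1 (by
    rw [(S.exists_lim_inv _).choose_spec j, (S.exists_lim γ).choose_spec j])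
  right_inv δ := ProHom.ext_md fun j => by
    rw [(S.exists_lim _).choose_spec j, (S.exists_lim_inv _).choose_spec j]
  -- The image modulo `core n j` depends only on the argument modulo the same subgroup, and by
  -- injectivity of `limQ` so it is for the inverse.
  continuous_toFun := ProHom.continuous_of_md fun j => ⟨j, fun γ δ h => by
    rw [(S.exists_lim γ).choose_spec j, (S.exists_lim δ).choose_spec j, h]⟩
  continuous_invFun := ProHom.continuous_of_md fun j => ⟨j, fun γ δ h =>
    (S.limQ_bijective j a.shape b.shape).1 (by
      rw [(S.exists_lim_inv γ).choose_spec j, (S.exists_lim_inv δ).choose_spec j, h])⟩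

theorem md_homeo (γ : ProHom a b) (j : ℕ) :
    (S.homeo a b γ).md (core n j) = S.limQ j a.shape b.shape (γ.md (core n j)) :=
  (S.exists_lim γ).choose_spec j

theorem md_homeo_of_md {γ : ProHom a b} {j : ℕ} {g : Braid n} (h : γ.md (core n j) = g) :
    (S.homeo a b γ).md (core n j) = S.limTw (core n j) a.shape b.shape g := by
  rw [md_homeo, h, limQ_mk]

/-- An arbitrary M contains some `core n j`, where the value is known by construction. -/
theorem md_homeo_of (g : a ⟶ b) : (S.homeo a b (.of g)).md M = S.limTw M a.shape b.shape g.1 := by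
  obtain ⟨j, hj⟩ := exists_core_le M
  obtain ⟨y, hy⟩ := QuotientGroup.mk_surjective (S.limTw (core n j) a.shape b.shape g.1)
  rw [← S.limTw_of_le (hj j le_rfl) hy]
  exact ProHom.md_of_le (hj j le_rfl) ((S.md_homeo_of_md (ProHom.md_of g)).trans hy.symm)

theorem homeo_comp (γ : ProHom a b) (η : ProHom b c) :
    S.homeo a c (γ.comp η) = (S.homeo a b γ).comp (S.homeo b c η) :=
  ProHom.ext_md fun j => by
    rw [ProHom.md_comp, md_homeo, md_homeo, md_homeo, ProHom.md_comp,
      S.limQ_mul j a.shape b.shape c.shape]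

theorem homeo_insRight (i : Fin n) (a : PaB n) {b b' : PaB (k + 1)} (η : ProHom b b') :
    S.homeo _ _ (η.map (PaB.insRight i a)) = (S.homeo b b' η).map (PaB.insRight i a) := by
  refine ProHom.ext_md fun j => ?_
  have := finiteIndex_comap (blockShift k (a.pos i)) (core (n + k) j)
  obtain ⟨l, hl⟩ := exists_core_le ((core (n + k) j).comap (blockShift k (a.pos i)))
  have hl := hl l le_rfl
  obtain ⟨g, h1, h2⟩ := η.exists_md_map (PaB.insRight i a) (core (n + k) j) (core (k + 1) l)
  obtain ⟨h, h3, h4⟩ := (S.homeo b b' η).exists_md_map (PaB.insRight i a) (core (n + k) j)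
    (core (k + 1) l)
  rw [S.md_homeo_of_md h1, h3]
  rw [S.md_homeo_of_md h2] at h4
  have := S.limTw_blockShift (a.pos i) hl a.size_eq b.size_eq b'.size_eq g.1
  rw [h4] at this
  exact this.symm

theorem homeo_insLeft (i : Fin n) {a a' : PaB n} (b : PaB (k + 1)) (γ : ProHom a a') :
    S.homeo _ _ (γ.map (PaB.insLeft i b)) = (S.homeo a a' γ).map (PaB.insLeft i b) := by
  refine ProHom.ext_md fun j => ?_
  -- The level must be deep enough that the cablings of all strands at once respect the congruences,
  -- as the position of the cabled strand varies along a braid.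
  obtain ⟨l, hl⟩ := exists_core_le (pull (core (n + k) j) n)
  have hl := hl l le_rfl
  have hc : ∀ p : Fin n, ∀ x ∈ core n l, cable k p x ∈ core (n + k) j := fun p x hx => by
    rw [cable_eq_cab]; exact (hl hx).2 _ _
  obtain ⟨g, h1, h2⟩ := γ.exists_md_map (PaB.insLeft i b) (core (n + k) j) (core n l)
  obtain ⟨h, h3, h4⟩ := (S.homeo a a' γ).exists_md_map (PaB.insLeft i b) (core (n + k) j)
    (core n l)
  rw [S.md_homeo_of_md h1, h3]
  rw [S.md_homeo_of_md h2] at h4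
  have := S.limTw_cable (core_le_PB n l) hc b.size_eq a.size_eq a'.size_eq g.1 (a.pos i) h.1 h4.symm
  rw [PaB.rho_pos] at this
  exact this.symm

/-- The element of `GT^` given by a compatible sequence of pairs. -/
noncomputable def toGTHat : GTHat where
  toHomeo := S.homeo
  map_comp := S.homeo_comp
  -- Relabelling keeps shapes and braids, and the twist depends on nothing else.
  map_act θ γ := ProHom.ext_md fun j => by
    rw [md_homeo, ProHom.md_act, ProHom.md_act, md_homeo]; rfl
  map_ins i a _ _ b' γ η := (S.homeo_comp _ _).trans
    (congrArg₂ ProHom.comp (S.homeo_insRight i a η) (S.homeo_insLeft i b' γ))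

theorem val_beta (M : Subgroup (Braid 2)) [M.Normal] [M.FiniteIndex] : ∀ᶠ j in atTop,
    (S.toGTHat.toHomeo _ _ (.of (PaB.betaMor 0))).val (relOf M) = ⟦PaB.betaMor (m j)⟧ := by
  filter_upwards [S.eventually_tw M] with j hj
  refine ProHom.val_eq_of_md ((S.md_homeo_of _).trans ?_)
  rw [← hj.2]
  have h := hj.1.tw_gen (q := 0) (t := node leaf leaf) .here (by decide)
  have e : (PaB.betaMor 0).1 = sg 2 0 := by
    change sg 2 0 * (sg 2 0 ^ 2) ^ (0 : ℤ) = _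
    rw [zpow_zero, mul_one]
  rw [e]
  exact h

theorem val_alpha (M : Subgroup (Braid 3)) [M.Normal] [M.FiniteIndex] : ∀ᶠ j in atTop,
    (S.toGTHat.toHomeo _ _ (.of (PaB.alphaMor 1))).val (relOf M) = ⟦PaB.alphaMor (f j)⟧ := by
  filter_upwards [S.eventually_tw M] with j hj
  refine ProHom.val_eq_of_md ((S.md_homeo_of _).trans ?_)
  rw [← hj.2]
  have h := hj.1.tw_move (x := leaf) (y := leaf) (z := leaf) .here (by decide)
  refine h.trans ?_
  change (FF 3 (f j) 0 1 1 1 : Braid 3 ⧸ M) = _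
  rw [FF_one_one_one (by omega), shift_self]; rfl

end IsPairSeq

end GTSh

namespace GTSh

open CategoryTheory Braid Paren Filter

/-! ### The pure braid groups on two and three strands -/

theorem exists_zpow_sg_two (g : Braid 2) : ∃ k : ℤ, g = sg 2 0 ^ k := by
  induction g using Braid.induction with
  | one => exact ⟨0, by simp⟩
  | gen i hi =>
    obtain rfl : i = 0 := by omega
    exact ⟨1, by simp⟩
  | mul x y hx hy =>
    obtain ⟨a, rfl⟩ := hx
    obtain ⟨b, rfl⟩ := hy
    exact ⟨a + b, by rw [zpow_add]⟩
  | inv x hx =>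
    obtain ⟨a, rfl⟩ := hx
    exact ⟨-a, by simp⟩

theorem PB_two : PB 2 = Subgroup.zpowers (sg 2 0 ^ 2) := by
  refine le_antisymm (fun g hg => ?_) (Subgroup.zpowers_le.mpr (sq_mem_PB (by omega)))
  obtain ⟨k, rfl⟩ := exists_zpow_sg_two g
  obtain ⟨l, rfl | rfl⟩ := Int.even_or_odd' k
  · exact ⟨l, by simp only [← zpow_natCast, ← zpow_mul]; norm_num⟩
  · exfalso
    have h1 : (sg 2 0 ^ (2 * l) : Braid 2) ∈ PB 2 := by
      rw [zpow_mul]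
      exact zpow_mem (sq_mem_PB (n := 2) (j := 0) (by omega)) l
    rw [zpow_add, zpow_one, Subgroup.mul_mem_cancel_left _ h1] at hg
    have h2 : rho 2 (sg 2 0) = 1 := hg
    rw [rho_sg (by omega)] at h2
    exact absurd h2 (by decide)

theorem zpow_mem_sub2 (N : NFI) {k : ℤ} (h : (N.ord : ℤ) ∣ k) : (sg 2 0 ^ 2) ^ k ∈ N.sub2 := by
  obtain ⟨l, rfl⟩ := h
  let x : PB 2 := ⟨sg 2 0 ^ 2, sq_mem_PB (by omega)⟩
  have := (N.sub2.subgroupOf (PB 2)).pow_index_mem x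
  rw [zpow_mul]
  refine zpow_mem ?_ l
  rw [zpow_natCast]
  exact this

/-- PB_2 is cyclic, generated by x_12, so `N.ord` is the order of x_12 in the quotient by `N.sub2`.
-/
theorem ord_dvd_of_zpow_mem (N : NFI) {k : ℤ} (h : (sg 2 0 ^ 2) ^ k ∈ N.sub2) :
    (N.ord : ℤ) ∣ k := by
  let x : PB 2 := ⟨sg 2 0 ^ 2, sq_mem_PB (by omega)⟩
  let H := N.sub2.subgroupOf (PB 2)
  have hx : ∀ y : PB 2 ⧸ H, y ∈ Subgroup.zpowers (x : PB 2 ⧸ H) := by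
    rintro ⟨y, hy⟩
    rw [PB_two] at hy
    obtain ⟨l, hl⟩ := hy
    exact ⟨l, congrArg (QuotientGroup.mk' H) (Subtype.ext hl : x ^ l = _)⟩
  have h1 : orderOf (x : PB 2 ⧸ H) = N.ord := orderOf_eq_card_of_forall_mem_zpowers hx
  rw [← h1, orderOf_dvd_iff_zpow_eq_one]
  exact (QuotientGroup.eq_one_iff (N := H) (x ^ k)).mpr h

theorem zpow_mem_sub3 (N : NFI) {k : ℤ} (h : (sg 2 0 ^ 2) ^ k ∈ N.sub2) :
    (sg 3 0 ^ 2) ^ k ∈ N.sub3 := by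
  have := h.2.1
  rw [map_zpow, map_pow, shift_sg _ (by omega)] at this
  exact this

theorem ord_ne_zero (N : NFI) : N.ord ≠ 0 := by
  have : (N.sub2.subgroupOf (PB 2)).FiniteIndex := inferInstance
  exact this.index_ne_zero

/-- The retraction `B_4 → B_3`, `σ_1, σ_2, σ_3 ↦ σ_1, σ_2, σ_1`. -/
def retr : Braid 4 →* Braid 3 :=
  lift (fun i => if i = 1 then sg 3 1 else sg 3 0)
    { comm := fun i j h1 h2 => by
        obtain ⟨rfl, rfl⟩ : i = 0 ∧ j = 2 := by omega
        rfl
      braid := fun i hi => by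
        obtain rfl | rfl : i = 0 ∨ i = 1 := by omega
        · exact (isBraid_sg 3).braid 0 (by omega)
        · exact ((isBraid_sg 3).braid 0 (by omega)).symm }

/-- Since adding a strand on the right has a left inverse, a condition on g in B_3 can be imposed
through a subgroup of B_4. This makes the subgroups `sub3` cofinal in B_3. -/
theorem retr_shift (g : Braid 3) : retr (shift 0 (by omega) g) = g := by
  have : retr.comp (shift 0 (by omega)) = MonoidHom.id (Braid 3) := hom_ext fun i hi => by
    rw [MonoidHom.comp_apply, shift_sg _ hi, retr, lift_sg _ (by omega)]
    obtain rfl | rfl : i = 0 ∨ i = 1 := by omega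
    all_goals rfl
  exact congrArg (· g) this

/-! ### A cofinal sequence in the poset -/

/-- The intersection of `N` with `core 4 j`. -/
def NFI.infCore (N : NFI) (j : ℕ) : NFI where
  sub4 := N.sub4 ⊓ core 4 j
  normal := inferInstance
  finiteIndex := inferInstance
  le_PB := inf_le_left.trans N.le_PB

theorem NFI.infCore_le (N : NFI) (j : ℕ) : N.infCore j ≤ N :=
  (inf_le_left : N.sub4 ⊓ core 4 j ≤ N.sub4)

theorem NFI.infCore_anti (N : NFI) {i j : ℕ} (h : i ≤ j) : N.infCore j ≤ N.infCore i :=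
  (inf_le_inf_left N.sub4 (core_anti h) : N.sub4 ⊓ core 4 j ≤ N.sub4 ⊓ core 4 i)

theorem NFI.eventually_sub4 (N : NFI) (C : Subgroup (Braid 4)) [C.FiniteIndex] :
    ∀ᶠ j in atTop, (N.infCore j).sub4 ≤ C := by
  obtain ⟨j₀, h⟩ := exists_core_le C
  filter_upwards [eventually_ge_atTop j₀] with j hj
  exact inf_le_right.trans (h j hj)

theorem NFI.eventually_sub3 (N : NFI) (A : Subgroup (Braid 3)) [A.FiniteIndex] :
    ∀ᶠ j in atTop, (N.infCore j).sub3 ≤ A := by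
  have := finiteIndex_comap retr A
  filter_upwards [N.eventually_sub4 (A.comap retr)] with j hj g hg
  rw [← retr_shift g]
  exact hj hg.2.1

/-! ### Threads of charming shadows -/

theorem restrict_restrict {J K N : NFI} (h : J ≤ K) (h' : K ≤ N) (h'' : J ≤ N) (x : GTHeart J) :
    GTHeart.restrict h' (GTHeart.restrict h x) = GTHeart.restrict h'' x := by
  obtain ⟨_, m, f, hp, rfl, hc⟩ := x
  refine Subtype.ext ?_
  change reduce h' (reduce h (cls J m f)) = reduce h'' (cls J m f)
  rw [reduce_cls, reduce_cls, reduce_cls]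

theorem restrict_self {K : NFI} (h : K ≤ K) (x : GTHeart K) : GTHeart.restrict h x = x := by
  obtain ⟨_, m, f, hp, rfl, hc⟩ := x
  exact Subtype.ext (reduce_cls h m f)

instance (K : NFI) : Finite (PairSpace K) := by
  have : NeZero K.ord := ⟨ord_ne_zero K⟩
  have : Finite (PB 3 ⧸ K.sub3.subgroupOf (PB 3)) := Subgroup.finite_quotient_of_finiteIndex
  exact inferInstance

/-- Compactness: the lifts of q to the members of the chain form an inverse system of finite sets,
nonempty by hypothesis. -/
theorem exists_section {N : NFI} {q : GTHeart N}
    (hq : ∀ (K : NFI) (hKN : K ≤ N), q ∈ Set.range (GTHeart.restrict hKN)) :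
    ∃ x : ∀ j, GTHeart (N.infCore j), (∀ j, GTHeart.restrict (N.infCore_le j) (x j) = q) ∧
      ∀ i j (h : i ≤ j), GTHeart.restrict (N.infCore_anti h) (x j) = x i := by
  let F : ℕᵒᵖ ⥤ Type :=
    { obj := fun j => {x : GTHeart (N.infCore j.unop) // GTHeart.restrict (N.infCore_le _) x = q}
      map := fun {i j} h => TypeCat.ofHom fun x => ⟨GTHeart.restrict (N.infCore_anti h.unop.le) x.1, by
        rw [restrict_restrict _ _ (N.infCore_le _), x.2]⟩
      map_id := fun j => ConcreteCategory.hom_ext _ _ fun x => Subtype.ext (restrict_self _ x.1)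
      map_comp := fun h h' => ConcreteCategory.hom_ext _ _ fun x =>
        Subtype.ext (restrict_restrict _ _ _ x.1).symm }
  have h1 : ∀ j, Finite (F.obj j) := fun j => inferInstanceAs
    (Finite {x : GTHeart (N.infCore j.unop) // GTHeart.restrict (N.infCore_le _) x = q})
  have h2 : ∀ j, Nonempty (F.obj j) := fun j => by
    obtain ⟨x, hx⟩ := hq _ (N.infCore_le j.unop)
    exact ⟨⟨x, hx⟩⟩
  obtain ⟨s, hs⟩ := nonempty_sections_of_finite_inverse_system F
  refine ⟨fun j => (s (.op j)).1, fun j => (s (.op j)).2, fun i j h => ?_⟩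
  exact congrArg Subtype.val (hs (homOfLE h).op)

theorem cls_eq_iff {K : NFI} {m m' : ℤ} {f f' : PB 3} : cls K m f = cls K m' f' ↔
    (sg 2 0 ^ 2) ^ (m' - m) ∈ K.sub2 ∧ (f.1 : Braid 3 ⧸ K.sub3) = f'.1 := by
  rw [cls, cls, Prod.mk.injEq, ZMod.intCast_eq_intCast_iff_dvd_sub, QuotientGroup.eq,
    QuotientGroup.eq]
  exact and_congr ⟨zpow_mem_sub2 K, ord_dvd_of_zpow_mem K⟩ Iff.rfl

theorem mem_sup_of_mk {G : Type*} [Group G] {A H : Subgroup G} [A.Normal] {x : G}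
    (h : (x : G ⧸ A) ∈ H.map (QuotientGroup.mk' A)) : x ∈ H ⊔ A := by
  rw [sup_comm, ← QuotientGroup.comap_map_mk']
  exact h

/-! ### Generation properties of charming pairs -/

namespace IsGTPair

variable {K : NFI} {m : ℤ} {f : PB 3} (h : IsGTPair K m f)

theorem T3_sg_zero : h.T3 (sg 3 0) = bp 3 m 0 := lift_sg _ (by omega)

theorem T3_sg_one : h.T3 (sg 3 1) = (f.1⁻¹ * bp 3 m 1 * f.1 : Braid 3) := lift_sg _ (by omega)

theorem T3_sq_zero : h.T3 (sg 3 0 ^ 2) = ((sg 3 0 ^ 2) ^ (2 * m + 1) : Braid 3) := by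
  rw [map_pow, T3_sg_zero, pow_two, ← QuotientGroup.mk_mul, bp_mul_self]

theorem T3_sq_one :
    h.T3 (sg 3 1 ^ 2) = (f.1⁻¹ * (sg 3 1 ^ 2) ^ (2 * m + 1) * f.1 : Braid 3) := by
  rw [map_pow, T3_sg_one, pow_two, ← QuotientGroup.mk_mul, ← bp_mul_self]
  congr 1
  group

theorem map_T3_F2 : F2.map h.T3 = (Subgroup.closure {(sg 3 0 ^ 2) ^ (2 * m + 1),
      f.1⁻¹ * (sg 3 1 ^ 2) ^ (2 * m + 1) * f.1}).map (QuotientGroup.mk' K.sub3) := by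
  rw [F2, MonoidHom.map_closure, MonoidHom.map_closure, Set.image_pair, Set.image_pair, T3_sq_zero,
    T3_sq_one]
  rfl

variable {h}

/-- Modulo `K.sub3` the element f comes from [F_2, F_2], hence from F_2, and T maps F_2 onto its
image; the group T(F_2) is generated by the two elements named. -/
theorem IsCharming.gen_f (hc : h.IsCharming) :
    f.1 ∈ Subgroup.closure {(sg 3 0 ^ 2) ^ (2 * m + 1),
      f.1⁻¹ * (sg 3 1 ^ 2) ^ (2 * m + 1) * f.1} ⊔ K.sub3 := by
  obtain ⟨f₁, h₁, e⟩ := hc.comm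
  refine mem_sup_of_mk ?_
  rw [← h.map_T3_F2, hc.ontoF2, ← e]
  exact Subgroup.mem_map_of_mem _ (Subgroup.commutator_le_self F2 h₁)

/-- The condition in arity 2 makes x_12 a power of x_12^{2m+1} modulo `K.sub2`, and adding a strand
on the right carries this to B_3. -/
theorem IsCharming.gen_sq (hc : h.IsCharming) :
    sg 3 0 ^ 2 ∈ Subgroup.zpowers ((sg 3 0 ^ 2) ^ (2 * m + 1)) ⊔ K.sub3 := by
  have h1 : QuotientGroup.mk' K.sub2 (sg 2 0 ^ 2) ∈ (PB 2).map h.T2 := by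
    rw [hc.onto2]; exact Subgroup.mem_map_of_mem _ (sq_mem_PB (by omega))
  obtain ⟨g, hg, e⟩ := h1
  rw [PB_two] at hg
  obtain ⟨k, rfl⟩ := hg
  have e2 : h.T2 (sg 2 0 ^ 2) = ((sg 2 0 ^ 2) ^ (2 * m + 1) : Braid 2) := by
    have : h.T2 (sg 2 0) = (bp 2 m 0 : Braid 2) := lift_sg _ (by omega)
    rw [map_pow, this, pow_two, ← QuotientGroup.mk_mul, bp_mul_self]
  change h.T2 ((sg 2 0 ^ 2) ^ k) = _ at e
  rw [map_zpow, e2, ← QuotientGroup.mk_zpow] at e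
  have e3 := (QuotientGroup.eq.mp e).2.1
  simp only [map_mul, map_inv, map_zpow, map_pow, shift_sg _ (show 0 + 1 < 2 by omega)] at e3
  refine Subgroup.mem_sup_of_normal_right.mpr ⟨_, ⟨k, rfl⟩, _, e3, ?_⟩
  simp

end IsGTPair

theorem isGenuine_of_forall {N : NFI} {q : GTHeart N}
    (hq : ∀ (K : NFI) (hKN : K ≤ N), q ∈ Set.range (GTHeart.restrict hKN)) :
    IsGenuine N q.1 := by
  obtain ⟨x, hx, hx'⟩ := exists_section hq
  choose m f hp hcls hc using fun j => (x j).2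
  have hij : ∀ i j, i ≤ j → cls (N.infCore i) (m j) (f j) = cls (N.infCore i) (m i) (f i) := by
    intro i j h
    rw [← hcls i, ← hx' i j h, ← reduce_cls (N.infCore_anti h), ← hcls j]; rfl
  have S : IsPairSeq m f :=
    { pair := fun A _ _ C _ _ => by
        filter_upwards [N.eventually_sub3 A, N.eventually_sub4 C] with j h3 h4
        exact IsPairMod.mono h3 h4 ⟨(hp j).hexagon₁, (hp j).hexagon₂, (hp j).pentagon⟩
      cauchy_f := fun A _ _ => by
        obtain ⟨i, hi⟩ := (N.eventually_sub3 A).exists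
        refine ⟨(f i).1, ?_⟩
        filter_upwards [eventually_ge_atTop i] with j hj
        exact QuotientGroup.eq.mpr (hi (QuotientGroup.eq.mp (cls_eq_iff.mp (hij i j hj)).2))
      cauchy_m := fun A _ _ => by
        obtain ⟨i, hi⟩ := (N.eventually_sub3 A).exists
        refine ⟨bp 3 (m i) 0, ?_⟩
        filter_upwards [eventually_ge_atTop i] with j hj
        have := hi (zpow_mem_sub3 _ (cls_eq_iff.mp (hij i j hj)).1)
        refine QuotientGroup.eq.mpr ?_
        rw [bp, bp, mul_inv_rev, mul_assoc, inv_mul_cancel_left, ← zpow_neg, ← zpow_add, neg_add_eq_sub]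
        exact this
      gen_sq := fun A _ _ => by
        filter_upwards [N.eventually_sub3 A] with j h3
        exact sup_le_sup_left h3 _ (hc j).gen_sq
      gen_f := fun A _ _ => by
        filter_upwards [N.eventually_sub3 A] with j h3
        exact sup_le_sup_left h3 _ (hc j).gen_f }
  obtain ⟨j, h2, h3⟩ := ((S.val_beta N.sub2).and (S.val_alpha N.sub3)).exists
  refine ⟨m j, f j, S.toGTHat, ?_, h2, h3⟩
  rw [← hx j, ← reduce_cls (N.infCore_le j), ← hcls j]; rfl

end GTSh

namespace GTSh

open CategoryTheory Braid Paren Filter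

/-! ### The pure braid group on three strands -/

theorem Braid.braid_three : sg 3 0 * sg 3 1 * sg 3 0 = sg 3 1 * sg 3 0 * sg 3 1 :=
  (isBraid_sg 3).braid 0 (by omega)

/-- The half twist in `B_3`. -/
def halfTwist : Braid 3 := sg 3 0 * sg 3 1 * sg 3 0

theorem halfTwist_sq : halfTwist ^ 2 = sg 3 0 ^ 2 * (sg 3 1 * sg 3 0 ^ 2 * sg 3 1) := by
  rw [halfTwist, pow_two]
  nth_rw 2 [braid_three]
  calc sg 3 0 * sg 3 1 * sg 3 0 * (sg 3 1 * sg 3 0 * sg 3 1)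
      = sg 3 0 * (sg 3 1 * sg 3 0 * sg 3 1) * sg 3 0 * sg 3 1 := by group
    _ = _ := by rw [← braid_three, pow_two]; group

theorem halfTwist_mul_zero : halfTwist * sg 3 0 = sg 3 1 * halfTwist := by
  have h := braid_three
  calc halfTwist * sg 3 0 = (sg 3 1 * sg 3 0 * sg 3 1) * sg 3 0 := by rw [halfTwist, h]
    _ = _ := by rw [halfTwist]; group

theorem halfTwist_mul_one : halfTwist * sg 3 1 = sg 3 0 * halfTwist := by
  have h := braid_three
  calc halfTwist * sg 3 1 = sg 3 0 * (sg 3 1 * sg 3 0 * sg 3 1) := by rw [halfTwist]; group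
    _ = _ := by rw [← h, halfTwist]

theorem halfTwist_sq_comm (g : Braid 3) : Commute (halfTwist ^ 2) g := by
  have h0 : Commute (halfTwist ^ 2) (sg 3 0) := by
    change halfTwist ^ 2 * sg 3 0 = sg 3 0 * halfTwist ^ 2
    rw [pow_two, mul_assoc, halfTwist_mul_zero, ← mul_assoc, halfTwist_mul_one, mul_assoc]
  have h1 : Commute (halfTwist ^ 2) (sg 3 1) := by
    change halfTwist ^ 2 * sg 3 1 = sg 3 1 * halfTwist ^ 2
    rw [pow_two, mul_assoc, halfTwist_mul_one, ← mul_assoc, halfTwist_mul_zero, mul_assoc]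
  induction g using Braid.induction with
  | one => exact Commute.one_right _
  | gen i hi =>
    obtain rfl | rfl : i = 0 ∨ i = 1 := by omega
    · exact h0
    · exact h1
  | mul x y hx hy => exact hx.mul_right hy
  | inv x hx => exact hx.inv_right

instance zpowers_halfTwist_normal : (Subgroup.zpowers (halfTwist ^ 2)).Normal where
  conj_mem := by
    rintro _ ⟨k, rfl⟩ g
    have := ((halfTwist_sq_comm g).zpow_left k).eq
    change g * (halfTwist ^ 2) ^ k * g⁻¹ ∈ _
    rw [← this, mul_inv_cancel_right]
    exact ⟨k, rfl⟩

theorem halfTwist_sq_mem : halfTwist ^ 2 ∈ PB 3 := by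
  have h0 : adjSwap 3 0 = Equiv.swap 0 1 := rfl
  have h1 : adjSwap 3 1 = Equiv.swap 1 2 := rfl
  change rho 3 (halfTwist ^ 2) = 1
  rw [halfTwist, map_pow, map_mul, map_mul, rho_sg (by omega), rho_sg (by omega), h0, h1]
  decide

/-- The subgroup generated by `F_2` and the full twist. -/
def F2c : Subgroup (Braid 3) := F2 ⊔ Subgroup.zpowers (halfTwist ^ 2)

theorem sq_zero_mem_F2 : sg 3 0 ^ 2 ∈ F2 := Subgroup.subset_closure (Or.inl rfl)

theorem sq_one_mem_F2 : sg 3 1 ^ 2 ∈ F2 := Subgroup.subset_closure (Or.inr rfl)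

theorem F2_le_PB : F2 ≤ PB 3 := by
  rw [F2, Subgroup.closure_le]
  rintro x (rfl | rfl)
  · exact sq_mem_PB (by omega)
  · exact sq_mem_PB (by omega)

theorem F2c_conj {s : Braid 3} (h0 : s * sg 3 0 ^ 2 * s⁻¹ ∈ F2c) (h1 : s * sg 3 1 ^ 2 * s⁻¹ ∈ F2c) :
    ∀ h ∈ F2c, s * h * s⁻¹ ∈ F2c := by
  have : F2c ≤ F2c.comap (MulAut.conj s).toMonoidHom := by
    refine sup_le ((Subgroup.closure_le _).mpr ?_) (Subgroup.zpowers_le.mpr ?_)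
    · rintro x (rfl | rfl)
      · exact h0
      · exact h1
    · change s * halfTwist ^ 2 * s⁻¹ ∈ F2c
      rw [← (halfTwist_sq_comm s).eq, mul_inv_cancel_right]
      exact Subgroup.mem_sup_right (Subgroup.mem_zpowers _)
  exact fun h hh => this hh

/-- It suffices to conjugate x_12 and x_23 by the generators and their inverses. The new elements
are x_13 = x_12⁻¹ Δ² x_23⁻¹ and conjugates of it by x_12 and x_23. -/
instance F2c_normal : F2c.Normal where
  conj_mem h hh g := by
    have hb := braid_three
    have x12 : sg 3 0 ^ 2 ∈ F2c := Subgroup.mem_sup_left sq_zero_mem_F2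
    have x23 : sg 3 1 ^ 2 ∈ F2c := Subgroup.mem_sup_left sq_one_mem_F2
    have hc : halfTwist ^ 2 ∈ F2c := Subgroup.mem_sup_right (Subgroup.mem_zpowers _)
    have x13 : sg 3 1 * sg 3 0 ^ 2 * (sg 3 1)⁻¹ ∈ F2c := by
      have e : sg 3 1 * sg 3 0 ^ 2 * (sg 3 1)⁻¹ =
          (sg 3 0 ^ 2)⁻¹ * halfTwist ^ 2 * (sg 3 1 ^ 2)⁻¹ := by
        rw [halfTwist_sq]; group
      rw [e]
      exact mul_mem (mul_mem (inv_mem x12) hc) (inv_mem x23)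
    have s01 : (sg 3 0)⁻¹ * sg 3 1 * sg 3 0 = sg 3 1 * sg 3 0 * (sg 3 1)⁻¹ := by
      rw [eq_mul_inv_iff_mul_eq, mul_assoc, mul_assoc, inv_mul_eq_iff_eq_mul, ← mul_assoc, ← mul_assoc,
        hb]
    have y13 : (sg 3 0)⁻¹ * sg 3 1 ^ 2 * sg 3 0 ∈ F2c := by
      have e : (sg 3 0)⁻¹ * sg 3 1 ^ 2 * sg 3 0 = sg 3 1 * sg 3 0 ^ 2 * (sg 3 1)⁻¹ := by
        have := congrArg (· ^ 2) s01
        simp only [pow_two] at this ⊢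
        calc _ = (sg 3 0)⁻¹ * sg 3 1 * sg 3 0 * ((sg 3 0)⁻¹ * sg 3 1 * sg 3 0) := by group
          _ = _ := by rw [this]; group
      rw [e]; exact x13
    have z0 : sg 3 0 * sg 3 1 ^ 2 * (sg 3 0)⁻¹ ∈ F2c := by
      have e : sg 3 0 * sg 3 1 ^ 2 * (sg 3 0)⁻¹ =
          sg 3 0 ^ 2 * ((sg 3 0)⁻¹ * sg 3 1 ^ 2 * sg 3 0) * (sg 3 0 ^ 2)⁻¹ := by group
      rw [e]
      exact mul_mem (mul_mem x12 y13) (inv_mem x12)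
    have z1 : (sg 3 1)⁻¹ * sg 3 0 ^ 2 * sg 3 1 ∈ F2c := by
      have e : (sg 3 1)⁻¹ * sg 3 0 ^ 2 * sg 3 1 =
          (sg 3 1 ^ 2)⁻¹ * (sg 3 1 * sg 3 0 ^ 2 * (sg 3 1)⁻¹) * sg 3 1 ^ 2 := by group
      rw [e]
      exact mul_mem (mul_mem (inv_mem x23) x13) x23
    have key : ∀ g : Braid 3, (∀ h ∈ F2c, g * h * g⁻¹ ∈ F2c) ∧ ∀ h ∈ F2c, g⁻¹ * h * g ∈ F2c := by
      intro g
      induction g using Braid.induction with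
      | one => simp
      | gen i hi =>
        obtain rfl | rfl : i = 0 ∨ i = 1 := by omega
        · refine ⟨F2c_conj ?_ z0, ?_⟩
          · rwa [pow_two, ← mul_assoc, mul_inv_cancel_right, ← pow_two]
          · have := F2c_conj (s := (sg 3 0)⁻¹) (by rwa [pow_two, inv_mul_cancel_left, inv_inv, ← pow_two])
              (by rwa [inv_inv])
            rwa [inv_inv] at this
        · refine ⟨F2c_conj x13 ?_, ?_⟩
          · rwa [pow_two, ← mul_assoc, mul_inv_cancel_right, ← pow_two]
          · have := F2c_conj (s := (sg 3 1)⁻¹) (by rwa [inv_inv])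
              (by rwa [pow_two, inv_mul_cancel_left, inv_inv, ← pow_two])
            rwa [inv_inv] at this
      | mul x y hx hy =>
        refine ⟨fun h hh => ?_, fun h hh => ?_⟩
        · have := hx.1 _ (hy.1 h hh)
          simpa [mul_assoc] using this
        · have := hy.2 _ (hx.2 h hh)
          simpa [mul_assoc] using this
      | inv x hx => exact ⟨by simpa using hx.2, by simpa using hx.1⟩
    exact (key g).1 h hh

/-- Modulo `F2c` the generators are involutions a, b with aba = bab, so six words exhaust the
quotient. These words have six different permutations, so a pure braid is congruent to the empty
word. -/
theorem PB_three_le : PB 3 ≤ F2c := by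
  let a : Braid 3 ⧸ F2c := (sg 3 0 : Braid 3)
  let b : Braid 3 ⧸ F2c := (sg 3 1 : Braid 3)
  have ha : a * a = 1 := by
    have := (QuotientGroup.eq_one_iff (N := F2c) (sg 3 0 ^ 2)).mpr (Subgroup.mem_sup_left sq_zero_mem_F2)
    rw [pow_two] at this
    exact this
  have hb : b * b = 1 := by
    have := (QuotientGroup.eq_one_iff (N := F2c) (sg 3 1 ^ 2)).mpr (Subgroup.mem_sup_left sq_one_mem_F2)
    rw [pow_two] at this
    exact this
  have hab : a * b * a = b * a * b := congrArg (QuotientGroup.mk' F2c) braid_three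
  have ha' : ∀ q, a * (a * q) = q := fun q => by rw [← mul_assoc, ha, one_mul]
  have hb' : ∀ q, b * (b * q) = q := fun q => by rw [← mul_assoc, hb, one_mul]
  have hab' : b * (a * b) = a * (b * a) := by rw [← mul_assoc, ← mul_assoc, hab]
  let W : Set (Braid 3) := {1, sg 3 0, sg 3 1, sg 3 0 * sg 3 1, sg 3 1 * sg 3 0,
    sg 3 0 * (sg 3 1 * sg 3 0)}
  have hW : ∀ q : Braid 3 ⧸ F2c, (∃ w ∈ W, (w : Braid 3 ⧸ F2c) = q) ↔
      q = 1 ∨ q = a ∨ q = b ∨ q = a * b ∨ q = b * a ∨ q = a * (b * a) := by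
    intro q
    simp only [W, Set.mem_insert_iff, Set.mem_singleton_iff, exists_eq_or_imp, exists_eq_left,
      QuotientGroup.mk_mul, QuotientGroup.mk_one]
    simp only [eq_comm (b := q)]
    rfl
  have sa : ∀ q : Braid 3 ⧸ F2c,
      (q = 1 ∨ q = a ∨ q = b ∨ q = a * b ∨ q = b * a ∨ q = a * (b * a)) →
      (a * q = 1 ∨ a * q = a ∨ a * q = b ∨ a * q = a * b ∨ a * q = b * a ∨ a * q = a * (b * a)) := by
    rintro q (rfl | rfl | rfl | rfl | rfl | rfl) <;> simp only [ha', ha, mul_one, true_or, or_true]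
  have sb : ∀ q : Braid 3 ⧸ F2c,
      (q = 1 ∨ q = a ∨ q = b ∨ q = a * b ∨ q = b * a ∨ q = a * (b * a)) →
      (b * q = 1 ∨ b * q = a ∨ b * q = b ∨ b * q = a * b ∨ b * q = b * a ∨ b * q = a * (b * a)) := by
    rintro q (rfl | rfl | rfl | rfl | rfl | rfl)
    · simp only [mul_one, true_or, or_true]
    · simp only [true_or, or_true]
    · simp only [hb, true_or]
    · simp only [hab', or_true]
    · simp only [hb', true_or, or_true]
    · simp only [← hab', hb', true_or, or_true]
  -- An equivalence rather than an implication, so that the induction passes to inverses.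
  have key : ∀ (g : Braid 3) (q : Braid 3 ⧸ F2c), (∃ w ∈ W, (w : Braid 3 ⧸ F2c) = q) ↔
      ∃ w ∈ W, (w : Braid 3 ⧸ F2c) = g * q := by
    intro g
    induction g using Braid.induction with
    | one => intro q; rw [QuotientGroup.mk_one, one_mul]
    | gen i hi =>
      intro q
      rw [hW, hW]
      obtain rfl | rfl : i = 0 ∨ i = 1 := by omega
      · exact ⟨sa q, fun h => by have := sa _ h; rwa [ha'] at this⟩
      · exact ⟨sb q, fun h => by have := sb _ h; rwa [hb'] at this⟩
    | mul x y hx hy => intro q; rw [hy, hx, QuotientGroup.mk_mul, mul_assoc]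
    | inv x hx => intro q; rw [hx (((x⁻¹ : Braid 3) : Braid 3 ⧸ F2c) * q), QuotientGroup.mk_inv,
        mul_inv_cancel_left]
  intro g hg
  obtain ⟨w, hw, e⟩ := (key g 1).mp ⟨1, Or.inl rfl, rfl⟩
  rw [mul_one, QuotientGroup.eq] at e
  have hP : F2c ≤ PB 3 := sup_le F2_le_PB (Subgroup.zpowers_le.mpr halfTwist_sq_mem)
  have hw' : w ∈ PB 3 := by
    have := mul_mem hg (inv_mem (hP e))
    simpa using this
  -- Only the empty word among the six is pure.
  have hw1 : w = 1 := by
    have hr : rho 3 w = 1 := hw'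
    have h0 : adjSwap 3 0 = Equiv.swap 0 1 := rfl
    have h1 : adjSwap 3 1 = Equiv.swap 1 2 := rfl
    rcases hw with rfl | rfl | rfl | rfl | rfl | hw
    · rfl
    all_goals exfalso
    all_goals try rw [Set.mem_singleton_iff] at hw; subst hw
    all_goals
      simp only [map_mul, rho_sg (show 0 + 1 < 3 by omega), rho_sg (show 1 + 1 < 3 by omega), h0,
        h1] at hr
      exact absurd hr (by decide)
  rw [hw1, inv_one, one_mul] at e
  exact e

theorem exists_of_mem_PB_three {g : Braid 3} (hg : g ∈ PB 3) :
    ∃ w ∈ F2, ∃ k : ℤ, g = w * (halfTwist ^ 2) ^ k := by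
  obtain ⟨w, hw, z, ⟨k, rfl⟩, rfl⟩ := Subgroup.mem_sup_of_normal_right.mp (PB_three_le hg)
  exact ⟨w, hw, k, rfl⟩

/-- The abelianization of the group is generated by the images of x and y, so w agrees there with
some x^a y^b. -/
theorem exists_of_mem_closure_pair {G : Type*} [Group G] {x y w : G}
    (hw : w ∈ Subgroup.closure {x, y}) :
    ∃ (a b : ℤ), ∃ u ∈ ⁅Subgroup.closure {x, y}, Subgroup.closure {x, y}⁆, w = x ^ a * y ^ b * u := by
  let H := Subgroup.closure {x, y}
  let x' : H := ⟨x, Subgroup.subset_closure (Or.inl rfl)⟩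
  let y' : H := ⟨y, Subgroup.subset_closure (Or.inr rfl)⟩
  have key : ∃ a b : ℤ, Abelianization.of (⟨w, hw⟩ : H) =
      Abelianization.of x' ^ a * Abelianization.of y' ^ b := by
    induction hw using Subgroup.closure_induction with
    | mem w hw =>
      rcases hw with rfl | hw
      · exact ⟨1, 0, by simp [x']⟩
      · rw [Set.mem_singleton_iff] at hw
        subst hw
        exact ⟨0, 1, by simp [y']⟩
    | one => exact ⟨0, 0, (map_one (Abelianization.of (G := H))).trans (by simp)⟩
    | mul u v hu hv h1 h2 =>
      obtain ⟨a, b, h1⟩ := h1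
      obtain ⟨c, d, h2⟩ := h2
      refine ⟨a + c, b + d, ?_⟩
      have := map_mul (Abelianization.of (G := H)) ⟨u, hu⟩ ⟨v, hv⟩
      refine this.trans ?_
      rw [h1, h2, zpow_add, zpow_add]
      exact mul_mul_mul_comm _ _ _ _
    | inv u hu h1 =>
      obtain ⟨a, b, h1⟩ := h1
      refine ⟨-a, -b, ?_⟩
      have := map_inv (Abelianization.of (G := H)) ⟨u, hu⟩
      refine this.trans ?_
      rw [h1, zpow_neg, zpow_neg, mul_inv]
  obtain ⟨a, b, h⟩ := key
  refine ⟨a, b, (x ^ a * y ^ b)⁻¹ * w, ?_, by group⟩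
  rw [← Subgroup.map_subtype_commutator]
  refine ⟨(x' ^ a * y' ^ b)⁻¹ * ⟨w, hw⟩, ?_, rfl⟩
  rw [← map_zpow, ← map_zpow, ← map_mul, eq_comm, ← inv_mul_eq_one, ← map_inv, ← map_mul] at h
  exact (QuotientGroup.eq_one_iff _).mp h

end GTSh

namespace GTSh

open CategoryTheory Braid Paren Filter

/-! ### Linking numbers -/

/-- With at most one nonempty block there is nothing to cross. -/
theorem cab_eq_one_of_single {N p n : ℕ} (g : Braid n) : ∀ {w : ℕ → ℕ},
    (∀ i j, i ≠ j → w i = 0 ∨ w j = 0) → cab N p w g = 1 := by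
  have hmv : ∀ (g : Braid n) {w : ℕ → ℕ}, (∀ i j, i ≠ j → w i = 0 ∨ w j = 0) →
      ∀ i j, i ≠ j → mv g w i = 0 ∨ mv g w j = 0 := fun g w hw i j hij =>
    hw _ _ fun h => hij ((rhoN n g)⁻¹.injective h)
  induction g using Braid.induction with
  | one => intro w _; exact cab_one w
  | gen j hj =>
    intro w hw
    by_cases h : p + offs w n ≤ N
    · rw [cab_sg h hj]
      rcases hw j (j + 1) (by omega) with e | e <;> rw [e]
      · exact cross_zero_left _ _ _
      · rfl
    · exact cab_of_not h _
  | mul x y hx hy => intro w hw; rw [cab_mul, hx (hmv y hw), hy hw, one_mul]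
  | inv x hx => intro w hw; rw [cab_inv, hx (hmv x⁻¹ hw), inv_one]

theorem sz3_single (a b c : ℕ) (h : a = 0 ∧ b = 0 ∨ a = 0 ∧ c = 0 ∨ b = 0 ∧ c = 0) (i j : ℕ)
    (hij : i ≠ j) : sz3 a b c i = 0 ∨ sz3 a b c j = 0 := by
  match i, j with
  | 0, 0 => omega
  | 0, 1 => simp only [sz3]; omega
  | 0, 2 => simp only [sz3]; omega
  | 1, 0 => simp only [sz3]; omega
  | 1, 1 => omega
  | 1, 2 => simp only [sz3]; omega
  | 2, 0 => simp only [sz3]; omega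
  | 2, 1 => simp only [sz3]; omega
  | 2, 2 => omega
  | _ + 3, _ => exact .inl rfl
  | _, _ + 3 => exact .inr rfl

theorem FF_eq_one {N q a b c : ℕ} {f : PB 3}
    (h : a = 0 ∧ b = 0 ∨ a = 0 ∧ c = 0 ∨ b = 0 ∧ c = 0) : FF N f q a b c = 1 :=
  cab_eq_one_of_single _ (sz3_single a b c h)

section

variable {M : Subgroup (Braid 2)} [M.Normal] {m : ℤ} {f : PB 3}

/-- Cabling by 1, 1, 0 deletes the third strand and so measures the linking of the strands 1 and 2.
In the pentagon for the sizes 1, 1, 0, 0 this value occurs twice on one side and once on the other,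
all other factors being trivial; hence it is trivial. The two lemmas below use the sizes 0, 0, 1, 1
and 1, 0, 0, 1. -/
theorem Good.link₁₂ (h : Good M m f) : FF 2 f 0 1 1 0 ∈ M := by
  have := h.pent (q := 0) (a := 1) (x := 1) (y := 0) (z := 0) (by omega)
  simp only [zero_add, add_zero, FF_eq_one (f := f) (N := 2) (q := 1) (a := 1) (b := 0) (c := 0) (by omega),
    FF_eq_one (f := f) (N := 2) (q := 0) (a := 1 + 1) (b := 0) (c := 0) (by omega), QuotientGroup.mk_one,
    one_mul, mul_one, mul_eq_left] at this
  exact (QuotientGroup.eq_one_iff _).mp this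

theorem Good.link₂₃ (h : Good M m f) : FF 2 f 0 0 1 1 ∈ M := by
  have := h.pent (q := 0) (a := 0) (x := 0) (y := 1) (z := 1) (by omega)
  simp only [zero_add, add_zero, FF_eq_one (f := f) (N := 2) (q := 0) (a := 0) (b := 0) (c := 1) (by omega),
    FF_eq_one (f := f) (N := 2) (q := 0) (a := 0) (b := 0) (c := 1 + 1) (by omega), QuotientGroup.mk_one,
    one_mul, mul_one, mul_eq_left] at this
  exact (QuotientGroup.eq_one_iff _).mp this

theorem Good.link₁₃ (h : Good M m f) : FF 2 f 0 1 0 1 ∈ M := by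
  have := h.pent (q := 0) (a := 1) (x := 0) (y := 0) (z := 1) (by omega)
  simp only [zero_add, add_zero, FF_eq_one (f := f) (N := 2) (q := 1) (a := 0) (b := 0) (c := 1) (by omega),
    FF_eq_one (f := f) (N := 2) (q := 0) (a := 1) (b := 0) (c := 0) (by omega), QuotientGroup.mk_one,
    one_mul, mul_one, left_eq_mul] at this
  exact (QuotientGroup.eq_one_iff _).mp this

end

theorem mv_sg_zero (a b c : ℕ) : mv (sg 3 0) (sz3 a b c) = sz3 b a c := by
  rw [← mv_bp (m := 0) (by omega), mv_bp_zero]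

theorem mv_sg_one (a b c : ℕ) : mv (sg 3 1) (sz3 a b c) = sz3 a c b := by
  rw [← mv_bp (m := 0) (by omega), mv_bp_one]

theorem link_sg_zero {a b c : ℕ} (h : a + b + c ≤ 2) :
    cab 2 0 (sz3 a b c) (sg 3 0) = cross (sg 2) 0 a b := by
  rw [cab_sg (by rw [offs_sz3]; omega) (by omega)]; rfl

theorem link_sg_one {a b c : ℕ} (h : a + b + c ≤ 2) :
    cab 2 0 (sz3 a b c) (sg 3 1) = cross (sg 2) a b c := by
  rw [cab_sg (by rw [offs_sz3]; omega) (by omega)]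
  simp [offs_succ, offs_zero, sz3]

/-- The table of linking numbers: x_12 links only the strands 1, 2, x_23 only 2, 3, and the full
twist links every pair once. It determines the exponents a, b, k of a word from those of its three
linkings. -/
theorem link_values :
    cab 2 0 (sz3 1 1 0) (sg 3 0 ^ 2) = sg 2 0 ^ 2 ∧ cab 2 0 (sz3 1 1 0) (sg 3 1 ^ 2) = 1 ∧
    cab 2 0 (sz3 1 1 0) (halfTwist ^ 2) = sg 2 0 ^ 2 ∧
    cab 2 0 (sz3 0 1 1) (sg 3 0 ^ 2) = 1 ∧ cab 2 0 (sz3 0 1 1) (sg 3 1 ^ 2) = sg 2 0 ^ 2 ∧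
    cab 2 0 (sz3 0 1 1) (halfTwist ^ 2) = sg 2 0 ^ 2 ∧
    cab 2 0 (sz3 1 0 1) (sg 3 0 ^ 2) = 1 ∧ cab 2 0 (sz3 1 0 1) (sg 3 1 ^ 2) = 1 ∧
    cab 2 0 (sz3 1 0 1) (halfTwist ^ 2) = sg 2 0 ^ 2 := by
  have c0 : ∀ j b, cross (sg 2) j 0 b = 1 := fun j b => cross_zero_left _ _ _
  have c1 : ∀ j a, cross (sg 2) j a 0 = 1 := fun j a => rfl
  have c2 : cross (sg 2) 0 1 1 = sg 2 0 := by simp [cross, up]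
  simp only [halfTwist, pow_two, cab_mul, mv_mul, mv_sg_zero, mv_sg_one,
    link_sg_zero (show 1 + 1 + 0 ≤ 2 by omega), link_sg_zero (show 1 + 0 + 1 ≤ 2 by omega),
    link_sg_zero (show 0 + 1 + 1 ≤ 2 by omega), link_sg_one (show 1 + 1 + 0 ≤ 2 by omega),
    link_sg_one (show 1 + 0 + 1 ≤ 2 by omega), link_sg_one (show 0 + 1 + 1 ≤ 2 by omega), c0, c1, c2,
    one_mul, mul_one, and_self]

/-- The homomorphism `B_2 → B_3` that sends the generator to `s`. -/
def pw (s : Braid 3) : Braid 2 →* Braid 3 :=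
  lift (fun _ => s) ⟨fun _ _ _ _ => rfl, fun _ _ => rfl⟩

theorem pw_zpow (s : Braid 3) (k : ℤ) : pw s ((sg 2 0 ^ 2) ^ k) = (s ^ 2) ^ k := by
  rw [map_zpow, map_pow, pw, lift_sg _ (by omega)]

section

variable (A : Subgroup (Braid 3)) [A.Normal]

/-- The braids on two strands whose images under `σ_1 ↦ σ_1`, `σ_1 ↦ σ_2` and
`σ_1 ↦ σ_1 σ_2 σ_1` lie in `A`. -/
def roots : Subgroup (Braid 2) :=
  (A.comap (pw (sg 3 0)) ⊓ A.comap (pw (sg 3 1))) ⊓ A.comap (pw halfTwist)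

instance roots_normal : (roots A).Normal := by unfold roots; infer_instance

instance roots_finiteIndex [A.FiniteIndex] : (roots A).FiniteIndex := by
  have := finiteIndex_comap (pw (sg 3 0)) A
  have := finiteIndex_comap (pw (sg 3 1)) A
  have := finiteIndex_comap (pw halfTwist) A
  unfold roots
  infer_instance

end

/-- `roots` is designed so that a linking number which is trivial modulo it gives a trivial power of
x_12, of x_23 and of the full twist alike, modulo A. -/
theorem mem_of_zpow_mem_roots {A : Subgroup (Braid 3)} {k : ℤ} (h : (sg 2 0 ^ 2) ^ k ∈ roots A) :
    (sg 3 0 ^ 2) ^ k ∈ A ∧ (sg 3 1 ^ 2) ^ k ∈ A ∧ (halfTwist ^ 2) ^ k ∈ A := by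
  obtain ⟨⟨h1, h2⟩, h3⟩ := h
  have h1 : pw _ _ ∈ A := h1
  have h2 : pw _ _ ∈ A := h2
  have h3 : pw _ _ ∈ A := h3
  rw [pw_zpow] at h1 h2 h3
  exact ⟨h1, h2, h3⟩

/-! ### The charming conditions from the pentagon and the hexagons -/

theorem mul_comm_two (p q : Braid 2) : p * q = q * p := by
  obtain ⟨i, rfl⟩ := exists_zpow_sg_two p
  obtain ⟨j, rfl⟩ := exists_zpow_sg_two q
  rw [← zpow_add, ← zpow_add, add_comm]

/-- B_2 is abelian, so linking numbers do not see commutators. -/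
theorem map_commutator_F2 (φ : PB 3 →* Braid 2) {u : PB 3} (hu : u.1 ∈ ⁅F2, F2⁆) : φ u = 1 := by
  have h1 : ⁅F2.subgroupOf (PB 3), F2.subgroupOf (PB 3)⁆ ≤ φ.ker := by
    rw [Subgroup.commutator_le]
    intro p _ q _
    rw [MonoidHom.mem_ker, commutatorElement_def, map_mul, map_mul, map_mul, map_inv, map_inv,
      mul_comm_two (φ p)]
    group
  refine h1 ?_
  rw [← Subgroup.map_subgroupOf_eq_of_le F2_le_PB, ← Subgroup.map_commutator] at hu
  obtain ⟨v, hv, e⟩ := hu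
  obtain rfl : v = u := Subtype.ext e
  exact hv

/-- The normal form of a pure braid on three strands. The exponents are chosen once, and every
cabling to two strands is computed from them. -/
theorem exists_word (f : PB 3) : ∃ (a b k : ℤ), ∃ u ∈ ⁅F2, F2⁆,
    f.1 = (sg 3 0 ^ 2) ^ a * (sg 3 1 ^ 2) ^ b * u * (halfTwist ^ 2) ^ k ∧
    ∀ (w : ℕ → ℕ) {x y c : Braid 2}, cab 2 0 w (sg 3 0 ^ 2) = x → cab 2 0 w (sg 3 1 ^ 2) = y →
      cab 2 0 w (halfTwist ^ 2) = c → cabPB 2 0 w f = x ^ a * y ^ b * c ^ k := by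
  obtain ⟨w, hw, k, hf⟩ := exists_of_mem_PB_three f.2
  obtain ⟨a, b, u, hu, rfl⟩ := exists_of_mem_closure_pair hw
  have hu2 : u ∈ PB 3 := F2_le_PB (Subgroup.commutator_le_self F2 hu)
  refine ⟨a, b, k, u, hu, hf, fun w x y c hx hy hc => ?_⟩
  let x' : PB 3 := ⟨sg 3 0 ^ 2, sq_mem_PB (by omega)⟩
  let y' : PB 3 := ⟨sg 3 1 ^ 2, sq_mem_PB (by omega)⟩
  let c' : PB 3 := ⟨halfTwist ^ 2, halfTwist_sq_mem⟩
  have hf' : f = x' ^ a * y' ^ b * ⟨u, hu2⟩ * c' ^ k := Subtype.ext hf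
  have hx' : cabPB 2 0 w x' = x := hx
  have hy' : cabPB 2 0 w y' = y := hy
  have hc' : cabPB 2 0 w c' = c := hc
  rw [hf', map_mul, map_mul, map_mul, map_zpow, map_zpow, map_zpow, map_commutator_F2 _ (u := ⟨u, hu2⟩) hu, hx',
    hy', hc', mul_one]

/-- The three linkings of f are a + k, b + k and k, and all are trivial modulo `roots A` by the
pentagon. So the powers of x_12, x_23 and Δ² in the normal form lie in A, and only the commutator
remains. -/
theorem Good.exists_commutator {A : Subgroup (Braid 3)} [A.Normal] {m : ℤ} {f : PB 3} (h : Good (roots A) m f) :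
    ∃ u ∈ ⁅F2, F2⁆, (u : Braid 3 ⧸ A) = f.1 := by
  obtain ⟨a, b, k, u, hu, hf, hφ⟩ := exists_word f
  obtain ⟨v1, v2, v3, v4, v5, v6, v7, v8, v9⟩ := link_values
  have e12 : cabPB 2 0 (sz3 1 1 0) f ∈ roots A := h.link₁₂
  have e23 : cabPB 2 0 (sz3 0 1 1) f ∈ roots A := h.link₂₃
  have e13 : cabPB 2 0 (sz3 1 0 1) f ∈ roots A := h.link₁₃
  rw [hφ _ v1 v2 v3, one_zpow, mul_one] at e12
  rw [hφ _ v4 v5 v6, one_zpow, one_mul] at e23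
  rw [hφ _ v7 v8 v9, one_zpow, one_zpow, mul_one, one_mul] at e13
  -- The linking k is divided out of a + k, and in the next line out of b + k.
  have ha := (mem_of_zpow_mem_roots ((Subgroup.mul_mem_cancel_right _ e13).mp e12)).1
  have hb := (mem_of_zpow_mem_roots ((Subgroup.mul_mem_cancel_right _ e13).mp e23)).2.1
  have hk := (mem_of_zpow_mem_roots e13).2.2
  refine ⟨u, hu, ?_⟩
  rw [hf, QuotientGroup.mk_mul, QuotientGroup.mk_mul, QuotientGroup.mk_mul,
    (QuotientGroup.eq_one_iff _).mpr ha, (QuotientGroup.eq_one_iff _).mpr hb,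
    (QuotientGroup.eq_one_iff _).mpr hk, one_mul, one_mul, mul_one]

/-- Neither x_12 nor a conjugate of x_23 by a pure braid links the strands 1 and 3. -/
theorem link₁₃_of_mem_closure {m : ℤ} {f : PB 3} {v : Braid 3}
    (hv : v ∈ Subgroup.closure {(sg 3 0 ^ 2) ^ (2 * m + 1),
      f.1⁻¹ * (sg 3 1 ^ 2) ^ (2 * m + 1) * f.1}) :
    v ∈ PB 3 ∧ cab 2 0 (sz3 1 0 1) v = 1 := by
  obtain ⟨-, -, -, -, -, -, v7, v8, -⟩ := link_values
  let x : PB 3 := ⟨sg 3 0 ^ 2, sq_mem_PB (by omega)⟩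
  let y : PB 3 := ⟨sg 3 1 ^ 2, sq_mem_PB (by omega)⟩
  let φ := cabPB 2 0 (n := 3) (sz3 1 0 1)
  have hx : φ x = 1 := v7
  have hy : φ y = 1 := v8
  have h : Subgroup.closure {(sg 3 0 ^ 2) ^ (2 * m + 1),
      f.1⁻¹ * (sg 3 1 ^ 2) ^ (2 * m + 1) * f.1} ≤ φ.ker.map (PB 3).subtype := by
    rw [Subgroup.closure_le]
    rintro z (rfl | hz)
    · exact ⟨x ^ (2 * m + 1), by simp [MonoidHom.mem_ker, hx], rfl⟩
    · rw [Set.mem_singleton_iff] at hz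
      subst hz
      exact ⟨f⁻¹ * y ^ (2 * m + 1) * f, by simp [MonoidHom.mem_ker, hy], rfl⟩
  obtain ⟨v, hv', rfl⟩ := h hv
  exact ⟨v.2, hv'⟩

/-- The hexagons give T(σ_1σ_2) = f⁻¹⋯ and T(σ_2σ_1) = ⋯f. In the product z = σ_2σ_1·σ_1σ_2 the
element f cancels, so T(z) = z^{2m+1}. As Δ² = x_12 z with commuting factors, the claim follows. -/
theorem IsGTPair.T3_halfTwist {K : NFI} {m : ℤ} {f : PB 3} (h : IsGTPair K m f) :
    h.T3 (halfTwist ^ 2) = ((halfTwist ^ 2) ^ (2 * m + 1) : Braid 3) := by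
  have hb := braid_three
  let z : Braid 3 := sg 3 1 * sg 3 0 ^ 2 * sg 3 1
  have h1 : h.T3 (sg 3 0 * sg 3 1) = (f.1⁻¹ * (sg 3 0 * sg 3 1 * z ^ m) : Braid 3) := by
    have := h.hexagon₁
    rw [map_mul, T3_sg_zero, T3_sg_one, ← QuotientGroup.mk_mul]
    have e : sg 3 1 * sg 3 0 ^ 2 * (sg 3 1)⁻¹ * sg 3 1 ^ 2 = z := by simp only [z]; group
    rw [e] at this
    simpa only [bp, mul_assoc] using this
  have hz : sg 3 0 * sg 3 1 * z = sg 3 0 ^ 2 * (sg 3 1 * sg 3 0 ^ 2 * (sg 3 1)⁻¹) *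
      (sg 3 0 * sg 3 1) := by
    rw [← hexagon_word₂ hb]
    simp only [z, pow_two]; group
  have h2 : h.T3 (sg 3 1 * sg 3 0) = (sg 3 1 * sg 3 0 * (sg 3 0 ^ 2 *
      (sg 3 1 * sg 3 0 ^ 2 * (sg 3 1)⁻¹)) ^ m * f.1 : Braid 3) := by
    have := h.hexagon₂
    rw [map_mul, T3_sg_zero, T3_sg_one, ← QuotientGroup.mk_mul]
    simpa only [bp, mul_assoc] using this
  have hz' : sg 3 0 * sg 3 1 * z ^ m =
      (sg 3 0 ^ 2 * (sg 3 1 * sg 3 0 ^ 2 * (sg 3 1)⁻¹)) ^ m * (sg 3 0 * sg 3 1) :=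
    (show SemiconjBy (sg 3 0 * sg 3 1) z _ from hz).zpow_right m
  have h3 : h.T3 z = (z ^ (2 * m + 1) : Braid 3) := by
    have e : z = sg 3 1 * sg 3 0 * (sg 3 0 * sg 3 1) := by simp only [z, pow_two]; group
    rw [e, map_mul, h1, h2, ← QuotientGroup.mk_mul, ← e]
    congr 1
    calc _ = sg 3 1 * sg 3 0 * ((sg 3 0 ^ 2 * (sg 3 1 * sg 3 0 ^ 2 * (sg 3 1)⁻¹)) ^ m *
          (sg 3 0 * sg 3 1)) * z ^ m := by group
      _ = sg 3 1 * sg 3 0 * (sg 3 0 * sg 3 1) * z ^ m * z ^ m := by rw [← hz']; group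
      _ = _ := by rw [← e]; group
  have hcomm : Commute (sg 3 0 ^ 2) z := by
    have h4 := halfTwist_sq_comm (sg 3 0 ^ 2)
    rw [halfTwist_sq] at h4
    have h5 : sg 3 0 ^ 2 * z * sg 3 0 ^ 2 = sg 3 0 ^ 2 * (sg 3 0 ^ 2 * z) := h4.eq
    exact (mul_left_cancel ((mul_assoc _ _ _).symm.trans h5)).symm
  rw [halfTwist_sq, map_mul, T3_sq_zero, hcomm.mul_zpow]
  exact congrArg _ h3

/-- An element w of F_2 has a preimage v Δ^{2k} in PB_3 modulo L, with v in F_2. Neither w nor T(v)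
links the strands 1 and 3, so the linking of T(Δ^{2k}) is trivial modulo `roots K.sub3`. Hence this
power of Δ² lies in `K.sub3`, and v alone is a preimage modulo K. -/
theorem IsGTPair.map_F2 {K L : NFI} (hLK : L ≤ K) {m : ℤ} {f : PB 3} (h : IsGTPair L m f)
    (h3 : L.sub3 ≤ pull (roots K.sub3) 3)
    (honto : (PB 3).map h.T3 = (PB 3).map (QuotientGroup.mk' L.sub3))
    (hcomm : ∃ u ∈ ⁅F2, F2⁆, (u : Braid 3 ⧸ K.sub3) = f.1) :
    F2.map (h.mono hLK).T3 = F2.map (QuotientGroup.mk' K.sub3) := by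
  obtain ⟨u, hu, hf⟩ := hcomm
  have hu : u ∈ F2 := Subgroup.commutator_le_self F2 hu
  refine le_antisymm ?_ ?_
  · rw [F2, MonoidHom.map_closure, Subgroup.closure_le, Set.image_pair, T3_sq_zero, T3_sq_one]
    rintro q (rfl | hq)
    · exact ⟨_, zpow_mem sq_zero_mem_F2 _, rfl⟩
    · rw [Set.mem_singleton_iff] at hq
      -- Modulo `K.sub3` the pure braid f may be replaced by its representative u in F_2.
      refine ⟨u⁻¹ * (sg 3 1 ^ 2) ^ (2 * m + 1) * u,
        mul_mem (mul_mem (inv_mem hu) (zpow_mem sq_one_mem_F2 _)) hu, ?_⟩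
      rw [hq]
      simp only [QuotientGroup.mk'_apply, QuotientGroup.mk_mul, QuotientGroup.mk_inv, hf]
  · rintro _ ⟨w, hw, rfl⟩
    have h1 : QuotientGroup.mk' L.sub3 w ∈ (PB 3).map h.T3 := by
      rw [honto]; exact Subgroup.mem_map_of_mem _ (F2_le_PB hw)
    obtain ⟨g, hg, e⟩ := h1
    obtain ⟨v, hv, k, rfl⟩ := exists_of_mem_PB_three hg
    have hv' : h.T3 v ∈ F2.map h.T3 := Subgroup.mem_map_of_mem _ hv
    rw [h.map_T3_F2] at hv'
    obtain ⟨v', hv', e'⟩ := hv'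
    rw [map_mul, map_zpow, T3_halfTwist, ← e'] at e
    have e2 := QuotientGroup.eq.mp (e : ((v' * ((halfTwist ^ 2) ^ (2 * m + 1)) ^ k : Braid 3) :
      Braid 3 ⧸ L.sub3) = w)
    -- Deleting the second strand reads off the linking of the strands 1 and 3; the depth of L makes
    -- the congruence survive this.
    have e3 := cab_mk_eq (p := 0) (M := roots K.sub3) (sz3 1 0 1) (QuotientGroup.eq.mpr (h3 e2))
    have hc : ((halfTwist ^ 2) ^ (2 * m + 1)) ^ k ∈ PB 3 := zpow_mem (zpow_mem halfTwist_sq_mem _) _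
    have hw' : cab 2 0 (sz3 1 0 1) w = 1 :=
      -- For m = 0 and f = 1 the group of that lemma is F_2 itself.
      (link₁₃_of_mem_closure (m := 0) (f := 1) (v := w) (by simpa [F2] using hw)).2
    have hcv : cab 2 0 (sz3 1 0 1) (((halfTwist ^ 2) ^ (2 * m + 1)) ^ k) =
        (sg 2 0 ^ 2) ^ ((2 * m + 1) * k) := by
      let c : PB 3 := ⟨halfTwist ^ 2, halfTwist_sq_mem⟩
      have hφ : cabPB 2 0 (sz3 1 0 1) c = sg 2 0 ^ 2 := link_values.2.2.2.2.2.2.2.2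
      have : cabPB 2 0 (sz3 1 0 1) ((c ^ (2 * m + 1)) ^ k) = (sg 2 0 ^ 2) ^ ((2 * m + 1) * k) := by
        rw [map_zpow, map_zpow, hφ, ← zpow_mul]
      exact this
    rw [cab_mul_pure _ _ hc, (link₁₃_of_mem_closure hv').2, one_mul, hcv, hw', QuotientGroup.mk_one,
      QuotientGroup.eq_one_iff] at e3
    have e4 := (mem_of_zpow_mem_roots e3).2.2
    rw [zpow_mul] at e4
    refine ⟨v, hv, ?_⟩
    have hT : (h.mono hLK).T3 v = (v' : Braid 3) := by
      have : (h.mono hLK).T3 = (QuotientGroup.map L.sub3 K.sub3 (MonoidHom.id _)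
          (NFI.sub3_mono hLK)).comp h.T3 := hom_ext fun i hi => by
        rw [T3, lift_sg _ hi, MonoidHom.comp_apply, T3, lift_sg _ hi]; rfl
      rw [this, MonoidHom.comp_apply, ← e']; rfl
    have e5 : ((v' * ((halfTwist ^ 2) ^ (2 * m + 1)) ^ k : Braid 3) : Braid 3 ⧸ K.sub3) = w :=
      QuotientGroup.eq.mpr (NFI.sub3_mono hLK e2)
    rw [QuotientGroup.mk_mul, (QuotientGroup.eq_one_iff _).mpr e4, mul_one] at e5
    rw [hT, e5]; rfl

end GTSh

namespace GTSh

open CategoryTheory Braid Paren Filter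

/-! ### The values of an automorphism of the completed operad -/

namespace GTHat

variable (T : GTHat) {n k : ℕ}

/-- The value at an identity is idempotent, hence trivial in each finite quotient group. -/
theorem map_id (a : PaB n) : T.toHomeo a a (.of (𝟙 a)) = .of (𝟙 a) := by
  have h := T.map_comp (.of (𝟙 a)) (.of (𝟙 a))
  have e : (ProHom.of (𝟙 a)).comp (.of (𝟙 a)) = .of (𝟙 a) :=
    congrArg ProHom.of (Category.comp_id (𝟙 a))
  rw [e] at h
  refine ProHom.ext_md fun j => ?_
  have h2 := congrArg (ProHom.md (core n j)) h
  rw [ProHom.md_comp, left_eq_mul] at h2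
  rw [h2]; rfl

/-- Two morphisms with the same shapes and the same braid differ by a relabelling, and T commutes
with relabellings. So values of T can be treated as depending on parenthesizations and braids alone.
-/
theorem md_congr {a b a' b' : PaB n} {M : Subgroup (Braid n)} [M.Normal] [M.FiniteIndex]
    (f : a ⟶ b) (f' : a' ⟶ b') (ha : a.shape = a'.shape) (hb : b.shape = b'.shape)
    (e : f.1 = f'.1) :
    (T.toHomeo a b (.of f)).md M = (T.toHomeo a' b' (.of f')).md M := by
  obtain ⟨t, ht, π⟩ := a
  obtain ⟨s, hs, τ⟩ := b
  obtain ⟨t', ht', π'⟩ := a'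
  obtain ⟨s', hs', τ'⟩ := b'
  obtain rfl : t = t' := ha
  obtain rfl : s = s' := hb
  obtain ⟨θ, rfl⟩ : ∃ θ, π' = θ * π := ⟨π' * π⁻¹, by group⟩
  have h1 : rho n f.1 = τ⁻¹ * π := f.2
  have h2 : rho n f'.1 = τ'⁻¹ * (θ * π) := f'.2
  obtain rfl : τ' = θ * τ := by
    rw [← e, h1, ← mul_assoc, mul_left_inj, inv_eq_iff_eq_inv, mul_inv_rev, inv_inv] at h2
    rw [h2]; group
  obtain rfl : f' = (PaB.act θ).map f := Subtype.ext e.symm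
  have := congrArg (ProHom.md M) (T.map_act θ (.of f))
  rw [ProHom.md_act] at this
  exact this.symm

/-- The value of `T` on a braid from `t` to `t'`, modulo `M`. -/
noncomputable def tv (M : Subgroup (Braid n)) [M.Normal] [M.FiniteIndex] (t t' : Paren)
    (g : Braid n) : Braid n ⧸ M :=
  if h : t.size = n ∧ t'.size = n then
    (T.toHomeo ⟨t, h.1, 1⟩ ⟨t', h.2, (rho n g)⁻¹⟩ (.of (PaB.ofBraid g (by simp)))).md M
  else 1

variable {M : Subgroup (Braid n)} [M.Normal] [M.FiniteIndex]

theorem md_of {a b : PaB n} (f : a ⟶ b) :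
    (T.toHomeo a b (.of f)).md M = T.tv M a.shape b.shape f.1 := by
  rw [tv, dif_pos ⟨a.size_eq, b.size_eq⟩]
  exact T.md_congr _ _ rfl rfl rfl

theorem tv_mul (t t' t'' : Paren) (ht : t.size = n) (ht' : t'.size = n) (ht'' : t''.size = n)
    (g g' : Braid n) : T.tv M t t'' (g' * g) = T.tv M t' t'' g' * T.tv M t t' g := by
  let a : PaB n := ⟨t, ht, 1⟩
  let b : PaB n := ⟨t', ht', (rho n g)⁻¹⟩
  let c : PaB n := ⟨t'', ht'', (rho n (g' * g))⁻¹⟩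
  let f : a ⟶ b := PaB.ofBraid g (by simp [a, b])
  let f' : b ⟶ c := PaB.ofBraid g' (by simp [b, c])
  have h := congrArg (ProHom.md M) (T.map_comp (.of f) (.of f'))
  rw [ProHom.md_comp, md_of, md_of] at h
  exact (T.md_of (f ≫ f')).symm.trans h

theorem tv_one {t : Paren} (ht : t.size = n) : T.tv M t t 1 = 1 := by
  have := T.tv_mul (M := M) t t t ht ht ht 1 1
  rw [mul_one, left_eq_mul] at this
  exact this

theorem tv_one_symm (t t' : Paren) (ht : t.size = n) (ht' : t'.size = n) :
    T.tv M t' t 1 = (T.tv M t t' 1)⁻¹ := by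
  have := T.tv_mul (M := M) t t' t ht ht' ht 1 1
  rw [mul_one, tv_one _ ht] at this
  exact eq_inv_of_mul_eq_one_left this.symm

theorem tv_conj (t t' : Paren) (ht : t.size = n) (ht' : t'.size = n) (g : Braid n) :
    T.tv M t t g = (T.tv M t t' 1)⁻¹ * T.tv M t' t' g * T.tv M t t' 1 := by
  rw [← T.tv_one_symm t t' ht ht', ← T.tv_mul _ _ _ ht' ht' ht, ← T.tv_mul _ _ _ ht ht' ht, one_mul,
    mul_one]

theorem rhoQ_tv (hM : M ≤ PB n) {t t' : Paren} (ht : t.size = n) (ht' : t'.size = n)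
    (g : Braid n) : rhoQ hM (T.tv M t t' g) = rho n g := by
  rw [tv, dif_pos ⟨ht, ht'⟩, ProHom.rhoQ_md]; simp

/-- The braids are dense in the completion, and T is continuous and onto: a braid close enough to
the preimage of y has the same value as y modulo M. -/
theorem exists_tv {t t' : Paren} (ht : t.size = n) (ht' : t'.size = n) (y : Braid n) :
    ∃ g, T.tv M t t' g = y := by
  let a : PaB n := ⟨t, ht, 1⟩
  let b : PaB n := ⟨t', ht', (rho n y)⁻¹⟩
  let δ : ProHom a b := .of (PaB.ofBraid y (by simp [a, b]))
  have hU : IsOpen (T.toHomeo a b ⁻¹' {γ | γ.md M = y}) :=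
    (ProHom.isOpen_md _).preimage (T.toHomeo a b).continuous
  obtain ⟨g, hg⟩ := ProHom.exists_md_of_open hU (γ := (T.toHomeo a b).symm δ) (by
    change (T.toHomeo a b ((T.toHomeo a b).symm δ)).md M = y
    rw [Homeomorph.apply_symm_apply]; rfl)
  exact ⟨g.1, (T.md_of g).symm.trans hg⟩

/-- An insertion with an identity as the outer factor; T fixes the identity, so only the inner value
remains. `tv_cable` exchanges the roles. -/
theorem tv_blockShift {M : Subgroup (Braid (n + k))} [M.Normal] [M.FiniteIndex]
    {L : Subgroup (Braid (k + 1))} [L.Normal] [L.FiniteIndex] (p : Fin n)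
    (hLM : L ≤ M.comap (blockShift k p)) {s : Paren} (hs : s.size = n) {t t' : Paren}
    (ht : t.size = k + 1) (ht' : t'.size = k + 1) {g y : Braid (k + 1)}
    (hy : T.tv L t t' g = y) :
    T.tv M (graft t s p) (graft t' s p) (blockShift k p g) = blockShift k p y := by
  let a : PaB n := ⟨s, hs, 1⟩
  let b : PaB (k + 1) := ⟨t, ht, 1⟩
  let b' : PaB (k + 1) := ⟨t', ht', (rho (k + 1) g)⁻¹⟩
  let f : b ⟶ b' := PaB.ofBraid g (by simp [b, b'])
  have h := T.map_ins p (.of (𝟙 a)) (.of f)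
  rw [map_id] at h
  have e : (ProHom.of (𝟙 a)).ins p (.of f) = .of ((PaB.insRight p a).map f) := by
    refine congrArg ProHom.of (?_ : (PaB.insRight p a).map f ≫ (PaB.insLeft p b').map (𝟙 a) = _)
    exact (congrArg _ ((PaB.insLeft p b').map_id a)).trans (Category.comp_id _)
  rw [e] at h
  obtain ⟨z, h1, h2⟩ := (T.toHomeo b b' (.of f)).exists_md_map (PaB.insRight p a) M L
  have h3 := (T.md_of (M := M) ((PaB.insRight p a).map f)).symm.trans (congrArg (ProHom.md M) h)
  have h4 : (T.toHomeo b b' (.of f)).md L = y := (T.md_of f).trans hy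
  rw [h2] at h4
  refine h3.trans ((ProHom.md_comp _ _).trans ?_)
  have h5 : ((ProHom.of (𝟙 a)).map (PaB.insLeft p b')).md M = 1 := by
    change (((PaB.insLeft p b').map (𝟙 a)).1 : Braid (n + k) ⧸ M) = 1
    rw [(PaB.insLeft p b').map_id]; rfl
  refine (congrArg₂ (· * ·) h5 h1).trans ((one_mul _).trans ?_)
  exact congrArg (QuotientGroup.map L M (blockShift k p) hLM) h4

theorem tv_cable {M : Subgroup (Braid (n + k))} [M.Normal] [M.FiniteIndex]
    {L : Subgroup (Braid n)} [L.Normal] [L.FiniteIndex] (hLP : L ≤ PB n)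
    (hLM : ∀ p : Fin n, ∀ x ∈ L, cable k p x ∈ M) {u : Paren} (hu : u.size = k + 1) {t t' : Paren}
    (ht : t.size = n) (ht' : t'.size = n) {g y : Braid n} (hy : T.tv L t t' g = y) (p : Fin n) :
    T.tv M (graft u t p) (graft u t' (rho n g p)) (cable k p g) = cable k p y := by
  let a : PaB n := ⟨t, ht, 1⟩
  let a' : PaB n := ⟨t', ht', (rho n g)⁻¹⟩
  let b : PaB (k + 1) := ⟨u, hu, 1⟩
  let f : a ⟶ a' := PaB.ofBraid g (by simp [a, a'])
  have h := T.map_ins p (.of f) (.of (𝟙 b))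
  rw [map_id] at h
  have e : (ProHom.of f).ins p (.of (𝟙 b)) = .of ((PaB.insLeft p b).map f) := by
    refine congrArg ProHom.of (?_ : (PaB.insRight p a).map (𝟙 b) ≫ (PaB.insLeft p b).map f = _)
    exact (congrArg (· ≫ (PaB.insLeft p b).map f) ((PaB.insRight p a).map_id b)).trans
      (Category.id_comp _)
  rw [e] at h
  obtain ⟨z, h1, h2⟩ := (T.toHomeo a a' (.of f)).exists_md_map (PaB.insLeft p b) M L
  have h3 := (T.md_of (M := M) ((PaB.insLeft p b).map f)).symm.trans (congrArg (ProHom.md M) h)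
  have h4 : (T.toHomeo a a' (.of f)).md L = y := (T.md_of f).trans hy
  rw [h2] at h4
  refine h3.trans ((ProHom.md_comp _ _).trans ?_)
  have h5 : ((ProHom.of (𝟙 b)).map (PaB.insRight p a)).md M = 1 := by
    change (((PaB.insRight p a).map (𝟙 b)).1 : Braid (n + k) ⧸ M) = 1
    rw [(PaB.insRight p a).map_id]; rfl
  refine (congrArg₂ (· * ·) h1 h5).trans ((mul_one _).trans ?_)
  exact cable_mk_eq hLP hLM p h4

/-- A homomorphism given by the values of `T` maps the pure braids onto the pure braids. -/
theorem map_PB (hM : M ≤ PB n) {t : Paren} (ht : t.size = n) {φ : Braid n →* Braid n ⧸ M}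
    (hφ : ∀ i, i + 1 < n → T.tv M t t (sg n i) = φ (sg n i)) :
    (PB n).map φ = (PB n).map (QuotientGroup.mk' M) := by
  let ψ : Braid n →* Braid n ⧸ M :=
    { toFun := T.tv M t t, map_one' := T.tv_one ht, map_mul' := fun g h => T.tv_mul t t t ht ht ht h g }
  obtain rfl : ψ = φ := hom_ext hφ
  -- Values have the permutation of the argument, so surjectivity on all braids restricts to
  -- surjectivity on pure braids.
  have hr : ∀ g, rhoQ hM (ψ g) = rho n g := T.rhoQ_tv hM ht ht
  refine le_antisymm ?_ ?_
  · rintro _ ⟨g, hg, rfl⟩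
    obtain ⟨y, hy⟩ := QuotientGroup.mk_surjective (ψ g)
    refine ⟨y, ?_, hy⟩
    have := hr g
    rw [← hy] at this
    exact this.trans hg
  · rintro _ ⟨y, hy, rfl⟩
    obtain ⟨g, hg⟩ := T.exists_tv (M := M) ht ht y
    refine ⟨g, ?_, hg⟩
    have := hr g
    rw [show ψ g = y from hg] at this
    exact this.symm.trans hy

end GTHat

/-! ### Pairs given by an automorphism of the completed operad -/

theorem exists_betaMor (h : PaB.ob12 ⟶ PaB.ob21) : ∃ m, h = PaB.betaMor m := by
  have h0 : adjSwap 2 0 = Equiv.swap 0 1 := rfl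
  have hr : rho 2 h.1 = (Equiv.swap 0 1)⁻¹ * 1 := h.2
  have : (sg 2 0)⁻¹ * h.1 ∈ PB 2 := by
    change rho 2 _ = 1
    rw [map_mul, map_inv, rho_sg (by omega), h0, hr]; decide
  rw [PB_two] at this
  obtain ⟨m, hm⟩ := this
  exact ⟨m, Subtype.ext (inv_mul_eq_iff_eq_mul.mp hm.symm)⟩

theorem exists_alphaMor (h : PaB.ob12_3 ⟶ PaB.ob1_23) : ∃ f, h = PaB.alphaMor f :=
  ⟨⟨h.1, h.2.trans (inv_mul_cancel 1)⟩, rfl⟩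

theorem shift_shift_one (x : Braid 2) :
    shift (N := 4) 1 (by omega) (shift (N := 3) 1 (by omega) x) = shift 2 (by omega) x := by
  have : (shift (N := 4) 1 (by omega)).comp (shift (m := 2) (N := 3) 1 (by omega)) =
      shift 2 (by omega) := hom_ext fun i hi => by
    rw [MonoidHom.comp_apply, shift_sg _ hi, shift_sg _ (by omega), shift_sg _ hi]
    congr 1; omega
  exact congrArg (· x) this

/-- `T` has the values `β · x_{12}^m` and `α · f` on `β` and `α`, modulo `K`. -/
structure IsValue (T : GTHat) (K : NFI) (m : ℤ) (f : PB 3) : Prop where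
  beta : T.tv K.sub2 (node leaf leaf) (node leaf leaf) (sg 2 0) = (bp 2 m 0 : Braid 2)
  alpha : T.tv K.sub3 (node (node leaf leaf) leaf) (node leaf (node leaf leaf)) 1 = (f.1 : Braid 3)

namespace IsValue

variable {T : GTHat} {K : NFI} {m : ℤ} {f : PB 3}

instance (K : NFI) : Subgroup.Normal (G := Braid (1 + 1)) K.sub2 := K.sub2_normal

instance (K : NFI) : Subgroup.FiniteIndex (G := Braid (1 + 1)) K.sub2 := K.sub2_finiteIndex

instance (K : NFI) : Subgroup.Normal (G := Braid (2 + 1)) K.sub3 := K.sub3_normal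

instance (K : NFI) : Subgroup.FiniteIndex (G := Braid (2 + 1)) K.sub3 := K.sub3_finiteIndex

instance (K : NFI) : Subgroup.Normal (G := Braid (2 + 2)) K.sub4 := K.normal

instance (K : NFI) : Subgroup.FiniteIndex (G := Braid (2 + 2)) K.sub4 := K.finiteIndex

theorem sub2_le_PB (K : NFI) : K.sub2 ≤ PB 2 := fun _ h => h.1

theorem sub3_le_PB (K : NFI) : K.sub3 ≤ PB 3 := fun _ h => h.1

theorem sub2_cable (K : NFI) (p : Fin 2) (x : Braid 2) (hx : x ∈ K.sub2) :
    cable 1 p x ∈ K.sub3 := hx.2.2.2 p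

theorem sub3_cable (K : NFI) (p : Fin 3) (x : Braid 3) (hx : x ∈ K.sub3) :
    cable 1 p x ∈ K.sub4 := hx.2.2.2 p

theorem gen₁ (h : IsValue T K m f) : T.tv K.sub3 (node (node leaf leaf) leaf)
    (node (node leaf leaf) leaf) (sg 3 0) = (bp 3 m 0 : Braid 3) := by
  have := T.tv_blockShift (n := 2) (k := 1) (M := K.sub3) (L := K.sub2) 0 (fun x hx => hx.2.1)
    (s := node leaf leaf) rfl rfl rfl h.beta
  rw [blockShift_sg _ (by omega)] at this
  exact this.trans (congrArg _ (shift_bp (k := 2) (N := 3) (p := 0) (by omega) (by omega)))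

theorem gen₂ (h : IsValue T K m f) : T.tv K.sub3 (node leaf (node leaf leaf))
    (node leaf (node leaf leaf)) (sg 3 1) = (bp 3 m 1 : Braid 3) := by
  have := T.tv_blockShift (n := 2) (k := 1) (M := K.sub3) (L := K.sub2) 1 (fun x hx => hx.2.2.1)
    (s := node leaf leaf) rfl rfl rfl h.beta
  rw [blockShift_sg _ (by omega)] at this
  exact this.trans (congrArg _ (shift_bp (k := 2) (N := 3) (p := 1) (by omega) (by omega)))

theorem gen₂_left (h : IsValue T K m f) : T.tv K.sub3 (node (node leaf leaf) leaf)
    (node (node leaf leaf) leaf) (sg 3 1) = (f.1⁻¹ * bp 3 m 1 * f.1 : Braid 3) := by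
  rw [T.tv_conj (M := K.sub3) (node (node leaf leaf) leaf) (node leaf (node leaf leaf)) rfl rfl, h.gen₂, h.alpha]
  rfl

/-- The braid σ_1σ_2 at (12)3 is evaluated in two ways: as a product of generators, and as the
doubled braiding (12)3 → 3(12) followed by a move of parentheses back. -/
theorem hexagon₁ (h : IsValue T K m f) :
    ((sg 3 0 * (sg 3 0 ^ 2) ^ m * f.1⁻¹ * sg 3 1 * (sg 3 1 ^ 2) ^ m * f.1 : Braid 3) :
      Braid 3 ⧸ K.sub3) =
    ((f.1⁻¹ * sg 3 0 * sg 3 1 * ((sg 3 1 * sg 3 0 ^ 2 * (sg 3 1)⁻¹) * sg 3 1 ^ 2) ^ m : Braid 3) :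
      Braid 3 ⧸ K.sub3) := by
  have hc := T.tv_cable (n := 2) (k := 1) (M := K.sub3) (sub2_le_PB K) (sub2_cable K)
    (u := node leaf leaf) rfl rfl rfl h.beta 0
  rw [rho_sg (by omega)] at hc
  have hc' : T.tv K.sub3 (node (node leaf leaf) leaf) (node leaf (node leaf leaf))
      (sg 3 0 * sg 3 1) = (cable 1 (0 : Fin 2) (bp 2 m 0) : Braid 3) := by
    rw [← cable_sg_zero]; exact hc
  have e1 := T.tv_mul (M := K.sub3) (node (node leaf leaf) leaf)
    (node (node leaf leaf) leaf) (node (node leaf leaf) leaf)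
    rfl rfl rfl     (sg 3 1) (sg 3 0)
  have e2 := T.tv_mul (M := K.sub3) (node (node leaf leaf) leaf)
    (node leaf (node leaf leaf)) (node (node leaf leaf) leaf)
    rfl rfl rfl     (sg 3 0 * sg 3 1) 1
  rw [one_mul, e1, h.gen₁, h.gen₂_left, hc', 
    T.tv_one_symm (M := K.sub3) (node (node leaf leaf) leaf) (node leaf (node leaf leaf)) rfl rfl, h.alpha, cable_bp_zero] at e2
  have e3 : ((bp 3 m 0 * (f.1⁻¹ * bp 3 m 1 * f.1) : Braid 3) : Braid 3 ⧸ K.sub3) =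
      (f.1⁻¹ * (sg 3 0 * sg 3 1 * (sg 3 1 * sg 3 0 ^ 2 * (sg 3 1)⁻¹ * sg 3 1 ^ 2) ^ m) : Braid 3) := e2
  simpa only [bp, mul_assoc] using e3

theorem hexagon₂ (h : IsValue T K m f) :
    ((f.1⁻¹ * sg 3 1 * (sg 3 1 ^ 2) ^ m * f.1 * sg 3 0 * (sg 3 0 ^ 2) ^ m : Braid 3) :
      Braid 3 ⧸ K.sub3) =
    ((sg 3 1 * sg 3 0 * (sg 3 0 ^ 2 * (sg 3 1 * sg 3 0 ^ 2 * (sg 3 1)⁻¹)) ^ m * f.1 : Braid 3) :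
      Braid 3 ⧸ K.sub3) := by
  have hc := T.tv_cable (n := 2) (k := 1) (M := K.sub3) (sub2_le_PB K) (sub2_cable K)
    (u := node leaf leaf) rfl rfl rfl h.beta 1
  rw [rho_sg (by omega)] at hc
  have hc' : T.tv K.sub3 (node leaf (node leaf leaf)) (node (node leaf leaf) leaf)
      (sg 3 1 * sg 3 0) = (cable 1 (1 : Fin 2) (bp 2 m 0) : Braid 3) := by
    rw [← cable_sg_one]; exact hc
  have e1 := T.tv_mul (M := K.sub3) (node (node leaf leaf) leaf)
    (node (node leaf leaf) leaf) (node (node leaf leaf) leaf)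
    rfl rfl rfl     (sg 3 0) (sg 3 1)
  have e2 := T.tv_mul (M := K.sub3) (node (node leaf leaf) leaf)
    (node leaf (node leaf leaf)) (node (node leaf leaf) leaf)
    rfl rfl rfl     1 (sg 3 1 * sg 3 0)
  rw [mul_one, e1, h.gen₁, h.gen₂_left, hc', h.alpha, cable_bp_one] at e2
  have e3 : ((f.1⁻¹ * bp 3 m 1 * f.1 * bp 3 m 0 : Braid 3) : Braid 3 ⧸ K.sub3) =
      (sg 3 1 * sg 3 0 * (sg 3 0 ^ 2 * (sg 3 1 * sg 3 0 ^ 2 * (sg 3 1)⁻¹)) ^ m * f.1 : Braid 3) := e2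
  simpa only [bp, mul_assoc] using e3

theorem phi₁₂_₃_₄ (h : IsValue T K m f) :
    T.tv K.sub4 (node (node (node leaf leaf) leaf) leaf) (node (node leaf leaf) (node leaf leaf))
      1 = (phi12_3_4 f.1 : Braid 4) := by
  have := T.tv_cable (n := 3) (k := 1) (M := K.sub4) (sub3_le_PB K) (sub3_cable K)
    (u := node leaf leaf) rfl rfl rfl h.alpha 0
  rw [cable_one, _root_.map_one (rho 3)] at this
  exact this

/-- The unit braid from ((12)3)4 to 1(2(34)) is evaluated along the two paths of moves around the
pentagon. -/
theorem pentagon (h : IsValue T K m f) :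
    ((phi234 f.1 * phi1_23_4 f.1 * phi123 f.1 : Braid 4) : Braid 4 ⧸ K.sub4) =
    ((phi1_2_34 f.1 * phi12_3_4 f.1 : Braid 4) : Braid 4 ⧸ K.sub4) := by
  have h123 : T.tv K.sub4 (node (node (node leaf leaf) leaf) leaf)
      (node (node leaf (node leaf leaf)) leaf) 1 = (phi123 f.1 : Braid 4) := by
    have := T.tv_blockShift (n := 2) (k := 2) (M := K.sub4) (L := K.sub3) 0 (fun x hx => hx.2.1)
      (s := node leaf leaf) rfl rfl rfl h.alpha
    rw [_root_.map_one] at this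
    exact this
  have h234 : T.tv K.sub4 (node leaf (node (node leaf leaf) leaf))
      (node leaf (node leaf (node leaf leaf))) 1 = (phi234 f.1 : Braid 4) := by
    have := T.tv_blockShift (n := 2) (k := 2) (M := K.sub4) (L := K.sub3) 1 (fun x hx => hx.2.2.1)
      (s := node leaf leaf) rfl rfl rfl h.alpha
    rw [_root_.map_one] at this
    exact this
  have h1_23_4 : T.tv K.sub4 (node (node leaf (node leaf leaf)) leaf)
      (node leaf (node (node leaf leaf) leaf)) 1 = (phi1_23_4 f.1 : Braid 4) := by
    have := T.tv_cable (n := 3) (k := 1) (M := K.sub4) (sub3_le_PB K) (sub3_cable K)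
      (u := node leaf leaf) rfl rfl rfl h.alpha 1
    rw [cable_one, _root_.map_one (rho 3)] at this
    exact this
  have h1_2_34 : T.tv K.sub4 (node (node leaf leaf) (node leaf leaf))
      (node leaf (node leaf (node leaf leaf))) 1 = (phi1_2_34 f.1 : Braid 4) := by
    have := T.tv_cable (n := 3) (k := 1) (M := K.sub4) (sub3_le_PB K) (sub3_cable K)
      (u := node leaf leaf) rfl rfl rfl h.alpha 2
    rw [cable_one, _root_.map_one (rho 3)] at this
    exact this
  have e1 := T.tv_mul (M := K.sub4) (node (node (node leaf leaf) leaf) leaf)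
    (node (node leaf leaf) (node leaf leaf)) (node leaf (node leaf (node leaf leaf)))
    rfl rfl rfl 1 1
  have e2 := T.tv_mul (M := K.sub4) (node (node (node leaf leaf) leaf) leaf)
    (node leaf (node (node leaf leaf) leaf)) (node leaf (node leaf (node leaf leaf)))
    rfl rfl rfl 1 1
  have e3 := T.tv_mul (M := K.sub4) (node (node (node leaf leaf) leaf) leaf)
    (node (node leaf (node leaf leaf)) leaf) (node leaf (node (node leaf leaf) leaf))
    rfl rfl rfl 1 1
  rw [mul_one] at e1 e2 e3
  rw [e2, e3, h234, h1_23_4, h123, h1_2_34, h.phi₁₂_₃_₄, ← mul_assoc] at e1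
  exact e1

theorem isGTPair (h : IsValue T K m f) : IsGTPair K m f := ⟨h.hexagon₁, h.hexagon₂, h.pentagon⟩

/-- At (12)(34) the last two strands are enclosed, so the value of σ_3 comes from β; the move to
this parenthesization conjugates it. -/
theorem gen₄ (h : IsValue T K m f) : T.tv K.sub4 (node (node (node leaf leaf) leaf) leaf)
    (node (node (node leaf leaf) leaf) leaf) (sg 4 2) =
      ((phi12_3_4 f.1)⁻¹ * bp 4 m 2 * phi12_3_4 f.1 : Braid 4) := by
  have h2 := T.tv_blockShift (n := 3) (k := 1) (M := K.sub4) (L := K.sub2) 2 (fun x hx => by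
    change shift 2 _ x ∈ K.sub4
    rw [← shift_shift_one]
    exact hx.2.2.1.2.2.1) (s := node (node leaf leaf) leaf) rfl rfl rfl h.beta
  rw [blockShift_sg _ (by omega)] at h2
  have h2' : T.tv K.sub4 (node (node leaf leaf) (node leaf leaf))
      (node (node leaf leaf) (node leaf leaf)) (sg 4 2) = (bp 4 m 2 : Braid 4) :=
    h2.trans (congrArg _ (shift_bp (k := 2) (N := 4) (p := 2) (by omega) (by omega)))
  rw [T.tv_conj (M := K.sub4) (node (node (node leaf leaf) leaf) leaf)
    (node (node leaf leaf) (node leaf leaf)) rfl rfl, h2', h.phi₁₂_₃_₄]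
  rfl

theorem isShadow (h : IsValue T K m f) : h.isGTPair.IsShadow where
  onto2 := T.map_PB (sub2_le_PB K) (t := node leaf leaf) rfl fun i hi => by
    obtain rfl : i = 0 := by omega
    rw [h.beta, IsGTPair.T2, lift_sg _ hi]; rfl
  onto3 := T.map_PB (sub3_le_PB K) (t := node (node leaf leaf) leaf) rfl fun i hi => by
    obtain rfl | rfl : i = 0 ∨ i = 1 := by omega
    · rw [h.gen₁, IsGTPair.T3_sg_zero]
    · rw [h.gen₂_left, IsGTPair.T3_sg_one]
  onto4 := T.map_PB K.le_PB (t := node (node (node leaf leaf) leaf) leaf) rfl fun i hi => by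
    have hs : ∀ {i : ℕ} {y : Braid 3}, i + 1 < 3 → T.tv K.sub3 (node (node leaf leaf) leaf)
        (node (node leaf leaf) leaf) (sg 3 i) = y →
        T.tv K.sub4 (node (node (node leaf leaf) leaf) leaf)
          (node (node (node leaf leaf) leaf) leaf) (sg 4 i) =
            (shift (N := 4) 0 (by omega) y : Braid 4) := by
      intro i y hi hy
      have := T.tv_blockShift (n := 2) (k := 2) (M := K.sub4) (L := K.sub3) 0 (fun x hx => hx.2.1)
        (s := node leaf leaf) rfl rfl rfl hy
      rw [blockShift_sg _ hi, show ((0 : Fin 2) : ℕ) + i = i by simp] at this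
      exact this
    rw [IsGTPair.T4, lift_sg _ hi]
    obtain rfl | rfl | rfl : i = 0 ∨ i = 1 ∨ i = 2 := by omega
    · rw [hs (by omega) h.gen₁, shift_bp _ (by omega)]; rfl
    · rw [hs (by omega) h.gen₂_left, map_mul, map_mul, map_inv, shift_bp _ (by omega)]; rfl
    · rw [h.gen₄]; rfl

end IsValue

theorem isValue_of_val {T : GTHat} {K : NFI} {m : ℤ} {f : PB 3}
    (hβ : (T.toHomeo _ _ (ProHom.of (PaB.betaMor 0))).val (relOf K.sub2) = ⟦PaB.betaMor m⟧)
    (hα : (T.toHomeo _ _ (ProHom.of (PaB.alphaMor 1))).val (relOf K.sub3) = ⟦PaB.alphaMor f⟧) :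
    IsValue T K m f where
  beta := by
    have h := (T.md_of (M := K.sub2) (PaB.betaMor 0)).symm.trans (ProHom.md_eq hβ)
    have e : (PaB.betaMor 0).1 = sg 2 0 := by
      change sg 2 0 * (sg 2 0 ^ 2) ^ (0 : ℤ) = _
      rw [zpow_zero, mul_one]
    rw [e] at h
    exact h
  alpha := (T.md_of (M := K.sub3) (PaB.alphaMor 1)).symm.trans (ProHom.md_eq hα)

/-- The pair given by T modulo L is a shadow at once, but the charming conditions are only obtained
after reduction to K. Hence L is taken below K and deep enough for the linking numbers modulo `roots
K.sub3`. -/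
theorem exists_restrict_of_isGenuine {N : NFI} {q : GTHeart N} (hq : IsGenuine N q.1) (K : NFI)
    (hKN : K ≤ N) : q ∈ Set.range (GTHeart.restrict hKN) := by
  obtain ⟨m₀, f₀, T, hcls, hβ, hα⟩ := hq
  -- At this depth the relations modulo L hold for all cablings to two strands, modulo `roots
  -- K.sub3`.
  obtain ⟨j, h3, h4⟩ := ((K.eventually_sub3 (pull (roots K.sub3) 3)).and
    (K.eventually_sub4 (pull (roots K.sub3) 4))).exists
  let L := K.infCore j
  have hLK : L ≤ K := K.infCore_le j
  have hLN : L ≤ N := (show L.sub4 ≤ K.sub4 from hLK).trans hKN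
  obtain ⟨b, hb⟩ := Quotient.exists_rep
    ((T.toHomeo _ _ (ProHom.of (PaB.betaMor 0))).val (relOf L.sub2))
  obtain ⟨a, ha⟩ := Quotient.exists_rep
    ((T.toHomeo _ _ (ProHom.of (PaB.alphaMor 1))).val (relOf L.sub3))
  obtain ⟨m, rfl⟩ := exists_betaMor b
  obtain ⟨f, rfl⟩ := exists_alphaMor a
  have hv := isValue_of_val hb.symm ha.symm
  have hp := hv.isGTPair
  have hs := hv.isShadow
  have hcomm : ∃ u ∈ ⁅F2, F2⁆, (u : Braid 3 ⧸ K.sub3) = f.1 :=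
    Good.exists_commutator (m := m) (IsPairMod.mono h3 h4 ⟨hp.hexagon₁, hp.hexagon₂, hp.pentagon⟩)
  have hc : (hp.mono hLK).IsCharming :=
    { onto4 := IsGTPair.map_T hLK _ _ _ hs.onto4
      onto3 := IsGTPair.map_T (NFI.sub3_mono hLK) _ _ _ hs.onto3
      onto2 := IsGTPair.map_T (NFI.sub2_mono hLK) (fun _ => sg 2 0 * (sg 2 0 ^ 2) ^ m) _ _ hs.onto2
      comm := hcomm
      ontoF2 := hp.map_F2 hLK h3 hs.onto3 hcomm }
  refine ⟨⟨cls K m f, m, f, hp.mono hLK, rfl, hc⟩, Subtype.ext ?_⟩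
  change reduce hKN (cls K m f) = q.1
  rw [reduce_cls, hcls, cls_eq_iff]
  -- Both pairs are values of the same T, so they agree modulo N.
  have hb' := ProHom.val_eq_of_le (relOf_mono (NFI.sub2_mono hLN)) hb.symm
  have ha' := ProHom.val_eq_of_le (relOf_mono (NFI.sub3_mono hLN)) ha.symm
  rw [hβ] at hb'
  rw [hα] at ha'
  constructor
  · have h5 : (bp 2 m 0)⁻¹ * bp 2 m₀ 0 ∈ N.sub2 :=
      QuotientGroup.leftRel_apply.mp (Quotient.exact (s := (relOf N.sub2).rel _ _) hb'.symm)
    rw [bp, bp, mul_inv_rev, mul_assoc, inv_mul_cancel_left, ← zpow_neg, ← zpow_add,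
      neg_add_eq_sub] at h5
    exact h5
  · exact QuotientGroup.eq.mpr (QuotientGroup.leftRel_apply.mp (Quotient.exact (s := (relOf N.sub3).rel _ _) ha'.symm))

end GTSh

theorem corollary3p12 (N : GTSh.NFI) (q : GTSh.GTHeart N) :
    GTSh.IsGenuine N q.1 ↔
      ∀ (K : GTSh.NFI) (hKN : K ≤ N), q ∈ Set.range (GTSh.GTHeart.restrict hKN) :=
  ⟨GTSh.exists_restrict_of_isGenuine, GTSh.isGenuine_of_forall⟩
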